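/- **Definitions.** Let $\Sigma$ be a finite alphabet. For a finite set $V$ of variables, let $\Gamma_V$ consist of two extra symbols ${\vdash_x}$ ("open $x$") and ${\dashv_x}$ ("close $x$") for each $x\in V$. A *vset-automaton* is a tuple $A=(V,Q,q_0,q_f,\delta)$ with finite state set $Q$, $q_0,q_f\in Q$ and $\delta\colon Q\times(\Sigma\cup\{\epsilon\}\cup\Gamma_V)\to 2^Q$; its transitions are the triples $(p,a,q)$ with $q\in\delta(p,a)$. Let $\mathcal R(A)\subseteq(\Sigma\cup\Gamma_V)^*$ be the set of labels of paths from $q_0$ to $q_f$. A word $r\in(\Sigma\cup\Gamma_V)^*$ is *valid* if, for every $x\in V$, it contains ${\vdash_x}$ exactly once and ${\dashv_x}$ exactly once, the former before the latter. $A$ is *functional* if every $r\in\mathcal R(A)$ is valid. Let $\mathrm{clr}$ be the morphism that erases the symbols of $\Gamma_V$. A *span* of a string $s\in\Sigma^*$ is a pair $[i,j\rangle$ with $1\le i\le j\le|s|+1$. A valid $r$ with $\mathrm{clr}(r)=s$ defines the tuple $\mu^r$ that maps each $x\in V$ to the span $[i,j\rangle$ of $s$, where $r=r_1{\vdash_x}r_2{\dashv_x}r_3$,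 $i=|\mathrm{clr}(r_1)|+1$, $j=i+|\mathrm{clr}(r_2)|$. Finally, $[\![A]\!](s)=\{\mu^r \mid r\in\mathcal R(A)\text{ valid},\ \mathrm{clr}(r)=s\}$. **Theorem.** Fix a finite alphabet $\Sigma$. There is an algorithm for the unit-cost RAM with words of $O(\log N)$ bits, where $N$ is the input size (number of states, variables and transitions plus $|s|$), that, given a functional vset-automaton $A$ over $\Sigma$ with $n$ states and $m$ transitions and a string $s\in\Sigma^*$, prints every element of $[\![A]\!](s)$ exactly once and then halts, such that * the time until the first answer (or until the algorithm halts, if there is no answer) is $O(n^2(|s|+1)+mn)$, and * the time between two consecutive answers, and between the last answer and halting, is $O(n^2(|s|+1))$. The implied constants depend only on $\Sigma$. -/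

import Mathlib

/-! ### Strings, spans, ref-words -/

/-- A span `[left, right⟩` of the string `s`, with `1 ≤ left ≤ right ≤ |s| + 1`. -/
@[ext]
structure Span {S : Type*} (s : List S) where
  left : ℕ
  right : ℕ
  one_le_left : 1 ≤ left
  left_le_right : left ≤ right
  right_le : right ≤ s.length + 1

/-- A `(V, s)`-tuple: a map from the variables to spans of `s`. -/
abbrev SpanTuple {S : Type*} (V : Type*) (s : List S) := V → Span s

/-- The extended alphabet: terminal letters, and for every variable `x` one symbol that opens `x`
and one symbol that closes `x`. -/
inductive RefSymbol (S V : Type*) where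
  | letter (a : S)
  | opens (x : V)
  | closes (x : V)
  deriving DecidableEq

/-- The morphism that erases the variable operations and keeps the terminal letters. -/
def clean {S V : Type*} (r : List (RefSymbol S V)) : List S :=
  r.filterMap fun
    | .letter a => some a
    | .opens _ => none
    | .closes _ => none

/-- A ref-word is valid if every variable is opened exactly once and closed exactly once, and is
opened before it is closed. -/
def ValidRefWord {S V : Type*} [DecidableEq S] [DecidableEq V] (r : List (RefSymbol S V)) : Prop :=
  ∀ x : V, r.count (.opens x) = 1 ∧ r.count (.closes x) = 1 ∧
    ∃ r₁ r₂ r₃, r = r₁ ++ .opens x :: (r₂ ++ .closes x :: r₃)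

/-- `IsTupleOf r μ` says that `μ` is the tuple that the ref-word `r` describes: if
`r = r₁ · (open x) · r₂ · (close x) · r₃` then `μ x = [i, j⟩` with `i = |clean r₁| + 1` and
`j = i + |clean r₂|`. (For a valid `r` this factorization is unique, so `μ` is determined.) -/
def IsTupleOf {S V : Type*} {s : List S} (r : List (RefSymbol S V)) (μ : SpanTuple V s) : Prop :=
  ∀ x : V, ∃ r₁ r₂ r₃, r = r₁ ++ .opens x :: (r₂ ++ .closes x :: r₃) ∧
    (μ x).left = (clean r₁).length + 1 ∧ (μ x).right = (μ x).left + (clean r₂).length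

/-! ### Variable-set automata -/

/-- A vset-automaton with terminal alphabet `S`, variables `V` and states `Q`. The label `none` of
a transition is the empty word. -/
structure VSetAutomaton (S V Q : Type*) where
  start : Q
  final : Q
  δ : Q → Option (RefSymbol S V) → Set Q

namespace VSetAutomaton

variable {S V Q : Type*}

/-- The automaton as an `ε`-NFA over the extended alphabet. -/
def toEpsNFA (A : VSetAutomaton S V Q) : εNFA (RefSymbol S V) Q where
  step := A.δ
  start := {A.start}
  accept := {A.final}

/-- The ref-word language: the labels of the paths from the initial to the final state. -/
def refLanguage (A : VSetAutomaton S V Q) : Language (RefSymbol S V) :=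
  A.toEpsNFA.accepts

/-- The automaton is functional if every ref-word that it accepts is valid. -/
def Functional [DecidableEq S] [DecidableEq V] (A : VSetAutomaton S V Q) : Prop :=
  ∀ r ∈ A.refLanguage, ValidRefWord r

/-- The relation `⟦A⟧(s)`: the tuples of those valid ref-words of `A` that `clean` maps to `s`. -/
def spanRelation [DecidableEq S] [DecidableEq V] (A : VSetAutomaton S V Q) (s : List S) :
    Set (SpanTuple V s) :=
  {μ | ∃ r ∈ A.refLanguage, ValidRefWord r ∧ clean r = s ∧ IsTupleOf r μ}

/-- The transitions (labelled edges) of the automaton. -/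
def transitions (A : VSetAutomaton S V Q) : Set (Q × Option (RefSymbol S V) × Q) :=
  {t | t.2.2 ∈ A.δ t.1 t.2.1}

/-- The number of transitions. -/
noncomputable def numTransitions (A : VSetAutomaton S V Q) : ℕ :=
  A.transitions.ncard

end VSetAutomaton

/-! ### A unit-cost RAM with bounded words

The store has registers and finitely many random-access arrays (those that a program mentions),
all holding natural numbers. There is a write-only output. Programs are built from assignments,
array stores and output operations by sequencing, branching and loops. Every operation, every
memory access and every test costs one time unit. Arithmetic is done modulo `2 ^ w`, where `w` is
the word size. -/

namespace RAM

/-- Expressions over the registers and the arrays. -/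
inductive Expr where
  | const (c : ℕ)
  | reg (r : ℕ)
  | load (arr : ℕ) (idx : Expr)
  | add (a b : Expr)
  | sub (a b : Expr)
  | mul (a b : Expr)
  | lt (a b : Expr)
  | eq (a b : Expr)

/-- Programs. `write e` appends the word `e` to the answer that is being printed, and `emit`
completes that answer. -/
inductive Cmd where
  | skip
  | assign (r : ℕ) (e : Expr)
  | store (arr : ℕ) (idx e : Expr)
  | write (e : Expr)
  | emit
  | seq (p q : Cmd)
  | branch (e : Expr) (p q : Cmd)
  | loop (e : Expr) (p : Cmd)

/-- A state of the machine. The expressions can read only `reg` and `mem`. The field `buf` holds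
the words of the answer that is being printed, `clock` the elapsed time, and `log` the completed
answers in chronological order, each with the time of its completion. -/
structure State where
  reg : ℕ → ℕ
  mem : ℕ → ℕ → ℕ
  buf : List ℕ
  clock : ℕ
  log : List (ℕ × List ℕ)

/-- The state at time zero: the input is in array `0`, all other words are zero. -/
def State.init (input : List ℕ) : State where
  reg := fun _ => 0
  mem := fun arr i => if arr = 0 then input.getD i 0 else 0
  buf := []
  clock := 0
  log := []

/-- Let `t` time units pass. -/
def State.tick (σ : State) (t : ℕ) : State := { σ with clock := σ.clock + t }

/-- The value of an expression with word size `w`; subtraction is truncated at zero, and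
comparisons have the value `1` or `0`. -/
def Expr.eval (w : ℕ) (σ : State) : Expr → ℕ
  | .const c => c % 2 ^ w
  | .reg r => σ.reg r
  | .load arr idx => σ.mem arr (idx.eval w σ)
  | .add a b => (a.eval w σ + b.eval w σ) % 2 ^ w
  | .sub a b => a.eval w σ - b.eval w σ
  | .mul a b => (a.eval w σ * b.eval w σ) % 2 ^ w
  | .lt a b => if a.eval w σ < b.eval w σ then 1 else 0
  | .eq a b => if a.eval w σ = b.eval w σ then 1 else 0

/-- The time to evaluate an expression: the number of its operations and accesses. -/
def Expr.cost : Expr → ℕ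
  | .const _ => 1
  | .reg _ => 1
  | .load _ idx => idx.cost + 1
  | .add a b => a.cost + b.cost + 1
  | .sub a b => a.cost + b.cost + 1
  | .mul a b => a.cost + b.cost + 1
  | .lt a b => a.cost + b.cost + 1
  | .eq a b => a.cost + b.cost + 1

/-- `Exec w p σ τ`: started in the state `σ` with word size `w`, the program `p` terminates in the
state `τ`. -/
inductive Exec (w : ℕ) : Cmd → State → State → Prop
  | skip (σ : State) : Exec w .skip σ (σ.tick 1)
  | assign (r : ℕ) (e : Expr) (σ : State) :
      Exec w (.assign r e) σ
        { σ.tick (e.cost + 1) with reg := Function.update σ.reg r (e.eval w σ) }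
  | store (arr : ℕ) (idx e : Expr) (σ : State) :
      Exec w (.store arr idx e) σ
        { σ.tick (idx.cost + e.cost + 1) with
          mem := Function.update σ.mem arr
            (Function.update (σ.mem arr) (idx.eval w σ) (e.eval w σ)) }
  | write (e : Expr) (σ : State) :
      Exec w (.write e) σ { σ.tick (e.cost + 1) with buf := σ.buf ++ [e.eval w σ] }
  | emit (σ : State) :
      Exec w .emit σ
        { σ.tick 1 with buf := [], log := σ.log ++ [(σ.clock + 1, σ.buf)] }
  | seq {p q : Cmd} {σ τ υ : State} : Exec w p σ τ → Exec w q τ υ → Exec w (.seq p q) σ υ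
  | branch_true {e : Expr} {p q : Cmd} {σ τ : State} : e.eval w σ ≠ 0 →
      Exec w p (σ.tick (e.cost + 1)) τ → Exec w (.branch e p q) σ τ
  | branch_false {e : Expr} {p q : Cmd} {σ τ : State} : e.eval w σ = 0 →
      Exec w q (σ.tick (e.cost + 1)) τ → Exec w (.branch e p q) σ τ
  | loop_true {e : Expr} {p : Cmd} {σ τ υ : State} : e.eval w σ ≠ 0 →
      Exec w p (σ.tick (e.cost + 1)) τ → Exec w (.loop e p) τ υ → Exec w (.loop e p) σ υ
  | loop_false {e : Expr} {p : Cmd} {σ : State} : e.eval w σ = 0 →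
      Exec w (.loop e p) σ (σ.tick (e.cost + 1))

/-- On the given input, with word size `w`, the program terminates and prints exactly the given
answers in the given order. The first answer (or termination, if there is no answer) comes after
at most `pre` time units. From each answer to the next one, and from the last answer to
termination, at most `delay` time units pass. -/
def Enumerates (w : ℕ) (p : Cmd) (input : List ℕ) (answers : List (List ℕ)) (pre delay : ℕ) :
    Prop :=
  ∃ τ : State, Exec w p (State.init input) τ ∧ τ.buf = [] ∧ τ.log.map Prod.snd = answers ∧
    (∀ t ∈ (τ.log.map Prod.fst ++ [τ.clock]).head?, t ≤ pre) ∧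
    (τ.log.map Prod.fst ++ [τ.clock]).IsChain (fun t t' => t' ≤ t + delay)

end RAM

/-! ### Input and output formats -/

/-- The label of a transition as two words: its kind and its letter or variable. -/
def encodeLabel {k v : ℕ} : Option (RefSymbol (Fin k) (Fin v)) → List ℕ
  | none => [0, 0]
  | some (.letter a) => [1, a]
  | some (.opens x) => [2, x]
  | some (.closes x) => [3, x]

/-- The input of the machine, for an automaton with states `0, …, n - 1`, variables
`0, …, v - 1`, letters `0, …, k - 1`, the list `ts` of its transitions, and a string `s`. -/
def encodeInput {k v n : ℕ} (A : VSetAutomaton (Fin k) (Fin v) (Fin n))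
    (ts : List (Fin n × Option (RefSymbol (Fin k) (Fin v)) × Fin n)) (s : List (Fin k)) : List ℕ :=
  [n, v, ts.length, s.length, (A.start : ℕ), (A.final : ℕ)] ++
    ts.flatMap (fun t => [(t.1 : ℕ)] ++ encodeLabel t.2.1 ++ [(t.2.2 : ℕ)]) ++
    s.map (fun a => (a : ℕ))

/-- An answer is printed as the endpoints of the spans of the variables `0, …, v - 1`. -/
def encodeTuple {S : Type*} {v : ℕ} {s : List S} (μ : SpanTuple (Fin v) s) : List ℕ :=
  (List.finRange v).flatMap fun x => [(μ x).left, (μ x).right]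

/-- The word size for inputs of size `N`: logarithmic in `N`, with the constant factor `c`. -/
def wordSize (c N : ℕ) : ℕ := c * (Nat.log 2 N + 1)

/-! In a functional automaton, let two paths lead from the initial state to the same state `q`, and
let the final state be reachable from `q`. Both prefixes become valid words when completed by a
common suffix, so they apply the same number of operations (0, 1 or 2) to every variable
(`opCount_eq_of_valid`). Such a state therefore carries a status vector. Conversely, the spans of a
tuple are determined by the statuses in the `|s| + 1` gaps of `s`, one before each letter and one at
the end (`ValidRefWord.opCount_gapPrefix`, `StatusesOf.unique`). With a number (key) for each status
vector, the tuples correspond one-to-one to the words of `|s| + 1` keys along the runs that pick, in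
each gap, the state from which the gap is left (`exists_tuples_of_words`).

These runs are the paths of a layered graph: level `0` is the initial state, level `i + 1` belongs
to gap `i`, and an edge is a silent path, preceded above level `0` by a letter
(`HoldsInput.gapRun_iff`). Different paths may spell the same word. The search is therefore a
lexicographic depth-first search over sets of nodes: all nodes that can be reached while spelling
the current prefix are kept together, so each word is met once. Nodes from which the end cannot be
reached are left out, so a descent never fails. A step at one level takes time `O(n²)`; between two
answers the search goes back over at most all levels and then forward again, which gives the delay
`O(n²(|s| + 1))`.

The tables are computed in time `O(n²(|s| + 1) + mn)`: silent closure by a search over pairs of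
states, letter relations by copying rows of the closure, statuses by propagation, keys by a trie,
live nodes by backward induction. The terms with the number `v` of variables are absorbed by `v ≤
n`: on an accepting path, prefixes with different numbers of operations end in different states
(`card_le_of_valid`). If `v > n` there is no answer and the program halts at once.

The arrays hold: 0 the input; 1, 2 heads and links of the adjacency lists; 3 the edge relations, in
blocks of `n²` cells; 4, 5 the queue of pairs; 6 marks; 7 statuses; 8 the trie; 9 keys; 10 live
nodes; 11 the node set of each level; 12 the key chosen at each level; 13 candidates; 14 a state
with the chosen key; 15 the block used by each level. -/

namespace RAM

/-! ### Evaluation without overflow -/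

/-- The value of the comparison `x < y`. -/
def ltVal (x y : ℕ) : ℕ := if x < y then 1 else 0

/-- The value of the comparison `x = y`. -/
def eqVal (x y : ℕ) : ℕ := if x = y then 1 else 0

@[simp] theorem ltVal_def (x y : ℕ) : ltVal x y = if x < y then 1 else 0 := rfl

@[simp] theorem eqVal_def (x y : ℕ) : eqVal x y = if x = y then 1 else 0 := rfl

/-- The value of an expression in unbounded arithmetic. -/
def Expr.val (σ : State) : Expr → ℕ
  | .const c => c
  | .reg r => σ.reg r
  | .load arr idx => σ.mem arr (idx.val σ)
  | .add a b => a.val σ + b.val σ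
  | .sub a b => a.val σ - b.val σ
  | .mul a b => a.val σ * b.val σ
  | .lt a b => ltVal (a.val σ) (b.val σ)
  | .eq a b => eqVal (a.val σ) (b.val σ)

/-- The number of values of a word of `w` bits. -/
def modulus (w : ℕ) : ℕ := 2 ^ w

/-- No operation in the evaluation of the expression exceeds the bound `B`. -/
def Expr.Fits (B : ℕ) (σ : State) : Expr → Prop
  | .const c => c < B
  | .reg _ => True
  | .load _ idx => idx.Fits B σ
  | .add a b => a.Fits B σ ∧ b.Fits B σ ∧ a.val σ + b.val σ < B
  | .sub a b => a.Fits B σ ∧ b.Fits B σ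
  | .mul a b => a.Fits B σ ∧ b.Fits B σ ∧ a.val σ * b.val σ < B
  | .lt a b => a.Fits B σ ∧ b.Fits B σ
  | .eq a b => a.Fits B σ ∧ b.Fits B σ

/-- Truncated subtraction, comparisons and memory accesses cannot overflow, so only constants, sums
and products need a bound. From here on programs are analysed in unbounded arithmetic. -/
theorem Expr.eval_eq_val {w : ℕ} {σ : State} (e : Expr) (h : e.Fits (modulus w) σ) :
    e.eval w σ = e.val σ := by
  induction e with
  | const c => exact Nat.mod_eq_of_lt h
  | reg r => rfl
  | load arr idx ih => simp only [Expr.eval, Expr.val, ih h]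
  | add a b iha ihb =>
    simp only [Expr.eval, Expr.val, iha h.1, ihb h.2.1]
    exact Nat.mod_eq_of_lt h.2.2
  | sub a b iha ihb => simp only [Expr.eval, Expr.val, iha h.1, ihb h.2]
  | mul a b iha ihb =>
    simp only [Expr.eval, Expr.val, iha h.1, ihb h.2.1]
    exact Nat.mod_eq_of_lt h.2.2
  | lt a b iha ihb => simp only [Expr.eval, Expr.val, iha h.1, ihb h.2, ltVal]
  | eq a b iha ihb => simp only [Expr.eval, Expr.val, iha h.1, ihb h.2, eqVal]

/-! ### State updates -/

/-- Set a register and let time pass. -/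
def State.setReg (σ : State) (r x t : ℕ) : State :=
  { σ.tick t with reg := Function.update σ.reg r x }

/-- Set an array cell and let time pass. -/
def State.setMem (σ : State) (arr i x t : ℕ) : State :=
  { σ.tick t with mem := Function.update σ.mem arr (Function.update (σ.mem arr) i x) }

/-- Append a word to the answer that is being printed and let time pass. -/
def State.put (σ : State) (x t : ℕ) : State :=
  { σ.tick t with buf := σ.buf ++ [x] }

section simps
variable (σ : State) (r x t arr i : ℕ)

@[simp] theorem State.tick_reg : (σ.tick t).reg = σ.reg := rfl
@[simp] theorem State.tick_mem : (σ.tick t).mem = σ.mem := rfl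
@[simp] theorem State.tick_buf : (σ.tick t).buf = σ.buf := rfl
@[simp] theorem State.tick_log : (σ.tick t).log = σ.log := rfl
@[simp] theorem State.tick_clock : (σ.tick t).clock = σ.clock + t := rfl
@[simp] theorem State.setReg_reg (r' : ℕ) :
    (σ.setReg r x t).reg r' = if r' = r then x else σ.reg r' := Function.update_apply ..
@[simp] theorem State.setReg_mem : (σ.setReg r x t).mem = σ.mem := rfl
@[simp] theorem State.setReg_buf : (σ.setReg r x t).buf = σ.buf := rfl
@[simp] theorem State.setReg_log : (σ.setReg r x t).log = σ.log := rfl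
@[simp] theorem State.setReg_clock : (σ.setReg r x t).clock = σ.clock + t := rfl
@[simp] theorem State.setMem_mem (a : ℕ) : (σ.setMem arr i x t).mem a =
    if a = arr then Function.update (σ.mem arr) i x else σ.mem a := Function.update_apply ..
@[simp] theorem State.setMem_reg : (σ.setMem arr i x t).reg = σ.reg := rfl
@[simp] theorem State.setMem_buf : (σ.setMem arr i x t).buf = σ.buf := rfl
@[simp] theorem State.setMem_log : (σ.setMem arr i x t).log = σ.log := rfl
@[simp] theorem State.setMem_clock : (σ.setMem arr i x t).clock = σ.clock + t := rfl
@[simp] theorem State.put_reg : (σ.put x t).reg = σ.reg := rfl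
@[simp] theorem State.put_mem : (σ.put x t).mem = σ.mem := rfl
@[simp] theorem State.put_buf : (σ.put x t).buf = σ.buf ++ [x] := rfl
@[simp] theorem State.put_log : (σ.put x t).log = σ.log := rfl
@[simp] theorem State.put_clock : (σ.put x t).clock = σ.clock + t := rfl

end simps

/-! ### Frames -/

/-- The registers that a program may modify. -/
def Cmd.regs : Cmd → List ℕ
  | .assign r _ => [r]
  | .seq p q => p.regs ++ q.regs
  | .branch _ p q => p.regs ++ q.regs
  | .loop _ p => p.regs
  | _ => []

/-- The arrays that a program may modify. -/
def Cmd.arrs : Cmd → List ℕ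
  | .store a _ _ => [a]
  | .seq p q => p.arrs ++ q.arrs
  | .branch _ p q => p.arrs ++ q.arrs
  | .loop _ p => p.arrs
  | _ => []

/-- Whether a program has output operations. -/
def Cmd.prints : Cmd → Bool
  | .write _ => true
  | .emit => true
  | .seq p q => p.prints || q.prints
  | .branch _ p q => p.prints || q.prints
  | .loop _ p => p.prints
  | _ => false

/-- Whether a program may complete an answer. -/
def Cmd.emits : Cmd → Bool
  | .emit => true
  | .seq p q => p.emits || q.emits
  | .branch _ p q => p.emits || q.emits
  | .loop _ p => p.emits
  | _ => false

/-- What a run of a program from `σ` to `τ` leaves unchanged for syntactic reasons. -/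
structure Frame (p : Cmd) (σ τ : State) : Prop where
  reg : ∀ r, r ∉ p.regs → τ.reg r = σ.reg r
  mem : ∀ a, a ∉ p.arrs → τ.mem a = σ.mem a
  buf : p.prints = false → τ.buf = σ.buf
  log : p.emits = false → τ.log = σ.log
  clock : σ.clock ≤ τ.clock

theorem Frame.refl (p : Cmd) (σ : State) : Frame p σ σ :=
  ⟨fun _ _ => rfl, fun _ _ => rfl, fun _ => rfl, fun _ => rfl, le_rfl⟩

theorem Frame.trans {p : Cmd} {σ τ υ : State} (h : Frame p σ τ) (h' : Frame p τ υ) :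
    Frame p σ υ :=
  ⟨fun r hr => (h'.reg r hr).trans (h.reg r hr), fun a ha => (h'.mem a ha).trans (h.mem a ha),
    fun hp => (h'.buf hp).trans (h.buf hp), fun hp => (h'.log hp).trans (h.log hp),
    h.clock.trans h'.clock⟩

theorem Frame.mono {p q : Cmd} {σ τ : State} (h : Frame p σ τ) (hr : p.regs ⊆ q.regs)
    (ha : p.arrs ⊆ q.arrs) (hp : q.prints = false → p.prints = false)
    (he : q.emits = false → p.emits = false) : Frame q σ τ :=
  ⟨fun r h' => h.reg r fun h'' => h' (hr h''), fun a h' => h.mem a fun h'' => h' (ha h''),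
    fun h' => h.buf (hp h'), fun h' => h.log (he h'), h.clock⟩

theorem Frame.tick (p : Cmd) (σ : State) (t : ℕ) : Frame p σ (σ.tick t) :=
  ⟨fun _ _ => rfl, fun _ _ => rfl, fun _ => rfl, fun _ => rfl, Nat.le_add_right _ _⟩

theorem Frame.setReg {p : Cmd} {r : ℕ} (h : r ∈ p.regs) (σ : State) (x t : ℕ) :
    Frame p σ (σ.setReg r x t) :=
  ⟨fun r' h' => by rw [State.setReg_reg, if_neg]; rintro rfl; exact h' h, fun _ _ => rfl,
    fun _ => rfl, fun _ => rfl, Nat.le_add_right _ _⟩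

/-- The syntactic footprint of a program. It lets every specification below speak only of the cells
that matter; that the others are unchanged is decided by computation on the program text. -/
theorem Exec.frame {w : ℕ} {p : Cmd} {σ τ : State} (h : Exec w p σ τ) : Frame p σ τ := by
  induction h with
  | skip σ => exact Frame.tick _ _ _
  | assign r e σ => exact Frame.setReg (by simp [Cmd.regs]) σ _ _
  | store a i e σ =>
    refine ⟨fun _ _ => rfl, fun a' h' => ?_, fun _ => rfl, fun _ => rfl, Nat.le_add_right _ _⟩
    exact Function.update_of_ne (by simpa [Cmd.arrs] using h') _ _
  | write e σ =>
    exact ⟨fun _ _ => rfl, fun _ _ => rfl, fun h => by simp [Cmd.prints] at h, fun _ => rfl,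
      Nat.le_add_right _ _⟩
  | emit σ =>
    exact ⟨fun _ _ => rfl, fun _ _ => rfl, fun h => by simp [Cmd.prints] at h,
      fun h => by simp [Cmd.emits] at h, Nat.le_add_right _ _⟩
  | seq _ _ ih ih' =>
    refine (ih.mono ?_ ?_ ?_ ?_).trans (ih'.mono ?_ ?_ ?_ ?_) <;>
      simp +contextual [Cmd.regs, Cmd.arrs, Cmd.prints, Cmd.emits]
  | branch_true _ _ ih =>
    refine (Frame.tick _ _ _).trans (ih.mono ?_ ?_ ?_ ?_) <;>
      simp +contextual [Cmd.regs, Cmd.arrs, Cmd.prints, Cmd.emits]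
  | branch_false _ _ ih =>
    refine (Frame.tick _ _ _).trans (ih.mono ?_ ?_ ?_ ?_) <;>
      simp +contextual [Cmd.regs, Cmd.arrs, Cmd.prints, Cmd.emits]
  | loop_true _ _ _ ih ih' =>
    refine ((Frame.tick _ _ _).trans (ih.mono ?_ ?_ ?_ ?_)).trans ih' <;>
      simp [Cmd.regs, Cmd.arrs, Cmd.prints, Cmd.emits]
  | loop_false _ => exact Frame.tick _ _ _

/-! ### Total correctness -/

/-- From the state `σ` the program terminates in a state with the property `Q`. -/
def WP (w : ℕ) (p : Cmd) (Q : State → Prop) (σ : State) : Prop :=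
  ∃ τ, Exec w p σ τ ∧ Q τ

namespace WP

variable {w : ℕ} {p q : Cmd} {Q R : State → Prop} {σ : State}

theorem mono (h : WP w p Q σ) (hQ : ∀ τ, Frame p σ τ → Q τ → R τ) : WP w p R σ :=
  let ⟨τ, he, hq⟩ := h
  ⟨τ, he, hQ τ he.frame hq⟩

theorem skip (h : Q (σ.tick 1)) : WP w .skip Q σ := ⟨_, .skip σ, h⟩

theorem assign {r : ℕ} {e : Expr} (hf : e.Fits (modulus w) σ)
    (h : Q (σ.setReg r (e.val σ) (e.cost + 1))) : WP w (.assign r e) Q σ :=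
  ⟨_, .assign r e σ, by rwa [e.eval_eq_val hf]⟩

theorem store {arr : ℕ} {i e : Expr} (hi : i.Fits (modulus w) σ) (hf : e.Fits (modulus w) σ)
    (h : Q (σ.setMem arr (i.val σ) (e.val σ) (i.cost + e.cost + 1))) :
    WP w (.store arr i e) Q σ :=
  ⟨_, .store arr i e σ, by rwa [e.eval_eq_val hf, i.eval_eq_val hi]⟩

theorem write {e : Expr} (hf : e.Fits (modulus w) σ) (h : Q (σ.put (e.val σ) (e.cost + 1))) :
    WP w (.write e) Q σ :=
  ⟨_, .write e σ, by rwa [e.eval_eq_val hf]⟩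

theorem seq (h : WP w p (fun τ => WP w q Q τ) σ) : WP w (.seq p q) Q σ :=
  let ⟨_, hp, _, hq, h⟩ := h
  ⟨_, .seq hp hq, h⟩

theorem branch {e : Expr} (hf : e.Fits (modulus w) σ)
    (ht : e.val σ ≠ 0 → WP w p Q (σ.tick (e.cost + 1)))
    (hn : e.val σ = 0 → WP w q Q (σ.tick (e.cost + 1))) : WP w (.branch e p q) Q σ := by
  by_cases h : e.val σ = 0
  · obtain ⟨τ, hτ, hQ⟩ := hn h
    exact ⟨τ, .branch_false (by rwa [e.eval_eq_val hf]) hτ, hQ⟩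
  · obtain ⟨τ, hτ, hQ⟩ := ht h
    exact ⟨τ, .branch_true (by rwa [e.eval_eq_val hf]) hτ, hQ⟩

/-- A loop whose invariant bounds the clock terminates. -/
theorem loop {e : Expr} {Inv : State → Prop} {D : ℕ} (h0 : Inv σ)
    (hD : ∀ σ', Inv σ' → σ'.clock ≤ D)
    (hf : ∀ σ', Frame (.loop e p) σ σ' → Inv σ' → e.Fits (modulus w) σ')
    (hs : ∀ σ', Frame (.loop e p) σ σ' → Inv σ' → e.val σ' ≠ 0 →
      WP w p Inv (σ'.tick (e.cost + 1)))
    (he : ∀ σ', Frame (.loop e p) σ σ' → Inv σ' → e.val σ' = 0 → Q (σ'.tick (e.cost + 1))) :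
    WP w (.loop e p) Q σ := by
  -- Induction on the time left before `D`. Testing the guard already advances the clock, so each
  -- iteration uses up some of it, and none is possible when nothing is left.
  suffices H : ∀ d σ', D - σ'.clock ≤ d → Frame (.loop e p) σ σ' → Inv σ' →
      WP w (.loop e p) Q σ' from H _ σ le_rfl (Frame.refl _ _) h0
  intro d
  induction d with
  | zero =>
    intro σ' hd hfr hi
    by_cases h : e.val σ' = 0
    · exact ⟨_, .loop_false (by rwa [e.eval_eq_val (hf σ' hfr hi)]), he σ' hfr hi h⟩
    · obtain ⟨τ, hτ, hI⟩ := hs σ' hfr hi h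
      have h1 := hτ.frame.clock
      have h2 := hD τ hI
      simp only [State.tick_clock] at h1
      omega
  | succ d ih =>
    intro σ' hd hfr hi
    by_cases h : e.val σ' = 0
    · exact ⟨_, .loop_false (by rwa [e.eval_eq_val (hf σ' hfr hi)]), he σ' hfr hi h⟩
    · obtain ⟨τ, hτ, hI⟩ := hs σ' hfr hi h
      have h1 := hτ.frame.clock
      simp only [State.tick_clock] at h1
      have hfr' : Frame (.loop e p) σ τ := (hfr.trans (Frame.tick _ _ _)).trans
        (hτ.frame.mono (fun _ h => h) (fun _ h => h) (fun h => h) (fun h => h))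
      obtain ⟨υ, hυ, hQ⟩ := ih τ (by omega) hfr' hI
      exact ⟨υ, .loop_true (by rwa [e.eval_eq_val (hf σ' hfr hi)]) hτ hυ, hQ⟩

end WP

/-- Run `p` with the register `r` counting from `0` up to, excluding, the register `b`. -/
def Cmd.upTo (r b : ℕ) (p : Cmd) : Cmd :=
  .seq (.assign r (.const 0))
    (.loop (.lt (.reg r) (.reg b)) (.seq p (.assign r (.add (.reg r) (.const 1)))))

/-- The invariant is taken just after a test of the guard. Hence `6 = 2 + 4` for the initial
assignment and the first test, and `8 = 4 + 4` for the increment and the next test. -/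
theorem WP.upTo {w r b : ℕ} {p : Cmd} {Q : State → Prop} {σ : State} {Inv : ℕ → State → Prop}
    (hr : r ∉ p.regs) (hb : b ∉ p.regs) (hne : b ≠ r) (hB : σ.reg b < modulus w)
    (h0 : Inv 0 (σ.setReg r 0 6))
    (hs : ∀ i < σ.reg b, ∀ σ', Frame (.upTo r b p) σ σ' → σ'.reg r = i → Inv i σ' →
      WP w p (fun τ => Inv (i + 1) (τ.setReg r (i + 1) 8)) σ')
    (he : ∀ σ', Frame (.upTo r b p) σ σ' → Inv (σ.reg b) σ' → Q σ') :
    WP w (.upTo r b p) Q σ := by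
  have hpos : 0 < modulus w := Nat.two_pow_pos w
  have sub : Frame (.upTo r b p) σ (σ.setReg r 0 2) := Frame.setReg (by simp [Cmd.upTo, Cmd.regs]) ..
  refine WP.seq (WP.assign hpos ?_)
  simp only [Expr.val, Expr.cost]
  suffices H : ∀ d i σ', i + d = σ.reg b → Frame (.upTo r b p) σ σ' → σ'.reg r = i →
      σ'.reg b = σ.reg b → Inv i (σ'.tick 4) →
      WP w (.loop (.lt (.reg r) (.reg b)) (.seq p (.assign r (.add (.reg r) (.const 1))))) Q σ' from
    H _ 0 _ (Nat.zero_add _) sub (by simp) (by simp [hne]) h0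
  intro d
  induction d with
  | zero =>
    intro i σ' hd hfr hri hbi hI
    obtain rfl : i = σ.reg b := hd
    exact ⟨_, .loop_false (by simp [Expr.eval, hri, hbi]), he _ (hfr.trans (Frame.tick _ _ _)) hI⟩
  | succ d ih =>
    intro i σ' hd hfr hri hbi hI
    obtain ⟨τ, hτ, hI'⟩ := hs i (by omega) (σ'.tick 4) (hfr.trans (Frame.tick _ _ _)) hri hI
    have hτr : τ.reg r = i := (hτ.frame.reg r hr).trans hri
    have hτb : τ.reg b = σ.reg b := (hτ.frame.reg b hb).trans hbi
    have hτ' : Frame (.upTo r b p) σ τ := (hfr.trans (Frame.tick _ _ 4)).trans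
      (hτ.frame.mono (by simp [Cmd.upTo, Cmd.regs]) (by simp [Cmd.upTo, Cmd.arrs])
        (by simp [Cmd.upTo, Cmd.prints]) (by simp [Cmd.upTo, Cmd.emits]))
    have hinc : Exec w (.assign r (.add (.reg r) (.const 1))) τ (τ.setReg r (i + 1) 4) := by
      have := Exec.assign (w := w) r (.add (.reg r) (.const 1)) τ
      rwa [Expr.eval_eq_val, show (Expr.add (.reg r) (.const 1)).val τ = i + 1 by
        simp [Expr.val, hτr]] at this
      simp only [Expr.Fits, Expr.val, hτr]
      exact ⟨trivial, by omega, by omega⟩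
    obtain ⟨υ, hυ, hQ⟩ := ih (i + 1) (τ.setReg r (i + 1) 4) (by omega)
      (hτ'.trans (Frame.setReg (by simp [Cmd.upTo, Cmd.regs]) ..)) (by simp)
      (by simp [hne, hτb]) hI'
    refine ⟨υ, .loop_true (by simp [Expr.eval, hri, hbi]; omega) ?_ hυ, hQ⟩
    exact .seq hτ hinc

/-- Counting loops whose body has the time bound `K`. -/
theorem WP.upTo_const {w r b K : ℕ} {p : Cmd} {Q : State → Prop} {σ : State}
    {Inv : ℕ → State → Prop}
    (hr : r ∉ p.regs) (hb : b ∉ p.regs) (hne : b ≠ r) (hB : σ.reg b < modulus w)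
    (h0 : Inv 0 (σ.setReg r 0 6))
    (hs : ∀ i < σ.reg b, ∀ σ', Frame (.upTo r b p) σ σ' → σ'.reg r = i → Inv i σ' →
      WP w p (fun τ => Inv (i + 1) (τ.setReg r (i + 1) 8) ∧ τ.clock + 8 ≤ σ'.clock + K) σ')
    (he : ∀ σ', Frame (.upTo r b p) σ σ' → Inv (σ.reg b) σ' →
      σ'.clock ≤ σ.clock + σ.reg b * K + 6 → Q σ') :
    WP w (.upTo r b p) Q σ := by
  refine WP.upTo (Inv := fun i σ' => Inv i σ' ∧ σ'.clock ≤ σ.clock + i * K + 6) hr hb hne hB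
    ⟨h0, by simp⟩ (fun i hi σ' hfr hri hI => ?_) (fun σ' hfr hI => he σ' hfr hI.1 hI.2)
  refine (hs i hi σ' hfr hri hI.1).mono fun τ _ hτ => ⟨hτ.1, ?_⟩
  have := hI.2
  simp only [State.setReg_clock, Nat.succ_mul]
  omega

end RAM

/-! ### Addresses of table cells; the size parameters; adjacency lists. -/

namespace RAM

attribute [simp] Expr.val Expr.Fits Expr.cost

/-- Word `c - 6` of the record of the transition whose number is in the register `r`. -/
def field (c r : ℕ) : Expr := .load 0 (.add (.const c) (.mul (.const 4) (.reg r)))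

@[simp] theorem field_val (c r : ℕ) (σ : State) :
    (field c r).val σ = σ.mem 0 (c + 4 * σ.reg r) := rfl

@[simp] theorem field_cost (c r : ℕ) : (field c r).cost = 6 := rfl

@[simp] theorem field_fits (c r B : ℕ) (σ : State) :
    (field c r).Fits B σ ↔ c + 4 * σ.reg r < B ∧ 4 < B := by
  simp only [field, Expr.Fits, Expr.val]
  constructor
  · rintro ⟨_, ⟨h, _⟩, h'⟩; exact ⟨h', h⟩
  · rintro ⟨h, h'⟩; exact ⟨by omega, ⟨h', trivial, by omega⟩, h⟩

/-- The cell in row `i` and column `j` of the array `a`, for rows of length `n`. -/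
def cell (i j : Expr) : Expr := .add (.mul i (.reg 0)) j

@[simp] theorem cell_val (i j : Expr) (σ : State) :
    (cell i j).val σ = i.val σ * σ.reg 0 + j.val σ := rfl

@[simp] theorem cell_cost (i j : Expr) : (cell i j).cost = i.cost + j.cost + 3 := by
  simp [cell]; omega

@[simp] theorem cell_fits (i j : Expr) (B : ℕ) (σ : State) : (cell i j).Fits B σ ↔
    i.Fits B σ ∧ j.Fits B σ ∧ i.val σ * σ.reg 0 + j.val σ < B := by
  simp only [cell, Expr.Fits, Expr.val]
  constructor
  · rintro ⟨⟨h, _⟩, h', h''⟩; exact ⟨h, h', h''⟩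
  · rintro ⟨h, h', h''⟩; exact ⟨⟨h, trivial, by omega⟩, h', h''⟩

theorem cell_inj {n i j i' j' : ℕ} (hj : j < n) (hj' : j' < n) :
    i * n + j = i' * n + j' ↔ i = i' ∧ j = j' := by
  constructor
  · intro h
    have h1 : (i * n + j) / n = i := by
      rw [mul_comm, Nat.mul_add_div (by omega), Nat.div_eq_of_lt hj, add_zero]
    have h2 : (i' * n + j') / n = i' := by
      rw [mul_comm, Nat.mul_add_div (by omega), Nat.div_eq_of_lt hj', add_zero]
    have : i = i' := by rw [← h1, h, h2]
    subst this
    exact ⟨rfl, by omega⟩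
  · rintro ⟨rfl, rfl⟩; rfl

theorem update_cell {n i j i' j' x : ℕ} {f : ℕ → ℕ} (hj : j < n) (hj' : j' < n) :
    Function.update f (i * n + j) x (i' * n + j') =
      if i' = i ∧ j' = j then x else f (i' * n + j') := by
  rw [Function.update_apply]
  simp only [cell_inj hj' hj]

theorem cell_lt {n i j k : ℕ} (hi : i < k) (hj : j < n) : i * n + j < k * n :=
  calc i * n + j < i * n + n := by omega
    _ = (i + 1) * n := by ring
    _ ≤ k * n := Nat.mul_le_mul_right _ hi

/-- The registers that hold the size parameters, and the input array. -/
structure Ctx (n v m l q₀ qf : ℕ) (I : ℕ → ℕ) (σ : State) : Prop where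
  hn : σ.reg 0 = n
  hv : σ.reg 1 = v
  hm : σ.reg 2 = m
  hl : σ.reg 3 = l
  hq₀ : σ.reg 4 = q₀
  hqf : σ.reg 5 = qf
  hL : σ.reg 6 = l + 1
  inp : σ.mem 0 = I

/-- Whether a program leaves the size parameters and the input alone. -/
def Cmd.keepsCtx (p : Cmd) : Bool :=
  p.regs.all (fun r => decide (6 < r)) && p.arrs.all (fun a => decide (0 < a))

theorem Ctx.frame {n v m l q₀ qf : ℕ} {I : ℕ → ℕ} {σ τ : State} {p : Cmd}
    (h : Ctx n v m l q₀ qf I σ) (hf : Frame p σ τ) (hp : p.keepsCtx = true) :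
    Ctx n v m l q₀ qf I τ := by
  simp only [Cmd.keepsCtx, Bool.and_eq_true, List.all_eq_true, decide_eq_true_eq] at hp
  have hr : ∀ r ≤ 6, τ.reg r = σ.reg r := fun r hr =>
    hf.reg r fun h' => by have := hp.1 r h'; omega
  exact ⟨(hr 0 (by omega)).trans h.hn, (hr 1 (by omega)).trans h.hv, (hr 2 (by omega)).trans h.hm,
    (hr 3 (by omega)).trans h.hl, (hr 4 (by omega)).trans h.hq₀, (hr 5 (by omega)).trans h.hqf,
    (hr 6 (by omega)).trans h.hL, (hf.mem 0 fun h' => by have := hp.2 0 h'; omega).trans h.inp⟩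

theorem Ctx.tick {n v m l q₀ qf : ℕ} {I : ℕ → ℕ} {σ : State} (h : Ctx n v m l q₀ qf I σ)
    (t : ℕ) : Ctx n v m l q₀ qf I (σ.tick t) :=
  ⟨h.hn, h.hv, h.hm, h.hl, h.hq₀, h.hqf, h.hL, h.inp⟩

theorem Ctx.setReg {n v m l q₀ qf : ℕ} {I : ℕ → ℕ} {σ : State} (h : Ctx n v m l q₀ qf I σ)
    {r : ℕ} (hr : 6 < r) (x t : ℕ) : Ctx n v m l q₀ qf I (σ.setReg r x t) :=
  h.frame (p := .assign r (.const 0)) (Frame.setReg (by simp [Cmd.regs]) σ x t)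
    (by simp [Cmd.keepsCtx, Cmd.regs, Cmd.arrs, hr])

theorem Ctx.setMem {n v m l q₀ qf : ℕ} {I : ℕ → ℕ} {σ : State} (h : Ctx n v m l q₀ qf I σ)
    {a : ℕ} (ha : 0 < a) (i x t : ℕ) : Ctx n v m l q₀ qf I (σ.setMem a i x t) :=
  ⟨h.hn, h.hv, h.hm, h.hl, h.hq₀, h.hqf, h.hL, by simp [ha.ne, h.inp]⟩

/-! ### Adjacency lists -/

/-- The successor table `nxt` represents the list `js` starting from `t`; items are shifted by one,
so that zero ends a list. -/
def Linked (nxt : ℕ → ℕ) : ℕ → List ℕ → Prop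
  | t, [] => t = 0
  | t, j :: js => t = j + 1 ∧ Linked nxt (nxt j) js

theorem Linked.update {nxt : ℕ → ℕ} {i x : ℕ} {js : List ℕ} {t : ℕ} (h : Linked nxt t js)
    (hi : i ∉ js) : Linked (Function.update nxt i x) t js := by
  induction js generalizing t with
  | nil => exact h
  | cons j js ih =>
    rw [List.mem_cons, not_or] at hi
    exact ⟨h.1, by rw [Function.update_of_ne (Ne.symm hi.1)]; exact ih h.2 hi.2⟩

/-- The transitions before number `i` that leave `q` and do not read a letter, last one first. -/
def silentFrom (I : ℕ → ℕ) (q i : ℕ) : List ℕ :=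
  ((List.range i).filter fun j => I (6 + 4 * j) = q ∧ I (7 + 4 * j) ≠ 1).reverse

theorem silentFrom_succ (I : ℕ → ℕ) (q i : ℕ) : silentFrom I q (i + 1) =
    if I (6 + 4 * i) = q ∧ I (7 + 4 * i) ≠ 1 then i :: silentFrom I q i else silentFrom I q i := by
  simp only [silentFrom, List.range_succ, List.filter_append, List.reverse_append]
  split <;> simp_all

theorem mem_silentFrom {I : ℕ → ℕ} {q i j : ℕ} :
    j ∈ silentFrom I q i ↔ j < i ∧ I (6 + 4 * j) = q ∧ I (7 + 4 * j) ≠ 1 := by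
  simp [silentFrom]

/-- Each transition occurs only in the list of its source. This bound on the total degree is what
makes the closure cost `n * m` and not `n * n * m`. -/
theorem sum_length_silentFrom_le (I : ℕ → ℕ) (n i : ℕ) :
    ∑ q ∈ Finset.range n, (silentFrom I q i).length ≤ i := by
  induction i with
  | zero => simp [silentFrom]
  | succ i ih =>
    have : ∀ q, (silentFrom I q (i + 1)).length ≤
        (silentFrom I q i).length + if I (6 + 4 * i) = q then 1 else 0 := by
      intro q
      rw [silentFrom_succ]
      split <;> split <;> simp_all
    refine (Finset.sum_le_sum fun q _ => this q).trans ?_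
    rw [Finset.sum_add_distrib]
    refine Nat.add_le_add ih ?_
    rw [Finset.sum_ite_eq]
    split <;> simp

/-- Build the adjacency lists of the transitions that do not read a letter. -/
def buildLists : Cmd :=
  .upTo 7 2 (.branch (.eq (field 7 7) (.const 1)) .skip
    (.seq (.store 2 (.reg 7) (.load 1 (field 6 7))) (.store 1 (field 6 7) (.add (.reg 7) (.const 1)))))

/-- Time constants such as `60`, here and below, are round upper bounds for the summed costs of one
pass through a loop body. -/
theorem buildLists_spec {w n v m l q₀ qf : ℕ} {I : ℕ → ℕ} {σ : State}
    (hσ : Ctx n v m l q₀ qf I σ) (h1 : ∀ q, σ.mem 1 q = 0) (hB : 4 * m + 10 < modulus w) :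
    WP w buildLists (fun τ => (∀ q, Linked (τ.mem 2) (τ.mem 1 q) (silentFrom I q m)) ∧
      τ.clock ≤ σ.clock + m * 60 + 6) σ := by
  have hm := hσ.hm
  refine WP.upTo_const (K := 60)
    (Inv := fun i τ => ∀ q, Linked (τ.mem 2) (τ.mem 1 q) (silentFrom I q i))
    (by decide) (by decide) (by decide) (by omega) ?_ ?_ ?_
  · intro q
    simpa [silentFrom, Linked] using h1 q
  · intro i hi σ' hfr hri hI
    have hc := hσ.frame hfr (by decide)
    rw [hm] at hi
    refine WP.branch ?_ (fun h => ?_) (fun h => ?_)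
    · simp [hri]; omega
    · simp only [Expr.val, eqVal_def, field_val, hc.inp, hri] at h
      refine WP.skip ⟨fun q => ?_, ?_⟩
      · rw [silentFrom_succ, if_neg (by simp_all)]
        simpa using hI q
      · simp
    · simp only [Expr.val, eqVal_def, field_val, hc.inp, hri] at h
      refine WP.seq (WP.store ?_ ?_ (WP.store ?_ ?_ ⟨fun q => ?_, ?_⟩))
      · simp
      · simp [hri]; omega
      · simp [hri]; omega
      · simp [hri]; omega
      · rw [silentFrom_succ]
        simp only [State.setReg_mem, State.setMem_mem, State.tick_mem, Expr.val, field_val,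
          State.setMem_reg, State.tick_reg, hri, hc.inp]
        simp only [Nat.reduceEqDiff, reduceIte, OfNat.zero_ne_ofNat]
        -- All listed items are below `i`, so writing link number `i` disturbs no list.
        have hne : i ∉ silentFrom I q i := by simp [mem_silentFrom]
        by_cases hq : I (6 + 4 * i) = q
        · subst hq
          rw [if_pos ⟨rfl, by simpa using h⟩]
          simp only [Function.update_self]
          refine ⟨rfl, ?_⟩
          rw [Function.update_self]
          exact (hI _).update hne
        · rw [if_neg (by simp [hq]), Function.update_of_ne (Ne.symm hq)]
          exact (hI _).update hne
      · simp
  · intro τ hfr hI hcl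
    rw [hm] at hI hcl
    exact ⟨hI, hcl⟩

end RAM

namespace RAM

/-! ### Reflexive transitive closure -/

/-- One step along a listed edge. -/
def AdjStep (adj : ℕ → List ℕ) (dst : ℕ → ℕ) (a b : ℕ) : Prop :=
  ∃ e ∈ adj a, dst e = b

/-- The invariant of the graph search that finds all connected pairs. The pairs found so far form a
queue with entries `(qp j, qq j)`; those before `h` have been expanded, except that for the last one
the edges `js` are still to be scanned. The pairs that have not been expanded form the set `U`. -/
structure SearchInv (n : ℕ) (adj : ℕ → List ℕ) (dst nxt E qp qq : ℕ → ℕ) (cnt h t p : ℕ)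
    (js : List ℕ) (U : Finset (ℕ × ℕ)) : Prop where
  linked : Linked nxt t js
  p_lt : p < n
  js_ok : ∀ e ∈ js, ∃ q, e ∈ adj q ∧ Relation.ReflTransGen (AdjStep adj dst) p q
  h_le : h ≤ cnt
  queue : ∀ j < cnt, qp j < n ∧ qq j < n ∧ E (qp j * n + qq j) ≠ 0
  found : ∀ a < n, ∀ b < n, E (a * n + b) ≠ 0 → ∃ j < cnt, qp j = a ∧ qq j = b
  sound : ∀ a < n, ∀ b < n, E (a * n + b) ≠ 0 → Relation.ReflTransGen (AdjStep adj dst) a b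
  inj : ∀ i < cnt, ∀ j < cnt, qp i = qp j → qq i = qq j → i = j
  diag : ∀ a < n, E (a * n + a) ≠ 0
  closed : ∀ j < h, ∀ e ∈ adj (qq j), E (qp j * n + dst e) ≠ 0 ∨ qp j = p ∧ e ∈ js
  mem_U : ∀ a b, (a, b) ∈ U ↔ a < n ∧ b < n ∧ ∀ j < h, ¬ (qp j = a ∧ qq j = b)
  out : ∀ x, n * n ≤ x → E x = 0

namespace SearchInv

variable {n : ℕ} {adj : ℕ → List ℕ} {dst nxt E qp qq : ℕ → ℕ} {cnt h t p : ℕ} {js : List ℕ}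
  {U : Finset (ℕ × ℕ)}

/-- The queued pairs are pairwise distinct. This keeps the queue pointers within a machine word. -/
theorem cnt_le (hI : SearchInv n adj dst nxt E qp qq cnt h t p js U) : cnt ≤ n * n := by
  have := Finset.card_le_card_of_injOn (s := Finset.range cnt)
    (t := Finset.range n ×ˢ Finset.range n) (fun j => (qp j, qq j))
    (fun j hj => by
      have := hI.queue j (by simpa using hj)
      simp [this])
    (fun i hi j hj hij => by
      simp only [Prod.mk.injEq] at hij
      exact hI.inj i (by simpa using hi) j (by simpa using hj) hij.1 hij.2)
  simpa using this

/-- The membership in `U` is recorded because removing the pair from `U` pays for the scan of its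
edges. -/
theorem pop (hI : SearchInv n adj dst nxt E qp qq cnt h t p [] U) (hh : h < cnt) {hd : ℕ}
    (hl : Linked nxt hd (adj (qq h))) :
    SearchInv n adj dst nxt E qp qq cnt (h + 1) hd (qp h) (adj (qq h)) (U.erase (qp h, qq h)) ∧
      (qp h, qq h) ∈ U := by
  have hq := hI.queue h hh
  refine ⟨{ hI with
    linked := hl
    p_lt := hq.1
    js_ok := fun e he => ⟨_, he, hI.sound _ hq.1 _ hq.2.1 hq.2.2⟩
    h_le := hh
    closed := ?_
    mem_U := ?_ }, ?_⟩
  · intro j hj e he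
    rcases Nat.lt_succ_iff_lt_or_eq.1 hj with hj | rfl
    · rcases hI.closed j hj e he with h' | h'
      · exact Or.inl h'
      · simp at h'
    · exact Or.inr ⟨rfl, he⟩
  · intro a b
    rw [Finset.mem_erase, hI.mem_U]
    constructor
    · rintro ⟨hne, ha, hb, hall⟩
      refine ⟨ha, hb, fun j hj => ?_⟩
      rcases Nat.lt_succ_iff_lt_or_eq.1 hj with hj | rfl
      · exact hall j hj
      · rintro ⟨rfl, rfl⟩; exact hne rfl
    · rintro ⟨ha, hb, hall⟩
      refine ⟨?_, ha, hb, fun j hj => hall j (by omega)⟩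
      intro heq
      rw [Prod.mk.injEq] at heq
      exact hall h (by omega) ⟨heq.1.symm, heq.2.symm⟩
  · rw [hI.mem_U]
    refine ⟨hq.1, hq.2.1, fun j hj hj' => ?_⟩
    have := hI.inj j (by omega) h hh hj'.1 hj'.2
    omega

theorem scan_old {e : ℕ} (hI : SearchInv n adj dst nxt E qp qq cnt h t p (e :: js) U)
    (he : E (p * n + dst e) ≠ 0) : SearchInv n adj dst nxt E qp qq cnt h (nxt e) p js U :=
  { hI with
    linked := hI.linked.2
    js_ok := fun e' he' => hI.js_ok e' (List.mem_cons_of_mem _ he')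
    closed := fun j hj e' he' => by
      rcases hI.closed j hj e' he' with h' | ⟨h1, h2⟩
      · exact Or.inl h'
      · rcases List.mem_cons.1 h2 with rfl | h2
        · left; rwa [h1]
        · exact Or.inr ⟨h1, h2⟩ }

theorem scan_new {e : ℕ} (hI : SearchInv n adj dst nxt E qp qq cnt h t p (e :: js) U)
    (he : E (p * n + dst e) = 0) (hd : dst e < n) :
    SearchInv n adj dst nxt (Function.update E (p * n + dst e) 1) (Function.update qp cnt p)
      (Function.update qq cnt (dst e)) (cnt + 1) h (nxt e) p js U := by
  have hmono : ∀ x, E x ≠ 0 → Function.update E (p * n + dst e) 1 x ≠ 0 := by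
    intro x hx
    rw [Function.update_apply]
    split
    · exact one_ne_zero
    · exact hx
  have hp : ∀ j < cnt, Function.update qp cnt p j = qp j := fun j hj =>
    Function.update_of_ne (by omega) _ _
  have hq : ∀ j < cnt, Function.update qq cnt (dst e) j = qq j := fun j hj =>
    Function.update_of_ne (by omega) _ _
  have hfresh : ∀ j < cnt, ¬ (qp j = p ∧ qq j = dst e) := by
    rintro j hj ⟨h1, h2⟩
    have := (hI.queue j hj).2.2
    rw [h1, h2] at this
    exact this he
  have hle := hI.h_le
  refine
    { linked := hI.linked.2
      p_lt := hI.p_lt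
      js_ok := fun e' he' => hI.js_ok e' (List.mem_cons_of_mem _ he')
      h_le := by omega
      queue := ?_
      found := ?_
      sound := ?_
      inj := ?_
      diag := fun a ha => hmono _ (hI.diag a ha)
      closed := ?_
      mem_U := ?_
      out := ?_ }
  · intro j hj
    rcases Nat.lt_succ_iff_lt_or_eq.1 hj with hj | rfl
    · rw [hp j hj, hq j hj]
      have := hI.queue j hj
      exact ⟨this.1, this.2.1, hmono _ this.2.2⟩
    · simp [hI.p_lt, hd]
  · intro a ha b hb hE
    by_cases hab : a = p ∧ b = dst e
    · exact ⟨cnt, by omega, by simp [hab.1], by simp [hab.2]⟩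
    · rw [update_cell hd hb, if_neg hab] at hE
      obtain ⟨j, hj, h1, h2⟩ := hI.found a ha b hb hE
      exact ⟨j, by omega, by rw [hp j hj, h1], by rw [hq j hj, h2]⟩
  · intro a ha b hb hE
    by_cases hab : a = p ∧ b = dst e
    · obtain ⟨q, hq, hr⟩ := hI.js_ok e (by simp)
      rw [hab.1, hab.2]
      exact hr.tail ⟨e, hq, rfl⟩
    · rw [update_cell hd hb, if_neg hab] at hE
      exact hI.sound a ha b hb hE
  · intro i hi j hj h1 h2
    rcases Nat.lt_succ_iff_lt_or_eq.1 hi with hi | rfl <;>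
    rcases Nat.lt_succ_iff_lt_or_eq.1 hj with hj | rfl
    · rw [hp i hi, hp j hj] at h1
      rw [hq i hi, hq j hj] at h2
      exact hI.inj i hi j hj h1 h2
    · rw [hp i hi, Function.update_self] at h1
      rw [hq i hi, Function.update_self] at h2
      exact absurd ⟨h1, h2⟩ (hfresh i hi)
    · rw [hp j hj, Function.update_self] at h1
      rw [hq j hj, Function.update_self] at h2
      exact absurd ⟨h1.symm, h2.symm⟩ (hfresh j hj)
    · rfl
  · intro j hj e' he'
    rw [hq j (by omega)] at he'
    rw [hp j (by omega)]
    rcases hI.closed j hj e' he' with h' | ⟨h1, h2⟩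
    · exact Or.inl (hmono _ h')
    · rcases List.mem_cons.1 h2 with rfl | h2
      · left; rw [h1]; simp
      · exact Or.inr ⟨h1, h2⟩
  · intro a b
    rw [hI.mem_U]
    refine and_congr_right fun _ => and_congr_right fun _ => forall_congr' fun j => ?_
    refine imp_congr_right fun hj => ?_
    rw [hp j (by omega), hq j (by omega)]
  · intro x hx
    rw [Function.update_of_ne]
    · exact hI.out x hx
    · have := cell_lt hI.p_lt hd
      omega

/-- With every queued pair expanded and no edge pending, `closed` says that the found pairs are
closed under steps; they contain the diagonal, so induction along the path applies. -/
theorem complete (hI : SearchInv n adj dst nxt E qp qq cnt cnt t p [] U)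
    (hd : ∀ q, ∀ e ∈ adj q, dst e < n) {a b : ℕ} (ha : a < n)
    (hab : Relation.ReflTransGen (AdjStep adj dst) a b) : b < n ∧ E (a * n + b) ≠ 0 := by
  induction hab with
  | refl => exact ⟨ha, hI.diag a ha⟩
  | tail _ hs ih =>
    obtain ⟨e, he, rfl⟩ := hs
    obtain ⟨j, hj, h1, h2⟩ := hI.found a ha _ ih.1 ih.2
    refine ⟨hd _ e he, ?_⟩
    rw [← h2] at he
    rcases hI.closed j hj e he with h' | h'
    · rwa [h1] at h'
    · simp at h'

end SearchInv

/-- Enter the pairs of equal states into the relation and the queue. -/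
def initClosure : Cmd :=
  .upTo 7 0 (.seq (.store 3 (cell (.reg 7) (.reg 7)) (.const 1))
    (.seq (.store 4 (.reg 7) (.reg 7)) (.store 5 (.reg 7) (.reg 7))))

/-- Expand the pairs in the queue. -/
def expandPairs : Cmd :=
  .loop (.add (.reg 10) (.lt (.reg 9) (.reg 8)))
    (.branch (.reg 10)
      (.seq (.assign 13 (.sub (.reg 10) (.const 1)))
      (.seq (.assign 12 (field 9 13))
      (.seq (.branch (.load 3 (cell (.reg 11) (.reg 12))) .skip
        (.seq (.store 3 (cell (.reg 11) (.reg 12)) (.const 1))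
        (.seq (.store 4 (.reg 8) (.reg 11))
        (.seq (.store 5 (.reg 8) (.reg 12))
          (.assign 8 (.add (.reg 8) (.const 1)))))))
        (.assign 10 (.load 2 (.reg 13))))))
      (.seq (.assign 11 (.load 4 (.reg 9)))
      (.seq (.assign 10 (.load 1 (.load 5 (.reg 9))))
        (.assign 9 (.add (.reg 9) (.const 1))))))

theorem initClosure_spec {w n v m l q₀ qf : ℕ} {I : ℕ → ℕ} {σ : State}
    (hσ : Ctx n v m l q₀ qf I σ) (h3 : ∀ x, σ.mem 3 x = 0) (hB : n * n + 4 < modulus w) :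
    WP w initClosure (fun τ => (∀ x, τ.mem 3 x ≠ 0 ↔ ∃ j < n, x = j * n + j) ∧
      (∀ j < n, τ.mem 4 j = j ∧ τ.mem 5 j = j) ∧ τ.clock ≤ σ.clock + n * 30 + 6) σ := by
  have hn := hσ.hn
  refine WP.upTo_const (K := 30)
    (Inv := fun i τ => (∀ x, τ.mem 3 x ≠ 0 ↔ ∃ j < i, x = j * n + j) ∧
      (∀ j < i, τ.mem 4 j = j ∧ τ.mem 5 j = j))
    (by decide) (by decide) (by decide) (by nlinarith) ?_ ?_ ?_
  · simp [h3]
  · rintro i hi σ' hfr hri ⟨hI, hJ⟩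
    have hc := hσ.frame hfr (by decide)
    rw [hn] at hi
    have := cell_lt hi hi
    refine WP.seq (WP.store ?_ ?_ (WP.seq (WP.store ?_ ?_ (WP.store ?_ ?_ ⟨⟨?_, ?_⟩, ?_⟩))))
    · simp [hri, hc.hn]; omega
    · simp; omega
    · simp
    · simp
    · simp
    · simp
    · intro x
      simp [hri, hc.hn, Function.update_apply]
      split
      · exact iff_of_true one_ne_zero ⟨i, by omega, by assumption⟩
      · refine (hI x).trans ?_
        constructor
        · rintro ⟨j, hj, rfl⟩; exact ⟨j, by omega, rfl⟩
        · rintro ⟨j, hj, rfl⟩; exact ⟨j, by grind, rfl⟩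
    · intro j hj
      simp [hri, Function.update_apply]
      split
      · simp_all
      · exact hJ j (by omega)
    · simp
  · rintro τ hfr ⟨hI, hJ⟩ hcl
    rw [hn] at hI hJ hcl
    exact ⟨hI, hJ, hcl⟩

/-- Amortised analysis: the potential is the number of pending edges plus, for every unexpanded pair
`(p, q)`, the degree of `q` plus one. Scanning an edge lowers it by one, and so does a pop, which
trades `deg q + 1` for `deg q` pending edges. Its initial value is at most `n * m + n * n`, because
every first component meets each edge at most once. -/
theorem expandPairs_spec {w n v m l q₀ qf : ℕ} {I : ℕ → ℕ} {σ : State} {adj : ℕ → List ℕ}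
    (hσ : Ctx n v m l q₀ qf I σ) (hn : 0 < n)
    (h8 : σ.reg 8 = n) (h9 : σ.reg 9 = 0) (h10 : σ.reg 10 = 0) (h11 : σ.reg 11 = 0)
    (h3 : ∀ x, σ.mem 3 x ≠ 0 ↔ ∃ j < n, x = j * n + j)
    (h45 : ∀ j < n, σ.mem 4 j = j ∧ σ.mem 5 j = j)
    (hadj : ∀ q, Linked (σ.mem 2) (σ.mem 1 q) (adj q))
    (hd : ∀ q, ∀ e ∈ adj q, e < m ∧ I (9 + 4 * e) < n)
    (hdeg : ∑ q ∈ Finset.range n, (adj q).length ≤ m)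
    (hB : n * n + 4 * m + 20 < modulus w) :
    WP w expandPairs (fun τ =>
      (∀ a < n, ∀ b, Relation.ReflTransGen (AdjStep adj fun e => I (9 + 4 * e)) a b ↔
        b < n ∧ τ.mem 3 (a * n + b) ≠ 0) ∧ (∀ x, n * n ≤ x → τ.mem 3 x = 0) ∧
      τ.clock ≤ σ.clock + 100 * (n * m + n * n) + 10) σ := by
  set pot : Finset (ℕ × ℕ) → ℕ := fun U => ∑ x ∈ U, ((adj x.2).length + 1) with hpot
  refine WP.loop (D := σ.clock + 100 * (n * m + n * n))
    (Inv := fun τ => ∃ js U, SearchInv n adj (fun e => I (9 + 4 * e)) (τ.mem 2) (τ.mem 3)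
      (τ.mem 4) (τ.mem 5) (τ.reg 8) (τ.reg 9) (τ.reg 10) (τ.reg 11) js U ∧
      τ.clock + 100 * (js.length + pot U) ≤ σ.clock + 100 * (n * m + n * n)) ?_ ?_ ?_ ?_ ?_
  · refine ⟨[], Finset.range n ×ˢ Finset.range n, ?_, ?_⟩
    · rw [h8, h9, h10, h11]
      refine
        { linked := rfl
          p_lt := hn
          js_ok := by simp
          h_le := by omega
          queue := ?_
          found := ?_
          sound := ?_
          inj := ?_
          diag := fun a ha => (h3 _).2 ⟨a, ha, rfl⟩
          closed := by simp
          mem_U := by simp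
          out := ?_ }
      · intro j hj
        rw [(h45 j hj).1, (h45 j hj).2]
        exact ⟨hj, hj, (h3 _).2 ⟨j, hj, rfl⟩⟩
      · intro a ha b hb hE
        obtain ⟨j, hj, hx⟩ := (h3 _).1 hE
        obtain ⟨rfl, rfl⟩ := (cell_inj hb hj).1 hx
        exact ⟨b, hj, h45 b hj⟩
      · intro a ha b hb hE
        obtain ⟨j, hj, hx⟩ := (h3 _).1 hE
        obtain ⟨rfl, rfl⟩ := (cell_inj hb hj).1 hx
        exact .refl
      · intro i hi j hj h _
        rwa [(h45 i hi).1, (h45 j hj).1] at h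
      · intro x hx
        by_contra hE
        obtain ⟨j, hj, rfl⟩ := (h3 _).1 hE
        have := cell_lt hj hj
        omega
    · have : pot (Finset.range n ×ˢ Finset.range n) ≤ n * m + n * n := by
        simp only [hpot, Finset.sum_product, Finset.sum_const, Finset.card_range, smul_eq_mul,
          Finset.sum_add_distrib, mul_one, Finset.card_product]
        exact Nat.add_le_add_right (Nat.mul_le_mul_left _ hdeg) _
      simp only [List.length_nil, zero_add]
      omega
  · rintro σ' ⟨js, U, _, h⟩
    omega
  · rintro σ' hfr ⟨js, U, hI, h⟩
    have ht : σ'.reg 10 ≤ m := by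
      have h1 := hI.linked
      cases js with
      | nil => simp only [Linked] at h1; omega
      | cons e js =>
        obtain ⟨q, hq, _⟩ := hI.js_ok e (by simp)
        have := (hd q e hq).1
        have := h1.1
        omega
    simp only [Expr.Fits, Expr.val, ltVal_def]
    refine ⟨trivial, ⟨trivial, trivial⟩, ?_⟩
    split <;> omega
  · rintro σ' hfr ⟨js, U, hI, hcl⟩ hv
    have hc := hσ.frame hfr (by decide)
    have hcnt := hI.cnt_le
    have h1 : σ'.mem 1 = σ.mem 1 := hfr.mem 1 (by decide)
    have h2 : σ'.mem 2 = σ.mem 2 := hfr.mem 2 (by decide)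
    refine WP.branch trivial (fun ht => ?_) (fun ht => ?_)
    · simp only [Expr.val, State.tick_reg] at ht
      cases js with
      | nil => exact absurd hI.linked ht
      | cons e js =>
        have hte : σ'.reg 10 - 1 = e := by rw [hI.linked.1]; rfl
        obtain ⟨q, hq, _⟩ := hI.js_ok e (by simp)
        obtain ⟨hem, hen⟩ := hd q e hq
        have hlt := cell_lt hI.p_lt hen
        refine WP.seq (WP.assign (by simp; omega) (WP.seq (WP.assign ?_
          (WP.seq (WP.branch ?_ (fun h => WP.skip ?_) (fun h => ?_))))))
        · simp [hte]; omega
        · simp [hte, hc.inp, hc.hn]; omega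
        · simp [hte, hc.inp, hc.hn] at h
          refine WP.assign trivial ⟨js, U, ?_, ?_⟩
          · simpa [hte] using hI.scan_old h
          · simp at hcl ⊢; omega
        · simp [hte, hc.inp, hc.hn] at h
          refine WP.seq (WP.store ?_ ?_ (WP.seq (WP.store trivial trivial (WP.seq
            (WP.store trivial trivial (WP.assign ?_ (WP.assign trivial ⟨js, U, ?_, ?_⟩)))))))
          · simp [hte, hc.inp, hc.hn]; omega
          · simp; omega
          · simp; omega
          · simpa [hte, hc.inp, hc.hn] using hI.scan_new h hen
          · simp at hcl ⊢; omega
    · simp only [Expr.val, State.tick_reg] at ht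
      cases js with
      | cons e js => exact absurd (hI.linked.1.symm.trans ht) (by omega)
      | nil =>
        have hh : σ'.reg 9 < σ'.reg 8 := by
          by_contra hh
          simp [ht, hh] at hv
        obtain ⟨hI', hmem⟩ := hI.pop hh (hd := σ'.mem 1 (σ'.mem 5 (σ'.reg 9)))
          (by rw [h1, h2]; exact hadj _)
        have hp : pot U = pot (U.erase (σ'.mem 4 (σ'.reg 9), σ'.mem 5 (σ'.reg 9))) +
            ((adj (σ'.mem 5 (σ'.reg 9))).length + 1) :=
          (Finset.sum_erase_add _ _ hmem).symm
        refine WP.seq (WP.assign trivial (WP.seq (WP.assign trivial (WP.assign ?_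
          ⟨adj (σ'.mem 5 (σ'.reg 9)), U.erase (σ'.mem 4 (σ'.reg 9), σ'.mem 5 (σ'.reg 9)),
            ?_, ?_⟩))))
        · simp; omega
        · simpa using hI'
        · simp at hcl ⊢; omega
  · rintro σ' hfr ⟨js, U, hI, hcl⟩ hv
    simp only [Expr.val, ltVal_def] at hv
    have ht : σ'.reg 10 = 0 := by omega
    cases js with
    | cons e js => exact absurd (hI.linked.1.symm.trans ht) (by omega)
    | nil =>
      have hh : σ'.reg 9 = σ'.reg 8 := by
        have := hI.h_le
        by_contra hh
        rw [if_pos (by omega)] at hv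
        omega
      rw [hh] at hI
      refine ⟨fun a ha b => ⟨fun hab => ?_, fun hab => ?_⟩, hI.out, ?_⟩
      · exact hI.complete (fun q e he => (hd q e he).2) ha hab
      · exact hI.sound a ha b hab.1 hab.2
      · simp; omega

end RAM

namespace RAM

/-! ### Reading a letter -/

/-- For every letter `a`, relate `p` to `q` in the block of `a` if `a` leads from `p` to a state
that the block zero relates to `q`. -/
def letterBlocks : Cmd :=
  .upTo 7 2 (.branch (.eq (field 7 7) (.const 1))
    (.seq (.assign 9 (field 9 7))
    (.seq (.assign 10 (cell (.add (field 8 7) (.const 1)) (field 6 7)))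
      (.upTo 8 0 (.branch (.load 3 (cell (.reg 9) (.reg 8)))
        (.store 3 (cell (.reg 10) (.reg 8)) (.const 1)) .skip))))
    .skip)

/-- Block `0` of array 3 is the silent closure, block `a + 1` means "read `a`, then move silently".
A letter transition contributes the closure row of its target to the row of its source, at cost
`O(n)`, hence `O(mn)` in all. `hout` supplies the zeros in the blocks to be filled. -/
theorem letterBlocks_spec {w k n v m l q₀ qf : ℕ} {I : ℕ → ℕ} {σ : State}
    (hσ : Ctx n v m l q₀ qf I σ) (hout : ∀ x, n * n ≤ x → σ.mem 3 x = 0)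
    (hI : ∀ j < m, I (6 + 4 * j) < n ∧ I (9 + 4 * j) < n ∧ (I (7 + 4 * j) = 1 → I (8 + 4 * j) < k))
    (hB : (k + 1) * n * n + (k + 1) * n + k + n + 4 * m + 20 < modulus w) :
    WP w letterBlocks (fun τ => (∀ x < n * n, τ.mem 3 x = σ.mem 3 x) ∧
      (∀ a, ∀ p < n, ∀ q < n, τ.mem 3 (((a + 1) * n + p) * n + q) ≠ 0 ↔
        ∃ j < m, I (7 + 4 * j) = 1 ∧ I (8 + 4 * j) = a ∧ I (6 + 4 * j) = p ∧
          σ.mem 3 (I (9 + 4 * j) * n + q) ≠ 0) ∧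
      τ.clock ≤ σ.clock + m * (n * 60 + 100) + 6) σ := by
  have hm := hσ.hm
  set E := σ.mem 3 with hE
  set row : ℕ → ℕ := fun j => (I (8 + 4 * j) + 1) * n + I (6 + 4 * j) with hrow
  refine WP.upTo_const (K := n * 60 + 100)
    (Inv := fun i τ => (∀ x < n * n, τ.mem 3 x = E x) ∧ ∀ x, n * n ≤ x → (τ.mem 3 x ≠ 0 ↔
      ∃ j < i, I (7 + 4 * j) = 1 ∧ ∃ q < n, E (I (9 + 4 * j) * n + q) ≠ 0 ∧ x = row j * n + q))
    (by decide) (by decide) (by decide) (by omega) ?_ ?_ ?_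
  · simpa [← hE] using hout
  · rintro i hi σ' hfr hri ⟨hlow, hhigh⟩
    have hc := hσ.frame hfr (by decide)
    rw [hm] at hi
    refine WP.branch ?_ (fun h => ?_) (fun h => ?_)
    · simp [hri]; omega
    · have hk : I (7 + 4 * i) = 1 := by simpa [hc.inp, hri] using h
      obtain ⟨hs, hd, hl⟩ := hI i hi
      have hl := hl hk
      have hrl : row i < (k + 1) * n := cell_lt (by omega) hs
      -- The rows written lie beyond block `0`, so the closure stays intact while it is being read.
      have hrn : n ≤ row i := by simp only [hrow]; nlinarith
      have hx : ∀ q < n, row i * n + q < (k + 1) * n * n := fun q hq => cell_lt hrl hq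
      have hnn : n * n ≤ row i * n := Nat.mul_le_mul_right _ hrn
      have hdl : ∀ q < n, I (9 + 4 * i) * n + q < n * n := fun q hq => cell_lt hd hq
      refine WP.seq (WP.assign ?_ (WP.seq (WP.assign ?_ ?_)))
      · simp [hri]; omega
      · simp [hri, hc.inp, hc.hn]
        simp only [hrow] at hrl
        omega
      refine WP.upTo_const (K := 60)
        (Inv := fun i' τ => (∀ x < n * n, τ.mem 3 x = E x) ∧ ∀ x, n * n ≤ x → (τ.mem 3 x ≠ 0 ↔
          σ'.mem 3 x ≠ 0 ∨ ∃ q < i', E (I (9 + 4 * i) * n + q) ≠ 0 ∧ x = row i * n + q))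
        (by decide) (by decide) (by decide) (by simp [hc.hn]; omega) ?_ ?_ ?_
      · simpa using hlow
      · rintro q hq τ hfr' hrq ⟨hlow', hhigh'⟩
        have hc' := (((hc.tick _).setReg (by decide) _ _).setReg (by decide) _ _).frame hfr'
          (by decide)
        have h9 : τ.reg 9 = I (9 + 4 * i) := by
          rw [hfr'.reg 9 (by decide)]; simp [hri, hc.inp]
        have h10 : τ.reg 10 = row i := by
          rw [hfr'.reg 10 (by decide)]; simp [hri, hc.inp, hc.hn, hrow]
        simp [hc.hn] at hq
        have hx := hx q hq
        have hdl := hdl q hq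
        refine WP.branch ?_ (fun h' => WP.store ?_ ?_ ⟨⟨?_, ?_⟩, ?_⟩)
          (fun h' => WP.skip ⟨⟨?_, ?_⟩, ?_⟩)
        · simp [h9, hc'.hn, hrq]; omega
        · simp [h10, hc'.hn, hrq]; omega
        · simp; omega
        · intro x hx'
          simp [h10, hrq, hc'.hn]
          rw [Function.update_of_ne (by omega)]
          exact hlow' x hx'
        · intro x hx'
          simp [h10, hrq, hc'.hn, Function.update_apply]
          simp [h9, hrq, hc'.hn, hlow' _ hdl] at h'
          split
          · refine iff_of_true one_ne_zero (Or.inr ⟨q, by omega, h', by assumption⟩)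
          · refine (hhigh' x hx').trans (or_congr_right ?_)
            constructor
            · rintro ⟨q', hq', h1, h2⟩; exact ⟨q', by omega, h1, h2⟩
            · rintro ⟨q', hq', h1, h2⟩
              exact ⟨q', by rcases Nat.lt_or_eq_of_le hq' with h3 | rfl <;> [exact h3; omega],
                h1, h2⟩
        · simp
        · exact hlow'
        · intro x hx'
          simp [h9, hrq, hc'.hn, hlow' _ hdl] at h'
          refine (hhigh' x hx').trans (or_congr_right ?_)
          constructor
          · rintro ⟨q', hq', h1, h2⟩; exact ⟨q', by omega, h1, h2⟩
          · rintro ⟨q', hq', h1, h2⟩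
            refine ⟨q', ?_, h1, h2⟩
            rcases Nat.lt_succ_iff_lt_or_eq.1 hq' with h3 | rfl
            · exact h3
            · exact absurd h' h1
        · simp
      · rintro τ hfr' ⟨hlow', hhigh'⟩ hcl
        simp [hc.hn] at hcl hhigh'
        refine ⟨⟨hlow', fun x hx => ?_⟩, ?_⟩
        · refine (hhigh' x hx).trans ?_
          rw [← ne_eq, hhigh x hx]
          constructor
          · rintro (⟨j, hj, h'⟩ | ⟨q, hq, h1, h2⟩)
            · exact ⟨j, by omega, h'⟩
            · exact ⟨i, by omega, hk, q, hq, h1, h2⟩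
          · rintro ⟨j, hj, h', q, hq, h1, h2⟩
            rcases Nat.lt_or_eq_of_le (Nat.le_of_lt_succ hj) with h3 | rfl
            · exact Or.inl ⟨j, h3, h', q, hq, h1, h2⟩
            · exact Or.inr ⟨q, hq, h1, h2⟩
        · omega
    · have hk : I (7 + 4 * i) ≠ 1 := by simpa [hc.inp, hri] using h
      refine WP.skip ⟨⟨hlow, fun x hx => ?_⟩, ?_⟩
      · refine (hhigh x hx).trans ?_
        constructor
        · rintro ⟨j, hj, h⟩; exact ⟨j, by omega, h⟩
        · rintro ⟨j, hj, h⟩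
          refine ⟨j, ?_, h⟩
          rcases Nat.lt_or_eq_of_le (Nat.le_of_lt_succ hj) with h3 | rfl
          · exact h3
          · exact absurd h.1 hk
      · simp; omega
  · rintro τ hfr ⟨hlow, hhigh⟩ hcl
    rw [hm] at hhigh hcl
    refine ⟨hlow, fun a p hp q hq => ?_, hcl⟩
    have hnn : n * n ≤ ((a + 1) * n + p) * n + q := by nlinarith
    rw [hhigh _ hnn]
    constructor
    · rintro ⟨j, hj, h1, q', hq', h2, h3⟩
      obtain ⟨h4, rfl⟩ := (cell_inj hq hq').1 h3
      obtain ⟨h5, h6⟩ := (cell_inj hp (hI j hj).1).1 h4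
      exact ⟨j, hj, h1, by omega, h6.symm, h2⟩
    · rintro ⟨j, hj, h1, rfl, rfl, h2⟩
      exact ⟨j, hj, h1, q, hq, h2, rfl⟩

/-- Compute the block that each level uses. -/
def levelBlocks : Cmd :=
  .upTo 7 3 (.store 15 (.add (.reg 7) (.const 1)) (.add
    (.load 0 (.add (.reg 7) (.add (.const 6) (.mul (.const 4) (.reg 2))))) (.const 1)))

/-- No letter precedes gap `0`, so level `0` uses the closure itself; level `i + 1` reads letter
number `i`, whose block number is shifted by one because block `0` is taken. -/
theorem levelBlocks_spec {w k n v m l q₀ qf : ℕ} {I : ℕ → ℕ} {σ : State}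
    (hσ : Ctx n v m l q₀ qf I σ) (hI : ∀ i < l, I (i + (6 + 4 * m)) < k)
    (h15 : σ.mem 15 0 = 0) (hB : 4 * m + l + k + 20 < modulus w) :
    WP w levelBlocks (fun τ => τ.mem 15 0 = 0 ∧
      (∀ i < l, τ.mem 15 (i + 1) = I (i + (6 + 4 * m)) + 1) ∧
      τ.clock ≤ σ.clock + l * 40 + 6) σ := by
  have hl := hσ.hl
  refine WP.upTo_const (K := 40) (Inv := fun i' τ => τ.mem 15 0 = 0 ∧
      (∀ i < i', τ.mem 15 (i + 1) = I (i + (6 + 4 * m)) + 1))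
    (by decide) (by decide) (by decide) (by omega) ?_ ?_ ?_
  · simpa using h15
  · rintro i hi σ' hfr hri ⟨h0, h1⟩
    have hc := hσ.frame hfr (by decide)
    rw [hl] at hi
    have := hI i hi
    refine WP.store ?_ ?_ ⟨⟨?_, ?_⟩, ?_⟩
    · simp [hri]; omega
    · simp [hri, hc.inp, hc.hm]; omega
    · simp [h0]
    · intro j hj
      simp [Function.update_apply, hri, hc.inp, hc.hm]
      split
      · simp_all
      · exact h1 j (by omega)
    · simp
  · rintro τ hfr ⟨h0, h1⟩ hcl
    rw [hl] at h1 hcl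
    exact ⟨h0, h1, hcl⟩

end RAM

namespace RAM

/-! ### Variable statuses -/

/-- `Walk I m q₀ q f` says that some walk of transitions from `q₀` to `q` applies `f x` operations to
every variable `x`. -/
inductive Walk (I : ℕ → ℕ) (m q₀ : ℕ) : ℕ → (ℕ → ℕ) → Prop
  | nil : Walk I m q₀ q₀ fun _ => 0
  | snoc {j p q : ℕ} {f : ℕ → ℕ} : Walk I m q₀ p f → j < m → I (6 + 4 * j) = p →
      I (9 + 4 * j) = q →
      Walk I m q₀ q fun x => f x + if 1 < I (7 + 4 * j) ∧ x = I (8 + 4 * j) then 1 else 0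

/-- Mark the target of transition number `reg 7`, whose source is marked, and compute the
statuses of the variables there. -/
def discover : Cmd :=
  .seq (.store 6 (field 9 7) (.const 1))
  (.seq (.assign 8 (.const 1))
  (.seq (.assign 10 (field 9 7))
  (.seq (.assign 11 (field 6 7))
  (.seq (.upTo 9 1 (.store 7 (cell (.reg 10) (.reg 9)) (.load 7 (cell (.reg 11) (.reg 9)))))
    (.branch (.lt (.const 1) (field 7 7))
      (.store 7 (cell (.reg 10) (field 8 7)) (.add (.load 7 (cell (.reg 10) (field 8 7)))
        (.lt (.load 7 (cell (.reg 10) (field 8 7))) (.const 2))))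
      .skip)))))

/-- Propagate marks and statuses along the transitions until nothing changes. -/
def statuses : Cmd :=
  .seq (.store 6 (.reg 4) (.const 1))
  (.seq (.assign 8 (.const 1))
    (.loop (.reg 8) (.seq (.assign 8 (.const 0))
      (.upTo 7 2 (.branch (.load 6 (field 6 7))
        (.branch (.load 6 (field 9 7)) .skip discover) .skip)))))

/-- Label kinds above `1` are the variable operations. Counters saturate at `2`: at states off every
accepting path the true counts may be larger, but the entries must remain digits `0, 1, 2` for the
trie of keys. -/
theorem discover_spec {w n v m l q₀ qf : ℕ} {I : ℕ → ℕ} {σ : State}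
    (hσ : Ctx n v m l q₀ qf I σ) (hvn : v ≤ n) {j : ℕ} (hj : j < m) (h7 : σ.reg 7 = j)
    (hs : I (6 + 4 * j) < n) (hd : I (9 + 4 * j) < n) (hne : I (6 + 4 * j) ≠ I (9 + 4 * j))
    (hl : 1 < I (7 + 4 * j) → I (8 + 4 * j) < v)
    (h2 : ∀ x < v, σ.mem 7 (I (6 + 4 * j) * n + x) ≤ 2)
    (hB : n * n + n + 4 * m + 20 < modulus w) :
    WP w discover (fun τ => τ.mem 6 = Function.update (σ.mem 6) (I (9 + 4 * j)) 1 ∧ τ.reg 8 = 1 ∧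
      (∀ a < n, ∀ x < v, τ.mem 7 (a * n + x) = if a = I (9 + 4 * j) then
        min 2 (σ.mem 7 (I (6 + 4 * j) * n + x) +
          if 1 < I (7 + 4 * j) ∧ x = I (8 + 4 * j) then 1 else 0) else σ.mem 7 (a * n + x)) ∧
      τ.clock ≤ σ.clock + v * 40 + 120) σ := by
  set p := I (6 + 4 * j) with hp
  set q := I (9 + 4 * j) with hq
  set st := σ.mem 7 with hst
  have hv := hσ.hv
  refine WP.seq (WP.store ?_ ?_ (WP.seq (WP.assign ?_ (WP.seq (WP.assign ?_ (WP.seq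
    (WP.assign ?_ (WP.seq ?_))))))))
  · simp [h7]; omega
  · simp; omega
  · simp; omega
  · simp [h7]; omega
  · simp [h7]; omega
  simp only [Expr.val, field_val, State.setReg_reg, State.setReg_mem, State.setMem_reg,
    State.setMem_mem, hσ.inp, h7, ← hp, ← hq, OfNat.zero_ne_ofNat, reduceIte, Nat.reduceEqDiff,
    Expr.cost, field_cost]
  set σ₁ := (((σ.setMem 6 q 1 (6 + 1 + 1)).setReg 8 1 (1 + 1)).setReg 10 q (6 + 1)).setReg 11 p
    (6 + 1) with hσ₁
  have hc₁ : Ctx n v m l q₀ qf I σ₁ := (((hσ.setMem (by decide) _ _ _).setReg (by decide) _ _).setReg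
    (by decide) _ _).setReg (by decide) _ _
  refine WP.upTo_const (K := 40) (Inv := fun i τ => ∀ a < n, ∀ x < v,
    τ.mem 7 (a * n + x) = if a = q ∧ x < i then st (p * n + x) else st (a * n + x))
    (by decide) (by decide) (by decide) (by simp [hσ₁, hv]; omega) ?_ ?_ ?_
  · simp [hσ₁, hst]
  · intro i hi τ hfr hri hI
    rw [hc₁.hv] at hi
    have hc := hc₁.frame hfr (by decide)
    have h10 : τ.reg 10 = q := by rw [hfr.reg 10 (by decide)]; simp [hσ₁]
    have h11 : τ.reg 11 = p := by rw [hfr.reg 11 (by decide)]; simp [hσ₁]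
    have := cell_lt hd (show i < n by omega)
    have := cell_lt hs (show i < n by omega)
    refine WP.store ?_ ?_ ⟨fun a ha x hx => ?_, ?_⟩
    · simp [h10, hri, hc.hn]; omega
    · simp [h11, hri, hc.hn]; omega
    · simp [h10, h11, hri, hc.hn]
      -- Source and target differ, so copying into the target row leaves the source row unchanged.
      have h3 : τ.mem 7 (p * n + i) = st (p * n + i) := by
        rw [hI p hs i hi, if_neg fun h => hne h.1]
      rw [update_cell (by omega) (by omega), hI a ha x hx, h3]
      by_cases h1 : a = q <;> by_cases h2 : x = i
      · simp [h1, h2]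
      · simp [h1, h2, Nat.le_iff_lt_or_eq]
      · simp [h1]
      · simp [h1]
    · simp
  · intro τ hfr hI hcl
    have hc := hc₁.frame hfr (by decide)
    rw [hc₁.hv] at hI hcl
    have hcl₁ : σ₁.clock = σ.clock + 24 := by simp [hσ₁]
    have h7' : τ.reg 7 = j := by rw [hfr.reg 7 (by decide)]; simp [hσ₁, h7]
    have h6 : τ.mem 6 = Function.update (σ.mem 6) q 1 := by
      rw [hfr.mem 6 (by decide)]; simp [hσ₁]
    have h8 : τ.reg 8 = 1 := by rw [hfr.reg 8 (by decide)]; simp [hσ₁]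
    have h10 : τ.reg 10 = q := by rw [hfr.reg 10 (by decide)]; simp [hσ₁]
    refine WP.branch ?_ (fun h => WP.store ?_ ?_ ⟨?_, ?_, fun a ha x hx => ?_, ?_⟩)
      (fun h => WP.skip ⟨?_, ?_, fun a ha x hx => ?_, ?_⟩)
    · simp [h7']; omega
    all_goals simp [h7', hc.inp] at h
    · have := cell_lt hd (show I (8 + 4 * j) < n by have := hl h; omega)
      simp [h7', h10, hc.hn, hc.inp]; omega
    · have := cell_lt hd (show I (8 + 4 * j) < n by have := hl h; omega)
      have h3 := hI q hd _ (hl h)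
      rw [if_pos ⟨rfl, hl h⟩] at h3
      have := h2 _ (hl h)
      simp [h7', h10, hc.hn, hc.inp, h3]
      refine ⟨⟨?_, ?_⟩, ⟨?_, ?_⟩, ?_⟩ <;> first | omega | (split <;> omega)
    · simp [h6]
    · simp [h8]
    · have h3 := hI q hd _ (hl h)
      rw [if_pos ⟨rfl, hl h⟩] at h3
      have h4 := h2 _ (hl h)
      have h5 := h2 x hx
      have h6 := hl h
      simp only [State.setMem_mem, State.tick_mem, Expr.val, cell_val, State.tick_reg, field_val,
        h7', hc.inp, hc.hn, h10, reduceIte, ltVal_def]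
      rw [update_cell (by omega) (by omega), h3, hI a ha x hx]
      by_cases h1 : a = q <;> by_cases h2 : x = I (8 + 4 * j)
      · simp only [h1, h2, and_self, if_true, h, h6]
        rw [h2] at h5
        split <;> omega
      · simp [h1, h2, hx]; omega
      · simp [h1]
      · simp [h1]
    · simp; omega
    · simp [h6]
    · simp [h8]
    · rw [State.tick_mem, State.tick_mem, hI a ha x hx]
      have h5 := h2 x hx
      by_cases h1 : a = q
      · simp [h1, hx, show ¬ 1 < I (7 + 4 * j) by omega, h5]
      · simp [h1]
    · simp; omega

/-- The statuses at the marked states are those of walks. -/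
structure StatusInv (n v m q₀ : ℕ) (I mark st : ℕ → ℕ) : Prop where
  start : mark q₀ ≠ 0
  walk : ∀ q < n, mark q ≠ 0 →
    ∃ f, Walk I m q₀ q f ∧ ∀ x < v, st (q * n + x) = min 2 (f x)
  le_two : ∀ q < n, ∀ x < v, st (q * n + x) ≤ 2

theorem StatusInv.discover {n v m q₀ : ℕ} {I mark st st' : ℕ → ℕ}
    (h : StatusInv n v m q₀ I mark st) {j : ℕ} (hj : j < m)
    (hs : I (6 + 4 * j) < n) (hm : mark (I (6 + 4 * j)) ≠ 0)
    (hst : ∀ a < n, ∀ x < v, st' (a * n + x) = if a = I (9 + 4 * j) then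
        min 2 (st (I (6 + 4 * j) * n + x) +
          if 1 < I (7 + 4 * j) ∧ x = I (8 + 4 * j) then 1 else 0) else st (a * n + x)) :
    StatusInv n v m q₀ I (Function.update mark (I (9 + 4 * j)) 1) st' := by
  refine ⟨?_, fun q hq hmq => ?_, fun q hq x hx => ?_⟩
  · rw [Function.update_apply]
    split
    · exact one_ne_zero
    · exact h.start
  · by_cases h1 : q = I (9 + 4 * j)
    · obtain ⟨f, hf, hfx⟩ := h.walk _ hs hm
      refine ⟨_, hf.snoc hj rfl h1.symm, fun x hx => ?_⟩
      rw [hst q hq x hx, if_pos h1, hfx x hx]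
      omega
    · rw [Function.update_of_ne h1] at hmq
      obtain ⟨f, hf, hfx⟩ := h.walk q hq hmq
      refine ⟨f, hf, fun x hx => ?_⟩
      rw [hst q hq x hx, if_neg h1, hfx x hx]
  · rw [hst q hq x hx]
    split
    · exact min_le_left _ _
    · exact h.le_two q hq x hx

/-- The number of states without mark. -/
def unmarked (n : ℕ) (mark : ℕ → ℕ) : ℕ :=
  ((Finset.range n).filter fun a => mark a = 0).card

theorem unmarked_update {n q : ℕ} {mark : ℕ → ℕ} (hq : q < n) (h : mark q = 0) :
    unmarked n (Function.update mark q 1) + 1 = unmarked n mark := by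
  have : ((Finset.range n).filter fun a => Function.update mark q 1 a = 0) =
      ((Finset.range n).filter fun a => mark a = 0).erase q := by
    ext a
    by_cases ha : a = q <;> simp [ha]
  rw [unmarked, unmarked, this, Finset.card_erase_add_one]
  simp [hq, h]

/-- Every round except the last one marks a new state, so there are at most `n + 1` scans of the
transitions. The `O(v)` work of `discover` is done once per state. -/
theorem statuses_spec {w n v m l q₀ qf : ℕ} {I : ℕ → ℕ} {σ : State}
    (hσ : Ctx n v m l q₀ qf I σ) (hvn : v ≤ n) (hq₀ : q₀ < n)
    (h6 : ∀ q, σ.mem 6 q = 0) (h7 : ∀ x, σ.mem 7 x = 0)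
    (hI : ∀ j < m, I (6 + 4 * j) < n ∧ I (9 + 4 * j) < n ∧
      (1 < I (7 + 4 * j) → I (8 + 4 * j) < v))
    (hB : n * n + n + 4 * m + 20 < modulus w) :
    WP w statuses (fun τ => StatusInv n v m q₀ I (τ.mem 6) (τ.mem 7) ∧
      (∀ j < m, τ.mem 6 (I (6 + 4 * j)) ≠ 0 → τ.mem 6 (I (9 + 4 * j)) ≠ 0) ∧
      τ.clock ≤ σ.clock + (n + 1) * (m * 60 + 50) + n * (v * 40 + 200) + 20) σ := by
  set u : State → ℕ := fun τ => unmarked n (τ.mem 6) with hu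
  set P := m * 60 + 50 with hP
  set K := v * 40 + 200 with hK
  refine WP.seq (WP.store (by simp) (by simp; omega) (WP.seq (WP.assign (by simp; omega) ?_)))
  simp only [Expr.val, hσ.hq₀, Expr.cost]
  set σ₁ := (σ.setMem 6 q₀ 1 (1 + 1 + 1)).setReg 8 1 (1 + 1) with hσ₁
  have hc₁ : Ctx n v m l q₀ qf I σ₁ := (hσ.setMem (by decide) _ _ _).setReg (by decide) _ _
  -- `P` is the price of a round, `K` that of a discovery. The number of rounds still to be paid is
  -- bounded by the unmarked states plus one if register 8 requests another round.
  refine WP.loop (D := σ₁.clock + (n + 1) * P + n * K) (Inv := fun τ =>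
    StatusInv n v m q₀ I (τ.mem 6) (τ.mem 7) ∧ τ.reg 8 ≤ 1 ∧
    (τ.reg 8 = 0 → ∀ j < m, τ.mem 6 (I (6 + 4 * j)) ≠ 0 → τ.mem 6 (I (9 + 4 * j)) ≠ 0) ∧
    τ.clock + ((u τ + τ.reg 8) * P + u τ * K) ≤ σ₁.clock + (n + 1) * P + n * K) ?_ ?_ ?_ ?_ ?_
  · refine ⟨⟨?_, fun q hq hm => ?_, ?_⟩, ?_, ?_, ?_⟩
    · simp [hσ₁]
    · have : q = q₀ := by
        by_contra hne
        simp [hσ₁, Function.update_of_ne hne, h6] at hm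
      subst this
      exact ⟨_, .nil, by simp [hσ₁, h7]⟩
    · simp [hσ₁, h7]
    · simp [hσ₁]
    · simp [hσ₁]
    · have : u σ₁ ≤ n := (Finset.card_filter_le _ _).trans (by simp)
      have h1 : (u σ₁ + 1) * P ≤ (n + 1) * P := Nat.mul_le_mul_right _ (by omega)
      have h2 : u σ₁ * K ≤ n * K := Nat.mul_le_mul_right _ this
      have h3 : σ₁.reg 8 = 1 := by simp [hσ₁]
      rw [h3]
      omega
  · rintro τ ⟨-, -, -, h⟩
    omega
  · intros
    exact trivial
  · rintro τ hfr ⟨hS, h8, -, hcl⟩ h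
    simp only [Expr.val] at h
    have h8 : τ.reg 8 = 1 := by omega
    have hc := hc₁.frame hfr (by decide)
    refine WP.seq (WP.assign (by simp; omega) ?_)
    simp only [Expr.val, Expr.cost]
    have hm := hc.hm
    refine WP.upTo (Inv := fun i τ' => StatusInv n v m q₀ I (τ'.mem 6) (τ'.mem 7) ∧
      τ'.reg 8 ≤ 1 ∧
      (τ'.reg 8 = 0 → ∀ j < i, τ'.mem 6 (I (6 + 4 * j)) ≠ 0 → τ'.mem 6 (I (9 + 4 * j)) ≠ 0) ∧
      τ'.clock + ((m - i) * 60 + ((u τ' + τ'.reg 8) * P + u τ' * K)) ≤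
        σ₁.clock + (n + 1) * P + n * K) (by decide) (by decide) (by decide)
      (by simp [hm]; omega) ?_ ?_ ?_
    · refine ⟨by simpa using hS, by simp, by simp, ?_⟩
      have h1 : u (((τ.tick (1 + 1)).setReg 8 0 (1 + 1)).setReg 7 0 6) = u τ := by simp [hu]
      rw [h1]
      rw [h8, add_mul] at hcl
      simp
      omega
    · rintro i hi τ' hfr' hri ⟨hS', h8', hJ', hcl'⟩
      simp [hm] at hi
      have hc' := ((hc.tick _).setReg (by decide) _ _).frame hfr' (by decide)
      obtain ⟨hs, hd, hl⟩ := hI i hi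
      have hmi : m - i = m - (i + 1) + 1 := by omega
      rw [hmi] at hcl'
      refine WP.branch ?_ (fun h1 => WP.branch ?_ (fun h2 => WP.skip ⟨?_, ?_, ?_, ?_⟩)
        (fun h2 => ?_)) (fun h1 => WP.skip ⟨?_, ?_, ?_, ?_⟩)
      · simp [hri]; omega
      · simp [hri]; omega
      · simpa using hS'
      · simpa using h8'
      · simp [hri, hc'.inp] at h2
        simp only [State.setReg_reg, State.tick_reg, Nat.reduceEqDiff, if_false,
          State.setReg_mem, State.tick_mem]
        intro h j hj
        rcases Nat.lt_succ_iff_lt_or_eq.1 hj with hj | rfl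
        · exact hJ' h j hj
        · exact fun _ => h2
      · have : u ((((τ'.tick ((Expr.load 6 (field 6 7)).cost + 1)).tick
            ((Expr.load 6 (field 9 7)).cost + 1)).tick 1).setReg 7 (i + 1) 8) = u τ' := by
          simp [hu]
        rw [this]
        simp
        omega
      · simp [hri, hc'.inp] at h1 h2
        refine (discover_spec ((hc'.tick _).tick _) hvn hi (by simp [hri]) hs hd ?_ hl ?_
          (by omega)).mono ?_
        · intro h
          rw [h] at h1
          exact h1 h2
        · simpa using fun x hx => hS'.le_two _ hs x hx
        · rintro υ hfu ⟨hu6, hu8, hu7, hucl⟩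
          simp only [State.tick_mem] at hu6 hu7
          refine ⟨?_, ?_, ?_, ?_⟩
          · simpa [hu6] using hS'.discover hi hs h1 hu7
          · simp [hu8]
          · simp [hu8]
          · have h3 : u (υ.setReg 7 (i + 1) 8) + 1 = u τ' := by
              simp only [hu, State.setReg_mem, hu6]
              exact unmarked_update hd h2
            rw [← h3] at hcl'
            have h4 : (u (υ.setReg 7 (i + 1) 8) + 1) * P ≤
              (u (υ.setReg 7 (i + 1) 8) + 1 + τ'.reg 8) * P := Nat.mul_le_mul_right _ (by omega)
            rw [add_mul _ 1 K] at hcl'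
            simp [hu8] at hucl ⊢
            omega
      · simpa using hS'
      · simpa using h8'
      · simp [hri, hc'.inp] at h1
        simp only [State.setReg_reg, State.tick_reg, Nat.reduceEqDiff, if_false,
          State.setReg_mem, State.tick_mem]
        intro h j hj
        rcases Nat.lt_succ_iff_lt_or_eq.1 hj with hj | rfl
        · exact hJ' h j hj
        · exact fun h => absurd h1 h
      · have : u (((τ'.tick ((Expr.load 6 (field 6 7)).cost + 1)).tick 1).setReg 7 (i + 1) 8) =
            u τ' := by
          simp [hu]
        rw [this]
        simp
        omega
    · rintro τ' hfr' ⟨hS', h8', hJ', hcl'⟩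
      simp [hm] at hJ' hcl'
      exact ⟨hS', h8', hJ', by omega⟩
  · rintro τ hfr ⟨hS, h8, hJ, hcl⟩ h
    refine ⟨hS, hJ h, ?_⟩
    have : σ₁.clock = σ.clock + 5 := by simp [hσ₁]
    simp
    omega

end RAM

namespace RAM

/-! ### Keys of status vectors -/

/-- A trie with branching degree three: `child (3 * a + s)` is the child of the node `a` for the
digit `s`, and zero if there is none. -/
structure TrieInv (child : ℕ → ℕ) (cnt : ℕ) : Prop where
  le : ∀ i, child i ≤ cnt
  inj : ∀ i j, child i = child j → child i ≠ 0 → i = j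

/-- The word `f 0, …, f (i - 1)` leads from the root to the node `a`. -/
def TrieWalk (child f : ℕ → ℕ) (i a : ℕ) : Prop :=
  ∃ nd : ℕ → ℕ, nd 0 = 0 ∧ nd i = a ∧
    ∀ x < i, child (nd x * 3 + f x) = nd (x + 1) ∧ nd (x + 1) ≠ 0

/-- The new node number exceeds all existing ones, so no two cells share a child. -/
theorem TrieInv.insert {child : ℕ → ℕ} {cnt i : ℕ} (h : TrieInv child cnt) :
    TrieInv (Function.update child i (cnt + 1)) (cnt + 1) := by
  refine ⟨fun j => ?_, fun j j' hj hne => ?_⟩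
  · have := h.le j
    rw [Function.update_apply]
    split <;> omega
  · have h1 := h.le j
    have h2 := h.le j'
    rw [Function.update_apply] at hj hne
    rw [Function.update_apply] at hj
    split at hj <;> split at hj
    · simp_all
    · omega
    · omega
    · exact h.inj j j' hj (by simp_all)

theorem TrieWalk.mono {child child' f : ℕ → ℕ} {i a : ℕ} (h : TrieWalk child f i a)
    (hc : ∀ j, child j ≠ 0 → child' j = child j) : TrieWalk child' f i a := by
  obtain ⟨nd, h0, hi, hs⟩ := h
  refine ⟨nd, h0, hi, fun x hx => ⟨?_, (hs x hx).2⟩⟩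
  rw [hc _ (by rw [(hs x hx).1]; exact (hs x hx).2), (hs x hx).1]

theorem TrieWalk.succ {child f : ℕ → ℕ} {i a : ℕ} (h : TrieWalk child f i a)
    (hc : child (a * 3 + f i) ≠ 0) : TrieWalk child f (i + 1) (child (a * 3 + f i)) := by
  obtain ⟨nd, h0, hi, hs⟩ := h
  refine ⟨Function.update nd (i + 1) (child (a * 3 + f i)), ?_, by simp, fun x hx => ?_⟩
  · rw [Function.update_of_ne (by omega), h0]
  · rcases Nat.lt_succ_iff_lt_or_eq.1 hx with hx | rfl
    · rw [Function.update_of_ne (by omega), Function.update_of_ne (by omega)]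
      exact hs x hx
    · rw [Function.update_of_ne (by omega), hi, Function.update_self]
      exact ⟨rfl, hc⟩

theorem TrieWalk.le {child f : ℕ → ℕ} {i a cnt : ℕ} (h : TrieWalk child f i a)
    (hc : TrieInv child cnt) : a ≤ cnt := by
  obtain ⟨nd, h0, hi, hs⟩ := h
  cases i with
  | zero => omega
  | succ i =>
    rw [← hi, ← (hs i (by omega)).1]
    exact hc.le _

/-- A nonzero child determines its cell `3 * a + s`, and with `s < 3` both the parent `a` and the
digit `s`. So the end node of a walk determines the walk, digit by digit from the end. -/
theorem TrieWalk.eq_iff {child f g : ℕ → ℕ} {i a b cnt : ℕ} (hf : TrieWalk child f i a)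
    (hg : TrieWalk child g i b) (hc : TrieInv child cnt) (hf3 : ∀ x < i, f x < 3)
    (hg3 : ∀ x < i, g x < 3) : a = b ↔ ∀ x < i, f x = g x := by
  obtain ⟨nd, h0, hi, hs⟩ := hf
  obtain ⟨nd', h0', hi', hs'⟩ := hg
  subst hi hi'
  induction i with
  | zero => simp [h0, h0']
  | succ i ih =>
    have ih := ih (fun x hx => hf3 x (by omega)) (fun x hx => hg3 x (by omega))
      (fun x hx => hs x (by omega)) (fun x hx => hs' x (by omega))
    obtain ⟨h1, h2⟩ := hs i (by omega)
    obtain ⟨h1', h2'⟩ := hs' i (by omega)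
    have h3 := hf3 i (by omega)
    have h3' := hg3 i (by omega)
    constructor
    · intro h x hx
      have h4 := hc.inj _ _ (h1.trans (h.trans h1'.symm)) (by rw [h1]; exact h2)
      rcases Nat.lt_succ_iff_lt_or_eq.1 hx with hx | rfl
      · exact ih.1 (by omega) x hx
      · omega
    · intro h
      rw [← h1, ← h1', ih.2 fun x hx => h x (by omega), h i (by omega)]

/-- One step down the trie. -/
def trieStep : Cmd :=
  .seq (.assign 10 (.add (.mul (.reg 8) (.const 3)) (.load 7 (cell (.reg 7) (.reg 9)))))
  (.seq (.branch (.load 8 (.reg 10)) .skip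
      (.seq (.assign 11 (.add (.reg 11) (.const 1))) (.store 8 (.reg 10) (.reg 11))))
    (.assign 8 (.load 8 (.reg 10))))

/-- Compute a key for the status vector of every state. -/
def keys : Cmd :=
  .seq (.assign 11 (.const 0))
    (.upTo 7 0 (.seq (.assign 8 (.const 0))
      (.seq (.upTo 9 1 trieStep) (.store 9 (.reg 7) (.add (.reg 8) (.const 1))))))

/-- A trie identifies equal status rows in time `O(nv)`, where comparing all pairs of rows would
take `n²v`. The key is the trie node plus one, so that zero can mean "no key". -/
theorem keys_spec {w n v m l q₀ qf : ℕ} {I : ℕ → ℕ} {σ : State}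
    (hσ : Ctx n v m l q₀ qf I σ) (hvn : v ≤ n)
    (h2 : ∀ q < n, ∀ x < v, σ.mem 7 (q * n + x) ≤ 2)
    (h8 : ∀ x, σ.mem 8 x = 0) (hB : 3 * (n * n) + n + 20 < modulus w) :
    WP w keys (fun τ => (∀ q < n, τ.mem 9 q ≠ 0) ∧
      (∀ q < n, ∀ q' < n, τ.mem 9 q = τ.mem 9 q' ↔
        ∀ x < v, σ.mem 7 (q * n + x) = σ.mem 7 (q' * n + x)) ∧
      τ.clock ≤ σ.clock + n * (v * 60 + 40) + 20) σ := by
  set st : ℕ → ℕ → ℕ := fun q x => σ.mem 7 (q * n + x) with hst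
  have hnv : n * v ≤ n * n := Nat.mul_le_mul_left _ hvn
  refine WP.seq (WP.assign (by simp; omega) ?_)
  simp only [Expr.val, Expr.cost]
  -- Each row adds at most `v` nodes; with `v ≤ n` the trie addresses stay below about `3n²`.
  refine WP.upTo_const (K := v * 60 + 40) (Inv := fun i τ => TrieInv (τ.mem 8) (τ.reg 11) ∧
    τ.reg 11 ≤ i * v ∧ ∀ q < i, ∃ a, τ.mem 9 q = a + 1 ∧ TrieWalk (τ.mem 8) (st q) v a)
    (by decide) (by decide) (by decide) (by simp [hσ.hn]; omega) ?_ ?_ ?_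
  · refine ⟨⟨?_, ?_⟩, ?_, ?_⟩ <;> simp [h8]
  · rintro i hi σ' hfr hri ⟨hT, hcnt, hW⟩
    have hc := (hσ.setReg (by decide) 0 (1 + 1)).frame hfr (by decide)
    simp [hσ.hn] at hi
    have h7 : σ'.mem 7 = σ.mem 7 := hfr.mem 7 (by decide)
    have hiv : i * v + v ≤ n * v := by
      calc i * v + v = (i + 1) * v := by ring
        _ ≤ n * v := Nat.mul_le_mul_right _ hi
    refine WP.seq (WP.assign (by simp; omega) (WP.seq ?_))
    simp only [Expr.val, Expr.cost]
    have hv := hc.hv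
    -- Cells of the trie that have been set never change, so the walks of earlier rows survive the
    -- insertions for row `i`.
    refine WP.upTo_const (K := 60) (Inv := fun x τ => TrieInv (τ.mem 8) (τ.reg 11) ∧
      τ.reg 11 ≤ i * v + x ∧ (∀ j, σ'.mem 8 j ≠ 0 → τ.mem 8 j = σ'.mem 8 j) ∧
      TrieWalk (τ.mem 8) (st i) x (τ.reg 8))
      (by decide) (by decide) (by decide) (by simp [hv]; omega) ?_ ?_ ?_
    · refine ⟨by simpa using hT, by simpa using hcnt, by simp, fun _ => 0, rfl, by simp, by simp⟩
    · rintro x hx τ hfr' hrx ⟨hT', hcnt', hold, hW'⟩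
      simp [hv] at hx
      have hc' := (hc.setReg (by decide) 0 (1 + 1)).frame hfr' (by decide)
      have h7' : τ.mem 7 = σ.mem 7 := by rw [hfr'.mem 7 (by decide)]; simpa using h7
      have hri' : τ.reg 7 = i := by rw [hfr'.reg 7 (by decide)]; simpa using hri
      have hcell := cell_lt hi (show x < n by omega)
      have hle := hW'.le hT'
      have h2x := h2 i hi x hx
      refine WP.seq (WP.assign ?_ (WP.seq (WP.branch trivial (fun h => WP.skip (WP.assign trivial
        ⟨⟨?_, ?_, ?_, ?_⟩, ?_⟩)) (fun h => WP.seq (WP.assign ?_ (WP.store trivial trivial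
          (WP.assign trivial ⟨⟨?_, ?_, ?_, ?_⟩, ?_⟩)))))))
      · simp [hri', hrx, hc'.hn, h7']; omega
      all_goals simp [hri', hrx, hc'.hn, h7'] at h
      · simpa using hT'
      · simp; omega
      · simpa using hold
      · simpa [hri', hrx, hc'.hn, h7'] using hW'.succ (f := st i) h
      · simp
      · simp; omega
      · simpa using hT'.insert
      · simp; omega
      · intro j hj
        have := hold j hj
        simp [hri', hrx, hc'.hn, h7', Function.update_apply]
        split
        · simp_all
        · exact this
      · have := (hW'.mono (child' := Function.update (τ.mem 8) (τ.reg 8 * 3 + st i x)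
          (τ.reg 11 + 1)) (fun j hj => Function.update_of_ne (by rintro rfl; exact hj h) _ _)).succ
            (by simp)
        simpa [hri', hrx, hc'.hn, h7'] using this
      · simp
    · rintro τ hfr' ⟨hT', hcnt', hold, hW'⟩ hcl
      simp [hv] at hcnt' hW' hcl
      have hri' : τ.reg 7 = i := by rw [hfr'.reg 7 (by decide)]; simpa using hri
      have h9 : τ.mem 9 = σ'.mem 9 := by rw [hfr'.mem 9 (by decide)]; simp
      have hle := hW'.le hT'
      refine WP.store trivial ?_ ⟨⟨?_, ?_, ?_⟩, ?_⟩
      · simp; omega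
      · simpa using hT'
      · simp [add_mul]; omega
      · intro q hq
        rcases Nat.lt_succ_iff_lt_or_eq.1 hq with hq | rfl
        · obtain ⟨a, ha, hwa⟩ := hW q hq
          refine ⟨a, ?_, ?_⟩
          · simp [hri', h9, Function.update_of_ne (show q ≠ i by omega), ha]
          · simpa using hwa.mono hold
        · exact ⟨τ.reg 8, by simp [hri'], by simpa using hW'⟩
      · simp; omega
  · rintro τ hfr ⟨hT, hcnt, hW⟩ hcl
    simp [hσ.hn] at hW hcl
    refine ⟨fun q hq => ?_, fun q hq q' hq' => ?_, by omega⟩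
    · obtain ⟨a, ha, -⟩ := hW q hq
      omega
    · obtain ⟨a, ha, h⟩ := hW q hq
      obtain ⟨b, hb, h'⟩ := hW q' hq'
      rw [ha, hb, add_left_inj]
      exact h.eq_iff h' hT (fun x hx => Nat.lt_succ_of_le (h2 q hq x hx))
        (fun x hx => Nat.lt_succ_of_le (h2 q' hq' x hx))

/-! ### States from which the end can be reached -/

/-- There is a path in the layered graph with edges `Ed` from the node `p` of level `j` to the node
`f` of level `L`. -/
def AliveAt (n L f : ℕ) (Ed : ℕ → ℕ → ℕ → Prop) (j p : ℕ) : Prop :=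
  ∃ run : ℕ → ℕ, run j = p ∧ run L = f ∧
    ∀ i, j ≤ i → i < L → run (i + 1) < n ∧ Ed i (run i) (run (i + 1))

theorem aliveAt_last {n L f : ℕ} {Ed : ℕ → ℕ → ℕ → Prop} {p : ℕ} :
    AliveAt n L f Ed L p ↔ p = f := by
  constructor
  · rintro ⟨run, h1, h2, -⟩
    rw [← h1, h2]
  · rintro rfl
    exact ⟨fun _ => p, rfl, rfl, fun i h1 h2 => by omega⟩

theorem aliveAt_step {n L f : ℕ} {Ed : ℕ → ℕ → ℕ → Prop} {j p : ℕ} (hj : j < L) :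
    AliveAt n L f Ed j p ↔ ∃ q < n, Ed j p q ∧ AliveAt n L f Ed (j + 1) q := by
  constructor
  · rintro ⟨run, rfl, h2, h3⟩
    exact ⟨run (j + 1), (h3 j le_rfl hj).1, (h3 j le_rfl hj).2, run, rfl, h2,
      fun i h1 h2 => h3 i (by omega) h2⟩
  · rintro ⟨q, hq, he, run, rfl, h2, h3⟩
    refine ⟨Function.update run j p, by simp, ?_, fun i h1 h2 => ?_⟩
    · rw [Function.update_of_ne (by omega), h2]
    · rw [Function.update_of_ne (show i + 1 ≠ j by omega)]
      rcases Nat.eq_or_lt_of_le h1 with rfl | h1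
      · simpa using ⟨hq, he⟩
      · rw [Function.update_of_ne (by omega)]
        exact h3 i (by omega) h2

/-- Mark, from the last level to the first one, the nodes from which the end can be reached. -/
def aliveNodes : Cmd :=
  .seq (.store 10 (cell (.reg 6) (.reg 5)) (.const 1))
    (.upTo 7 6 (.seq (.assign 8 (.sub (.reg 6) (.add (.reg 7) (.const 1))))
      (.seq (.assign 9 (.load 15 (.reg 8)))
        (.upTo 10 0 (.seq (.assign 12 (cell (.reg 9) (.reg 10)))
          (.upTo 11 0 (.branch (.load 3 (cell (.reg 12) (.reg 11)))
            (.branch (.load 10 (cell (.add (.reg 8) (.const 1)) (.reg 11)))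
              (.store 10 (cell (.reg 8) (.reg 10)) (.const 1)) .skip) .skip)))))))

/-- Backward induction with `aliveAt_step`, starting from `qf`, the only live node of level `l + 1`.
One `n × n` block is read per level. The second half of the invariant says that the rows of lower
levels are still zero. -/
theorem aliveNodes_spec {w k n v m l q₀ qf : ℕ} {I : ℕ → ℕ} {σ : State}
    {Ed : ℕ → ℕ → ℕ → Prop}
    (hσ : Ctx n v m l q₀ qf I σ) (hqf : qf < n) (h10 : ∀ x, σ.mem 10 x = 0)
    (hk : ∀ j ≤ l, σ.mem 15 j ≤ k)
    (hEd : ∀ j ≤ l, ∀ p < n, ∀ q < n, σ.mem 3 ((σ.mem 15 j * n + p) * n + q) ≠ 0 ↔ Ed j p q)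
    (hB : (k + 1) * n * n + (k + 1) * n + (l + 2) * n + l + n + 20 < modulus w) :
    WP w aliveNodes (fun τ => (∀ j ≤ l + 1, ∀ p < n,
        τ.mem 10 (j * n + p) ≠ 0 ↔ AliveAt n (l + 1) qf Ed j p) ∧
      τ.clock ≤ σ.clock + (l + 1) * (n * (n * 60 + 60) + 60) + 20) σ := by
  set Al := AliveAt n (l + 1) qf Ed with hAl
  have hLn : (l + 1) * n + qf < (l + 2) * n := cell_lt (by omega) hqf
  refine WP.seq (WP.store ?_ ?_ ?_)
  · simp [hσ.hn, hσ.hqf, hσ.hL]; omega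
  · simp; omega
  simp only [Expr.val, Expr.cost, cell_val, cell_cost, hσ.hn, hσ.hqf, hσ.hL]
  set σ₁ := σ.setMem 10 ((l + 1) * n + qf) 1 (1 + 1 + 3 + 1 + 1) with hσ₁
  have hc₁ : Ctx n v m l q₀ qf I σ₁ := hσ.setMem (by decide) _ _ _
  have hL := hc₁.hL
  refine WP.upTo_const (K := n * (n * 60 + 60) + 60) (Inv := fun i τ =>
    (∀ j ≤ l + 1, l + 1 ≤ j + i → ∀ p < n, τ.mem 10 (j * n + p) ≠ 0 ↔ Al j p) ∧
    ∀ x < (l + 1 - i) * n, τ.mem 10 x = 0)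
    (by decide) (by decide) (by decide) (by omega) ?_ ?_ ?_
  · refine ⟨fun j hj hj' p hp => ?_, fun x hx => ?_⟩
    · obtain rfl : j = l + 1 := by omega
      simp [hσ₁, hAl, aliveAt_last, Function.update_apply, h10]
    · simp at hx
      simp [hσ₁, h10, Function.update_of_ne (show x ≠ (l + 1) * n + qf by omega)]
  · rintro i hi σ' hfr hri ⟨hA, hZ⟩
    rw [hL] at hi
    have hc := hc₁.frame hfr (by decide)
    have h3 : σ'.mem 3 = σ.mem 3 := by rw [hfr.mem 3 (by decide)]; simp [hσ₁]
    have h15 : σ'.mem 15 = σ.mem 15 := by rw [hfr.mem 15 (by decide)]; simp [hσ₁]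
    -- The loop counts up while the levels go down: pass `i` treats level `j = l - i`.
    obtain ⟨j, hj⟩ : ∃ j, j + (i + 1) = l + 1 := ⟨l - i, by omega⟩
    have hjl : l + 1 - (i + 1) = j := by omega
    have hkj := hk j (by omega)
    have hj1 : (l + 1 - i) * n = j * n + n := by rw [show l + 1 - i = j + 1 by omega]; ring
    have hjn : (j + 1) * n + n ≤ (l + 2) * n := by nlinarith
    refine WP.seq (WP.assign ?_ (WP.seq (WP.assign trivial ?_)))
    · simp [hri]; omega
    simp only [Expr.val, Expr.cost, State.setReg_reg, State.setReg_mem, hri, hc.hL, hjl, h15,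
      reduceIte]
    set σ₂ := (σ'.setReg 8 j (1 + (1 + 1 + 1) + 1 + 1)).setReg 9 (σ.mem 15 j) (1 + 1 + 1) with hσ₂
    have hc₂ : Ctx n v m l q₀ qf I σ₂ := (hc.setReg (by decide) _ _).setReg (by decide) _ _
    have hn₂ := hc₂.hn
    refine WP.upTo_const (K := n * 60 + 60) (Inv := fun p' τ =>
      (∀ x, (x < j * n ∨ j * n + n ≤ x) → τ.mem 10 x = σ'.mem 10 x) ∧
      ∀ p < n, τ.mem 10 (j * n + p) ≠ 0 ↔ p < p' ∧ Al j p)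
      (by decide) (by decide) (by decide) (by omega) ?_ ?_ ?_
    · simp [hσ₂]
      exact fun p hp => hZ _ (by omega)
    · rintro p' hp' τ₁ hfr₁ hrp ⟨hout, hin⟩
      rw [hn₂] at hp'
      have hc₃ := hc₂.frame hfr₁ (by decide)
      have h8 : τ₁.reg 8 = j := by rw [hfr₁.reg 8 (by decide)]; simp [hσ₂]
      have h9 : τ₁.reg 9 = σ.mem 15 j := by rw [hfr₁.reg 9 (by decide)]; simp [hσ₂]
      have hrow : σ.mem 15 j * n + p' < (k + 1) * n := cell_lt (by omega) hp'
      refine WP.seq (WP.assign ?_ ?_)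
      · simp [h9, hrp, hc₃.hn]; omega
      simp only [Expr.val, Expr.cost, cell_val, cell_cost, h9, hrp, hc₃.hn]
      have hn₃ := hc₃.hn
      have hj0 : (j * n + p') < (l + 2) * n := by nlinarith
      refine WP.upTo_const (K := 60) (Inv := fun q' τ =>
        (∀ x, (x < j * n ∨ j * n + n ≤ x) → τ.mem 10 x = σ'.mem 10 x) ∧
        ∀ p < n, τ.mem 10 (j * n + p) ≠ 0 ↔
          (p < p' ∧ Al j p) ∨ (p = p' ∧ ∃ q < q', Ed j p' q ∧ Al (j + 1) q))
        (by decide) (by decide) (by decide) (by simp [hn₃]; omega) ?_ ?_ ?_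
      · simp only [State.setReg_mem]
        refine ⟨hout, fun p hp => ?_⟩
        rw [hin p hp]
        simp
      · rintro q' hq' τ₂ hfr₂ hrq ⟨hout', hin'⟩
        simp [hn₃] at hq'
        have hc₄ := (hc₃.setReg (by decide) _ _).frame hfr₂ (by decide)
        have h8' : τ₂.reg 8 = j := by rw [hfr₂.reg 8 (by decide)]; simp [h8]
        have h10' : τ₂.reg 10 = p' := by rw [hfr₂.reg 10 (by decide)]; simp [hrp]
        have h12 : τ₂.reg 12 = σ.mem 15 j * n + p' := by rw [hfr₂.reg 12 (by decide)]; simp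
        have h3' : τ₂.mem 3 = σ.mem 3 := by
          rw [hfr₂.mem 3 (by decide)]
          simp only [State.setReg_mem]
          rw [hfr₁.mem 3 (by decide)]
          simpa [hσ₂] using h3
        have hcell := cell_lt hrow hq'
        have hcell' : (j + 1) * n + q' < (l + 2) * n := by omega
        have hE := hEd j (by omega) p' hp' q' hq'
        have hal := hA (j + 1) (by omega) (by omega) q' hq'
        have hup := hout' ((j + 1) * n + q') (Or.inr (by rw [add_mul]; omega))
        have hno : ¬ (Ed j p' q' ∧ Al (j + 1) q') → (∀ p < n, τ₂.mem 10 (j * n + p) ≠ 0 ↔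
            (p < p' ∧ Al j p) ∨ (p = p' ∧ ∃ q < q' + 1, Ed j p' q ∧ Al (j + 1) q)) := by
          intro h p hp
          rw [hin' p hp]
          refine or_congr_right (and_congr_right fun _ => ?_)
          constructor
          · rintro ⟨q, hq, h⟩; exact ⟨q, by omega, h⟩
          · rintro ⟨q, hq, h'⟩
            rcases Nat.lt_succ_iff_lt_or_eq.1 hq with hq | rfl
            · exact ⟨q, hq, h'⟩
            · exact absurd h' h
        refine WP.branch ?_ (fun h => WP.branch ?_ (fun h' => WP.store ?_ ?_ ⟨⟨?_, ?_⟩, ?_⟩)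
          (fun h' => WP.skip ⟨⟨?_, ?_⟩, ?_⟩)) (fun h => WP.skip ⟨⟨?_, ?_⟩, ?_⟩)
        · simp [h12, hrq, hc₄.hn]; omega
        · simp [h8', hrq, hc₄.hn]; omega
        · simp [h8', h10', hc₄.hn]; omega
        · simp; omega
        · intro x hx
          simp [h8', h10', hc₄.hn]
          rw [Function.update_of_ne (by omega)]
          exact hout' x hx
        · intro p hp
          simp [h12, hrq, hc₄.hn, h3'] at h
          simp [h8', hrq, hc₄.hn, hup] at h'
          simp only [State.setReg_mem, State.setMem_mem, State.tick_mem, State.tick_reg, cell_val,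
            Expr.val, h8', h10', hc₄.hn, reduceIte]
          rw [update_cell hp' hp]
          by_cases h5 : p = p'
          · rw [if_pos ⟨rfl, h5⟩]
            exact iff_of_true one_ne_zero (Or.inr ⟨h5, q', by omega, hE.1 h, hal.1 h'⟩)
          · rw [if_neg (by simp [h5]), hin' p hp]
            simp [h5]
        · simp
        · exact hout'
        · simp [h8', hrq, hc₄.hn, hup] at h'
          exact hno fun h => hal.2 h.2 h'
        · simp
        · exact hout'
        · simp [h12, hrq, hc₄.hn, h3'] at h
          exact hno fun h' => hE.2 h'.1 h
        · simp
      · rintro τ₂ hfr₂ ⟨hout', hin'⟩ hcl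
        simp [hn₃] at hin' hcl
        refine ⟨⟨hout', fun p hp => ?_⟩, ?_⟩
        · refine (not_congr Iff.rfl).trans ((hin' p hp).trans ?_)
          rw [Nat.lt_succ_iff_lt_or_eq, or_and_right]
          refine or_congr_right (and_congr_right fun h => ?_)
          rw [h]
          exact (aliveAt_step (by omega)).symm
        · omega
    · rintro τ hfr₁ ⟨hout, hin⟩ hcl
      rw [hn₂] at hin hcl
      have hcl₂ : σ₂.clock = σ'.clock + 9 := by simp [hσ₂]
      refine ⟨⟨fun j' hj' hj'' p hp => ?_, fun x hx => ?_⟩, ?_⟩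
      · rcases Nat.eq_or_lt_of_le (show j ≤ j' by omega) with rfl | hlt
        · rw [hin p hp]
          simp [hp]
        · have : (j + 1) * n ≤ j' * n := Nat.mul_le_mul_right _ hlt
          rw [hout _ (Or.inr (by rw [add_mul] at this; omega))]
          exact hA j' hj' (by omega) p hp
      · rw [hout _ (Or.inl hx)]
        exact hZ x (by omega)
      · omega
  · rintro τ hfr ⟨hA, -⟩ hcl
    rw [hL] at hA hcl
    have hcl₁ : σ₁.clock = σ.clock + 7 := by simp [hσ₁]
    exact ⟨fun j hj p hp => hA j hj (by omega) p hp, by omega⟩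

end RAM

/-! ### Paths and ref-words -/

section paths

variable {S V Q : Type*}

/-- `LabelPath step p r q` says that `r` labels a path from `p` to `q`. -/
inductive LabelPath (step : Q → Option (RefSymbol S V) → Q → Prop) :
    Q → List (RefSymbol S V) → Q → Prop
  | nil (p : Q) : LabelPath step p [] p
  | eps {p q f : Q} {r : List (RefSymbol S V)} :
      step p none q → LabelPath step q r f → LabelPath step p r f
  | cons {p q f : Q} {c : RefSymbol S V} {r : List (RefSymbol S V)} :
      step p (some c) q → LabelPath step q r f → LabelPath step p (c :: r) f

theorem LabelPath.append {step : Q → Option (RefSymbol S V) → Q → Prop} {p q f : Q}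
    {r r' : List (RefSymbol S V)} (h : LabelPath step p r q) (h' : LabelPath step q r' f) :
    LabelPath step p (r ++ r') f := by
  induction h with
  | nil p => exact h'
  | eps hs _ ih => exact .eps hs (ih h')
  | cons hs _ ih => exact .cons hs (ih h')

/-- A step that reads no letter. -/
def SilentStep (step : Q → Option (RefSymbol S V) → Q → Prop) (p q : Q) : Prop :=
  ∃ o, step p o q ∧ ∀ a, o ≠ some (.letter a)

@[simp] theorem clean_nil : clean ([] : List (RefSymbol S V)) = [] := rfl

@[simp] theorem clean_letter (a : S) (r : List (RefSymbol S V)) :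
    clean (.letter a :: r) = a :: clean r := rfl

@[simp] theorem clean_opens (x : V) (r : List (RefSymbol S V)) :
    clean (.opens x :: r) = clean r := rfl

@[simp] theorem clean_closes (x : V) (r : List (RefSymbol S V)) :
    clean (.closes x :: r) = clean r := rfl

@[simp] theorem clean_append (r r' : List (RefSymbol S V)) :
    clean (r ++ r') = clean r ++ clean r' := List.filterMap_append

/-- The part of a ref-word before the letter with number `i`. -/
def gapPrefix : ℕ → List (RefSymbol S V) → List (RefSymbol S V)
  | _, [] => []
  | 0, .letter _ :: _ => []
  | i + 1, .letter a :: r => .letter a :: gapPrefix i r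
  | i, .opens x :: r => .opens x :: gapPrefix i r
  | i, .closes x :: r => .closes x :: gapPrefix i r

/-- The cut takes the longest prefix with at most `i` letters: operations standing between the last
of these letters and the next one belong to the prefix. -/
theorem gapPrefix_append_of_le {r r' : List (RefSymbol S V)} {i : ℕ} (h : (clean r).length ≤ i) :
    gapPrefix i (r ++ r') = r ++ gapPrefix (i - (clean r).length) r' := by
  induction r generalizing i with
  | nil => rfl
  | cons c r ih =>
    cases c with
    | letter a =>
      rw [clean_letter, List.length_cons] at h
      obtain ⟨i, rfl⟩ : ∃ i', i = i' + 1 := ⟨i - 1, by omega⟩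
      simp [gapPrefix, ih (show (clean r).length ≤ i by omega)]
    | opens x => cases i <;> simp [gapPrefix, ih h]
    | closes x => cases i <;> simp [gapPrefix, ih h]

theorem gapPrefix_append_of_lt {r r' : List (RefSymbol S V)} {i : ℕ} (h : i < (clean r).length) :
    gapPrefix i (r ++ r') = gapPrefix i r := by
  induction r generalizing i with
  | nil => simp at h
  | cons c r ih =>
    cases c with
    | letter a =>
      cases i with
      | zero => rfl
      | succ i =>
        rw [clean_letter, List.length_cons] at h
        simp [gapPrefix, ih (show i < (clean r).length by omega)]
    | opens x => cases i <;> simp [gapPrefix, ih h]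
    | closes x => cases i <;> simp [gapPrefix, ih h]

theorem gapPrefix_isPrefix (r : List (RefSymbol S V)) (i : ℕ) : gapPrefix i r <+: r := by
  induction r generalizing i with
  | nil => cases i <;> simp [gapPrefix]
  | cons c r ih =>
    cases c <;> cases i <;> simp [gapPrefix, ih]

theorem gapPrefix_of_clean_eq_nil {r : List (RefSymbol S V)} (h : clean r = []) (i : ℕ) :
    gapPrefix i r = r := by
  have := gapPrefix_append_of_le (r := r) (r' := []) (i := i) (by simp [h])
  cases i <;> simpa [gapPrefix] using this

variable {step : Q → Option (RefSymbol S V) → Q → Prop}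

theorem silent_iff {p q : Q} : Relation.ReflTransGen (SilentStep step) p q ↔
    ∃ r, LabelPath step p r q ∧ clean r = [] := by
  constructor
  · intro h
    induction h using Relation.ReflTransGen.head_induction_on with
    | refl => exact ⟨[], .nil q, rfl⟩
    | head hs _ ih =>
      obtain ⟨r, hr, hc⟩ := ih
      obtain ⟨o, ho, hl⟩ := hs
      cases o with
      | none => exact ⟨r, .eps ho hr, hc⟩
      | some c =>
        refine ⟨c :: r, .cons ho hr, ?_⟩
        cases c with
        | letter a => exact absurd rfl (hl a)
        | opens x => exact hc
        | closes x => exact hc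
  · rintro ⟨r, hr, hc⟩
    induction hr with
    | nil p => exact .refl
    | eps hs _ ih => exact .head ⟨none, hs, by simp⟩ (ih hc)
    | @cons _ _ _ c _ hs _ ih =>
      cases c with
      | letter a => simp at hc
      | opens x => exact .head ⟨_, hs, by simp⟩ (ih hc)
      | closes x => exact .head ⟨_, hs, by simp⟩ (ih hc)

/-- The states `run i` can be visited by a path from `p` to `f` just before it reads the letter with
number `i` of `s`, the last one at the end. -/
structure GapRun (step : Q → Option (RefSymbol S V) → Q → Prop) (p f : Q) (s : List S)
    (run : ℕ → Q) : Prop where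
  first : Relation.ReflTransGen (SilentStep step) p (run 0)
  next : ∀ i (h : i < s.length), ∃ p', step (run i) (some (.letter s[i])) p' ∧
    Relation.ReflTransGen (SilentStep step) p' (run (i + 1))
  last : run s.length = f

theorem LabelPath.exists_gapRun {p f : Q} {r : List (RefSymbol S V)} (h : LabelPath step p r f) :
    ∃ run, GapRun step p f (clean r) run ∧
      ∀ i ≤ (clean r).length, LabelPath step p (gapPrefix i r) (run i) := by
  induction h with
  | nil p =>
    refine ⟨fun _ => p, ⟨.refl, by simp, rfl⟩, fun i _ => ?_⟩
    cases i <;> exact .nil p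
  | eps hs _ ih =>
    obtain ⟨run, hr, hp⟩ := ih
    exact ⟨run, ⟨.head ⟨_, hs, by simp⟩ hr.first, hr.next, hr.last⟩, fun i hi => .eps hs (hp i hi)⟩
  | @cons p q f c r hs _ ih =>
    obtain ⟨run, hr, hp⟩ := ih
    cases c with
    | letter a =>
      -- A letter in front leaves gap `0` without silent moves, at `p`, and shifts all other gaps by
      -- one.
      refine ⟨fun i => Nat.casesOn (motive := fun _ => Q) i p run,
        ⟨.refl, fun i hi => ?_, hr.last⟩, fun i hi => ?_⟩
      · cases i with
        | zero => exact ⟨q, hs, hr.first⟩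
        | succ i => exact hr.next i (by simpa using hi)
      · cases i with
        | zero => exact .nil p
        | succ i => exact .cons hs (hp i (by simpa using hi))
    | opens x =>
      refine ⟨run, ⟨.head ⟨_, hs, by simp⟩ hr.first, hr.next, hr.last⟩, fun i hi => ?_⟩
      cases i <;> exact .cons hs (hp _ hi)
    | closes x =>
      refine ⟨run, ⟨.head ⟨_, hs, by simp⟩ hr.first, hr.next, hr.last⟩, fun i hi => ?_⟩
      cases i <;> exact .cons hs (hp _ hi)

/-- Silent path labels and letters are concatenated. The label `r₀` for gap `0` is chosen before the
induction on `s`, because it is exactly the prefix `gapPrefix 0` of the resulting word. -/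
theorem GapRun.exists_path {p f : Q} {s : List S} {run : ℕ → Q} (h : GapRun step p f s run) :
    ∃ r, LabelPath step p r f ∧ clean r = s ∧
      ∀ i ≤ s.length, LabelPath step p (gapPrefix i r) (run i) := by
  obtain ⟨r₀, h₀, hc⟩ := silent_iff.1 h.first
  induction s generalizing p run r₀ with
  | nil =>
    refine ⟨r₀, ?_, hc, fun i hi => ?_⟩
    · have := h.last
      simp only [List.length_nil] at this
      rwa [this] at h₀
    · obtain rfl : i = 0 := by simpa using hi
      rwa [gapPrefix_of_clean_eq_nil hc]
  | cons a s ih =>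
    obtain ⟨p', hs, hp'⟩ := h.next 0 (by simp)
    have h' : GapRun step p' f s fun i => run (i + 1) :=
      ⟨hp', fun i hi => h.next (i + 1) (by simpa using hi), h.last⟩
    obtain ⟨r₁, h₁, hc₁⟩ := silent_iff.1 hp'
    obtain ⟨r, hr, hcr, hp⟩ := ih h' r₁ h₁ hc₁
    refine ⟨r₀ ++ .letter a :: r, h₀.append (.cons hs hr), by simp [hc, hcr], fun i hi => ?_⟩
    rw [gapPrefix_append_of_le (by simp [hc]), hc, List.length_nil, Nat.sub_zero]
    cases i with
    | zero => simpa [gapPrefix] using h₀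
    | succ i => exact h₀.append (.cons hs (hp i (by simpa using hi)))

end paths

/-! ### The tuple of a ref-word -/

section tuples

variable {S V : Type*} [DecidableEq S] [DecidableEq V]

/-- The number of operations on the variable `x`. -/
def opCount (x : V) (r : List (RefSymbol S V)) : ℕ :=
  r.count (.opens x) + r.count (.closes x)

@[simp] theorem opCount_append (x : V) (r r' : List (RefSymbol S V)) :
    opCount x (r ++ r') = opCount x r + opCount x r' := by
  simp [opCount]; omega

theorem ValidRefWord.opCount_eq {r : List (RefSymbol S V)} (h : ValidRefWord r) (x : V) :
    opCount x r = 2 := by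
  simp [opCount, (h x).1, (h x).2.1]

/-- The only occurrence of `c` follows `r₁`; as `c` is not a letter, it lies before letter number
`i` if and only if `r₁` has at most `i` letters. -/
theorem count_gapPrefix {r r₁ r₂ : List (RefSymbol S V)} {c : RefSymbol S V}
    (hr : r = r₁ ++ c :: r₂) (hc : r.count c = 1) (hl : ∀ a, c ≠ .letter a) (i : ℕ) :
    (gapPrefix i r).count c = if (clean r₁).length ≤ i then 1 else 0 := by
  subst hr
  have h1 : r₁.count c = 0 ∧ r₂.count c = 0 := by
    rw [List.count_append, List.count_cons_self] at hc
    omega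
  split
  · next h =>
    have h2 := ((gapPrefix_isPrefix (r₁ ++ c :: r₂) i).sublist.count_le c)
    rw [gapPrefix_append_of_le h] at h2 ⊢
    rw [hc] at h2
    refine le_antisymm h2 ?_
    rw [List.count_append]
    cases c with
    | letter a => exact absurd rfl (hl a)
    | opens x => cases (i - (clean r₁).length) <;> simp [gapPrefix] <;> omega
    | closes x => cases (i - (clean r₁).length) <;> simp [gapPrefix] <;> omega
  · next h =>
    rw [gapPrefix_append_of_lt (by omega)]
    exact Nat.le_zero.1 (((gapPrefix_isPrefix r₁ i).sublist.count_le c).trans h1.1.le)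

/-- The link between statuses and spans: by gap `i` the variable has been opened exactly if its left
end is at most `i + 1`, and closed exactly if its right end is. -/
theorem ValidRefWord.opCount_gapPrefix {s : List S} {r : List (RefSymbol S V)}
    (h : ValidRefWord r) {μ : SpanTuple V s} (hμ : IsTupleOf r μ) (x : V) (i : ℕ) :
    opCount x (gapPrefix i r) =
      (if (μ x).left ≤ i + 1 then 1 else 0) + if (μ x).right ≤ i + 1 then 1 else 0 := by
  obtain ⟨r₁, r₂, r₃, hr, hl, hr'⟩ := hμ x
  rw [opCount, count_gapPrefix hr (h x).1 (by simp),
    count_gapPrefix (r₁ := r₁ ++ .opens x :: r₂) (by simpa using hr) (h x).2.1 (by simp), hl, hr', hl]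
  simp only [clean_append, clean_opens, List.length_append]
  split_ifs <;> omega

theorem ValidRefWord.exists_tuple {s : List S} {r : List (RefSymbol S V)} (h : ValidRefWord r)
    (hs : clean r = s) : ∃ μ : SpanTuple V s, IsTupleOf r μ := by
  choose r₁ r₂ r₃ hr using fun x => (h x).2.2
  refine ⟨fun x => ⟨(clean (r₁ x)).length + 1, (clean (r₁ x)).length + 1 + (clean (r₂ x)).length,
    by omega, by omega, ?_⟩, fun x => ⟨r₁ x, r₂ x, r₃ x, hr x, rfl, rfl⟩⟩
  have : s.length = (clean (r₁ x)).length + (clean (r₂ x)).length + (clean (r₃ x)).length := by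
    rw [← hs, hr x]
    simp; omega
  omega

end tuples

/-! ### Enumeration of the words of a layered graph -/

section words

/-- The nodes of level `j + 1` that follow `S` and carry the key `κ`. -/
def nextSet (cand : ℕ → Finset ℕ → Finset ℕ) (key : ℕ → ℕ) (j : ℕ) (S : Finset ℕ) (κ : ℕ) :
    Finset ℕ :=
  (cand j S).filter fun q => key q = κ

/-- The keys greater than `lim` at the nodes of level `j + 1` that follow `S`, in increasing
order. -/
def keysAbove (cand : ℕ → Finset ℕ → Finset ℕ) (key : ℕ → ℕ) (j : ℕ) (S : Finset ℕ) (lim : ℕ) :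
    List ℕ :=
  (((cand j S).image key).filter fun κ => lim < κ).sort

/-- The words of length `d` that can be read from `S`, starting at level `j`. -/
def wordsFrom (cand : ℕ → Finset ℕ → Finset ℕ) (key : ℕ → ℕ) : ℕ → ℕ → Finset ℕ → List (List ℕ)
  | 0, _, _ => [[]]
  | d + 1, j, S => (keysAbove cand key j S 0).flatMap fun κ =>
      (wordsFrom cand key d (j + 1) (nextSet cand key j S κ)).map fun u => κ :: u

variable {cand : ℕ → Finset ℕ → Finset ℕ} {key : ℕ → ℕ}

theorem mem_keysAbove {j : ℕ} {S : Finset ℕ} {lim κ : ℕ} :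
    κ ∈ keysAbove cand key j S lim ↔ lim < κ ∧ ∃ q ∈ cand j S, key q = κ := by
  simp [keysAbove, and_comm]

theorem keysAbove_eq_nil {j : ℕ} {S : Finset ℕ} {lim : ℕ}
    (h : ∀ q ∈ cand j S, ¬ lim < key q) : keysAbove cand key j S lim = [] := by
  rw [List.eq_nil_iff_forall_not_mem]
  intro κ hκ
  obtain ⟨hlt, q, hq, rfl⟩ := mem_keysAbove.1 hκ
  exact h q hq hlt

theorem keysAbove_eq_cons {j : ℕ} {S : Finset ℕ} {lim q : ℕ} (hq : q ∈ cand j S)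
    (hlt : lim < key q) (hmin : ∀ q' ∈ cand j S, lim < key q' → key q ≤ key q') :
    keysAbove cand key j S lim = key q :: keysAbove cand key j S (key q) := by
  have : (((cand j S).image key).filter fun κ => lim < κ) =
      insert (key q) (((cand j S).image key).filter fun κ => key q < κ) := by
    ext κ
    simp only [Finset.mem_filter, Finset.mem_image, Finset.mem_insert]
    constructor
    · rintro ⟨⟨q', hq', rfl⟩, hlt'⟩
      rcases Nat.eq_or_lt_of_le (hmin q' hq' hlt') with h | h
      · exact Or.inl h.symm
      · exact Or.inr ⟨⟨q', hq', rfl⟩, h⟩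
    · rintro (rfl | ⟨h, h'⟩)
      · exact ⟨⟨q, hq, rfl⟩, hlt⟩
      · exact ⟨h, hlt.trans h'⟩
  rw [keysAbove, this, Finset.sort_insert]
  · rfl
  · intro b hb
    exact (Finset.mem_filter.1 hb).2.le
  · simp

/-- All nodes with the same key are followed together as one set, so a word is listed once however
many runs spell it; branches with different first keys are disjoint. -/
theorem nodup_wordsFrom (d j : ℕ) (S : Finset ℕ) : (wordsFrom cand key d j S).Nodup := by
  induction d generalizing j S with
  | zero => simp [wordsFrom]
  | succ d ih =>
    rw [wordsFrom, List.nodup_flatMap]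
    refine ⟨fun κ _ => (ih _ _).map fun a b h => (List.cons.inj h).2, ?_⟩
    have : (keysAbove cand key j S 0).Nodup := Finset.sort_nodup _ _
    refine this.imp fun {a b} hab => ?_
    intro u hu hu'
    obtain ⟨u₁, -, rfl⟩ := List.mem_map.1 hu
    obtain ⟨u₂, -, h⟩ := List.mem_map.1 hu'
    exact hab (List.cons.inj h).1.symm

/-- The start node `run 0` contributes no key. Keys must be nonzero because the listing starts above
the bound `0`, and `S` nonempty because the empty word is listed without consulting `S`. -/
theorem mem_wordsFrom {R : ℕ → ℕ → ℕ → Prop} (hc : ∀ j S q, q ∈ cand j S ↔ ∃ p ∈ S, R j p q)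
    (hpos : ∀ j S, ∀ q ∈ cand j S, key q ≠ 0) {d j : ℕ} {S : Finset ℕ} (hS : S.Nonempty)
    {u : List ℕ} : u ∈ wordsFrom cand key d j S ↔ ∃ run : ℕ → ℕ, run 0 ∈ S ∧
      (∀ i < d, R (j + i) (run i) (run (i + 1))) ∧
      u = (List.range d).map fun i => key (run (i + 1)) := by
  induction d generalizing j S u with
  | zero =>
    obtain ⟨p, hp⟩ := hS
    simp only [wordsFrom, List.mem_singleton, List.range_zero, List.map_nil, not_lt_zero]
    exact ⟨fun h => ⟨fun _ => p, hp, by simp, h⟩, fun ⟨_, _, _, h⟩ => h⟩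
  | succ d ih =>
    simp only [wordsFrom, List.mem_flatMap, List.mem_map]
    constructor
    · rintro ⟨κ, hκ, u, hu, rfl⟩
      obtain ⟨hlt, q, hq, hqκ⟩ := mem_keysAbove.1 hκ
      have hne : (nextSet cand key j S κ).Nonempty := ⟨q, Finset.mem_filter.2 ⟨hq, hqκ⟩⟩
      obtain ⟨run, h0, hs, rfl⟩ := (ih hne).1 hu
      obtain ⟨h0, h0κ⟩ := Finset.mem_filter.1 h0
      obtain ⟨p, hp, hR⟩ := (hc _ _ _).1 h0
      refine ⟨fun i => Nat.casesOn (motive := fun _ => ℕ) i p run, hp, fun i hi => ?_, ?_⟩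
      · cases i with
        | zero => exact hR
        | succ i =>
          rw [show j + (i + 1) = j + 1 + i by omega]
          exact hs i (by omega)
      · rw [List.range_succ_eq_map]
        simp [h0κ, Function.comp_def]
    · rintro ⟨run, h0, hs, rfl⟩
      have h1 : run 1 ∈ cand j S := (hc _ _ _).2 ⟨run 0, h0, hs 0 (by omega)⟩
      have h1' : run 1 ∈ nextSet cand key j S (key (run 1)) := Finset.mem_filter.2 ⟨h1, rfl⟩
      refine ⟨key (run 1), mem_keysAbove.2 ⟨Nat.pos_of_ne_zero (hpos _ _ _ h1), _, h1, rfl⟩,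
        (List.range d).map fun i => key (run (i + 2)),
        (ih ⟨_, h1'⟩).2 ⟨fun i => run (i + 1), h1', fun i hi => ?_, rfl⟩, ?_⟩
      · rw [show j + 1 + i = j + (i + 1) by omega]
        exact hs (i + 1) (by omega)
      · rw [List.range_succ_eq_map]
        simp [Function.comp_def]

/-- The words that are still to be listed by the search at level `j`: those that branch off at
level `j`, above the key `lim j`, from the word `lim 0, …, lim (j - 1)`. -/
def branchWords (cand : ℕ → Finset ℕ → Finset ℕ) (key : ℕ → ℕ) (L : ℕ) (S : ℕ → Finset ℕ)
    (lim : ℕ → ℕ) (j : ℕ) : List (List ℕ) :=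
  (keysAbove cand key j (S j) (lim j)).flatMap fun κ =>
    (wordsFrom cand key (L - (j + 1)) (j + 1) (nextSet cand key j (S j) κ)).map fun u =>
      (List.range j).map lim ++ κ :: u

/-- All words that are still to be listed by the search. -/
def remaining (cand : ℕ → Finset ℕ → Finset ℕ) (key : ℕ → ℕ) (L : ℕ) (S : ℕ → Finset ℕ)
    (lim : ℕ → ℕ) : ℕ → List (List ℕ)
  | 0 => branchWords cand key L S lim 0
  | j + 1 => branchWords cand key L S lim (j + 1) ++ remaining cand key L S lim j

variable {L : ℕ} {S S' : ℕ → Finset ℕ} {lim lim' : ℕ → ℕ}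

theorem map_range_congr {j : ℕ} (h : ∀ i < j, lim i = lim' i) :
    (List.range j).map lim = (List.range j).map lim' :=
  List.map_congr_left fun i hi => h i (List.mem_range.1 hi)

theorem branchWords_congr {j : ℕ} (hS : S j = S' j) (hl : ∀ i ≤ j, lim i = lim' i) :
    branchWords cand key L S lim j = branchWords cand key L S' lim' j := by
  rw [branchWords, branchWords, hS, hl j le_rfl, map_range_congr fun i hi => hl i hi.le]

theorem remaining_congr {j : ℕ} (hS : ∀ i ≤ j, S i = S' i) (hl : ∀ i ≤ j, lim i = lim' i) :
    remaining cand key L S lim j = remaining cand key L S' lim' j := by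
  induction j with
  | zero => exact branchWords_congr (hS 0 le_rfl) hl
  | succ j ih =>
    rw [remaining, remaining, branchWords_congr (hS _ le_rfl) hl,
      ih (fun i hi => hS i (by omega)) (fun i hi => hl i (by omega))]

theorem remaining_start (h : lim 0 = 0) (hL : 0 < L) :
    remaining cand key L S lim 0 = wordsFrom cand key L 0 (S 0) := by
  obtain ⟨L, rfl⟩ : ∃ L', L = L' + 1 := ⟨L - 1, by omega⟩
  simp [remaining, branchWords, h, wordsFrom]

theorem branchWords_eq_nil {j : ℕ} (h : ∀ q ∈ cand j (S j), ¬ lim j < key q) :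
    branchWords cand key L S lim j = [] := by
  rw [branchWords, keysAbove_eq_nil h, List.flatMap_nil]

/-- The least admissible key heads the list of keys at level `j`: its words come first, and raising
the bound to this key leaves precisely the others. -/
theorem remaining_eq_append {j q : ℕ} (hq : q ∈ cand j (S j)) (hlt : lim j < key q)
    (hmin : ∀ q' ∈ cand j (S j), lim j < key q' → key q ≤ key q')
    (hl : ∀ i < j, lim i = lim' i) (hlj : lim' j = key q) (hS : ∀ i ≤ j, S i = S' i) :
    remaining cand key L S lim j =
      (wordsFrom cand key (L - (j + 1)) (j + 1) (nextSet cand key j (S j) (key q))).map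
        (fun u => (List.range (j + 1)).map lim' ++ u) ++ remaining cand key L S' lim' j := by
  have : branchWords cand key L S lim j =
      (wordsFrom cand key (L - (j + 1)) (j + 1) (nextSet cand key j (S j) (key q))).map
        (fun u => (List.range (j + 1)).map lim' ++ u) ++ branchWords cand key L S' lim' j := by
    rw [branchWords, keysAbove_eq_cons hq hlt hmin, List.flatMap_cons, branchWords, ← hS j le_rfl,
      hlj, map_range_congr hl]
    congr 2
    funext u
    simp [List.range_succ, hlj]
  cases j with
  | zero => exact this
  | succ j =>
    rw [remaining, remaining, this, List.append_assoc,
      remaining_congr (fun i hi => hS i (by omega)) (fun i hi => hl i (by omega))]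

theorem remaining_step_last {j q : ℕ} (hq : q ∈ cand j (S j)) (hlt : lim j < key q)
    (hmin : ∀ q' ∈ cand j (S j), lim j < key q' → key q ≤ key q')
    (hl : ∀ i < j, lim i = lim' i) (hlj : lim' j = key q) (hS : ∀ i ≤ j, S i = S' i)
    (hL : j + 1 = L) :
    remaining cand key L S lim j =
      (List.range L).map lim' :: remaining cand key L S' lim' j := by
  rw [remaining_eq_append hq hlt hmin hl hlj hS, ← hL, Nat.sub_self]
  simp [wordsFrom]

/-- Descending: the words with the chosen key at level `j` are the words that branch off at level `j
+ 1` above the bound `0`. So a move of the search that prints nothing does not change what remains.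
-/
theorem remaining_step {j q : ℕ} (hq : q ∈ cand j (S j)) (hlt : lim j < key q)
    (hmin : ∀ q' ∈ cand j (S j), lim j < key q' → key q ≤ key q')
    (hl : ∀ i < j, lim i = lim' i) (hlj : lim' j = key q) (hS : ∀ i ≤ j, S i = S' i)
    (hL : j + 1 < L) (hS' : S' (j + 1) = nextSet cand key j (S j) (key q))
    (hl' : lim' (j + 1) = 0) :
    remaining cand key L S lim j = remaining cand key L S' lim' (j + 1) := by
  rw [remaining_eq_append hq hlt hmin hl hlj hS, remaining, branchWords, hS', hl']
  obtain ⟨d, hd⟩ : ∃ d, L - (j + 1) = d + 1 := ⟨L - (j + 1) - 1, by omega⟩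
  rw [hd, show L - (j + 1 + 1) = d by omega, wordsFrom, List.map_flatMap]
  simp only [List.map_map, Function.comp_def]

end words

/-! ### Schedules -/

/-- The events at the times `ts` and a next event at time `d` keep the time bounds. -/
def OnTime (pre delay : ℕ) (ts : List ℕ) (d : ℕ) : Prop :=
  (∀ t ∈ (ts ++ [d]).head?, t ≤ pre) ∧ (ts ++ [d]).IsChain fun t t' => t' ≤ t + delay

theorem OnTime.mono {pre delay : ℕ} {ts : List ℕ} {d d' : ℕ} (h : OnTime pre delay ts d)
    (hd : d' ≤ d) : OnTime pre delay ts d' := by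
  obtain ⟨h1, h2⟩ := h
  cases ts with
  | nil => exact ⟨by simp at h1 ⊢; omega, by simp⟩
  | cons t ts =>
    refine ⟨by simpa using h1, ?_⟩
    rw [List.isChain_append] at h2 ⊢
    refine ⟨h2.1, by simp, fun x hx y hy => ?_⟩
    have := h2.2.2 x hx d (by simp)
    simp at hy
    omega

/-- An answer printed at `t`, before the deadline, opens a new deadline `t + delay`. -/
theorem OnTime.emit {pre delay : ℕ} {ts : List ℕ} {d t : ℕ} (h : OnTime pre delay ts d)
    (ht : t ≤ d) : OnTime pre delay (ts ++ [t]) (t + delay) := by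
  obtain ⟨h1, h2⟩ := h.mono ht
  refine ⟨?_, ?_⟩
  · cases ts <;> simpa using h1
  · rw [List.isChain_append]
    refine ⟨h2, by simp, fun x hx y hy => ?_⟩
    simp at hx hy
    omega

namespace RAM

/-! ### The search step -/

/-- The tables of the layered graph. Level `j` has the edges `Ed j`, and `Al j` are its nodes from
which the end can be reached. -/
structure Tables (k n l : ℕ) (Ed : ℕ → ℕ → ℕ → Prop) (Al : ℕ → ℕ → Prop) (key st : ℕ → ℕ)
    (σ : State) : Prop where
  edges : ∀ j ≤ l, ∀ p < n, ∀ q < n, σ.mem 3 ((σ.mem 15 j * n + p) * n + q) ≠ 0 ↔ Ed j p q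
  blocks : ∀ j ≤ l, σ.mem 15 j ≤ k
  alive : ∀ j ≤ l + 1, ∀ p < n, σ.mem 10 (j * n + p) ≠ 0 ↔ Al j p
  keys : σ.mem 9 = key
  statuses : σ.mem 7 = st

/-- Whether a program leaves the tables alone. -/
def Cmd.keepsTables (p : Cmd) : Bool :=
  [3, 7, 9, 10, 15].all fun a => decide (a ∉ p.arrs)

theorem Tables.of_mem {k n l : ℕ} {Ed : ℕ → ℕ → ℕ → Prop} {Al : ℕ → ℕ → Prop} {key st : ℕ → ℕ}
    {σ τ : State} (h : Tables k n l Ed Al key st σ)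
    (hm : ∀ a ∈ [3, 7, 9, 10, 15], τ.mem a = σ.mem a) : Tables k n l Ed Al key st τ := by
  simp only [List.mem_cons, List.not_mem_nil, or_false, forall_eq_or_imp, forall_eq] at hm
  obtain ⟨h3, h7, h9, h10, h15⟩ := hm
  exact ⟨by rw [h3, h15]; exact h.edges, by rw [h15]; exact h.blocks, by rw [h10]; exact h.alive,
    h9.trans h.keys, h7.trans h.statuses⟩

theorem Tables.frame {k n l : ℕ} {Ed : ℕ → ℕ → ℕ → Prop} {Al : ℕ → ℕ → Prop} {key st : ℕ → ℕ}
    {σ τ : State} {p : Cmd} (h : Tables k n l Ed Al key st σ) (hf : Frame p σ τ)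
    (hp : p.keepsTables = true) : Tables k n l Ed Al key st τ := by
  refine h.of_mem fun a ha => hf.mem a ?_
  simp only [Cmd.keepsTables, List.all_eq_true, decide_eq_true_eq] at hp
  exact hp a ha

/-- Mark the candidates: the nodes of the next level that follow a node of the set at level
`reg 7` and from which the end can be reached. -/
def candidates : Cmd :=
  .seq (.upTo 10 0 (.store 13 (.reg 10) (.const 0)))
    (.upTo 10 0 (.branch (.load 11 (cell (.reg 7) (.reg 10)))
      (.seq (.assign 9 (cell (.load 15 (.reg 7)) (.reg 10)))
        (.upTo 11 0 (.branch (.load 3 (cell (.reg 9) (.reg 11)))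
          (.branch (.load 10 (cell (.add (.reg 7) (.const 1)) (.reg 11)))
            (.store 13 (.reg 11) (.const 1)) .skip) .skip)))
      .skip))

/-- At most one `n × n` block is read. Printing apart, this dominates the cost of a search step; the
other parts are linear in `n`. -/
theorem candidates_spec {w k n v m l q₀ qf : ℕ} {I : ℕ → ℕ} {σ : State}
    {Ed : ℕ → ℕ → ℕ → Prop} {Al : ℕ → ℕ → Prop} {key st : ℕ → ℕ}
    (hσ : Ctx n v m l q₀ qf I σ) (hT : Tables k n l Ed Al key st σ) {j : ℕ} (h7 : σ.reg 7 = j)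
    (hj : j ≤ l)
    (hB : (k + 1) * n * n + (k + 1) * n + (l + 2) * n + l + n + 20 < modulus w) :
    WP w candidates (fun τ => (∀ q < n, τ.mem 13 q ≠ 0 ↔
        ∃ p < n, σ.mem 11 (j * n + p) ≠ 0 ∧ Ed j p q ∧ Al (j + 1) q) ∧
      τ.clock ≤ σ.clock + n * (n * 60 + 120) + 20) σ := by
  have hn := hσ.hn
  have hkj := hT.blocks j hj
  refine WP.seq ?_
  refine WP.upTo_const (K := 20) (Inv := fun i τ => ∀ q < i, τ.mem 13 q = 0)
    (by decide) (by decide) (by decide) (by omega) (by simp) ?_ ?_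
  · intro i hi τ hfr hri hI
    refine WP.store trivial (by simp; omega) ⟨fun q hq => ?_, by simp⟩
    simp [hri, Function.update_apply]
    intro hne
    exact hI q (by omega)
  · intro σ₁ hfr₁ hZ hcl₁
    have hc₁ := hσ.frame hfr₁ (by decide)
    have hT₁ := hT.frame hfr₁ (by decide)
    have h7₁ : σ₁.reg 7 = j := by rw [hfr₁.reg 7 (by decide), h7]
    have h11₁ : σ₁.mem 11 = σ.mem 11 := hfr₁.mem 11 (by decide)
    have hn₁ := hc₁.hn
    have h15₁ : σ₁.mem 15 = σ.mem 15 := hfr₁.mem 15 (by decide)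
    rw [hn] at hZ hcl₁
    refine WP.upTo_const (K := n * 60 + 60) (Inv := fun i τ => ∀ q < n, τ.mem 13 q ≠ 0 ↔
        ∃ p < i, σ.mem 11 (j * n + p) ≠ 0 ∧ Ed j p q ∧ Al (j + 1) q)
      (by decide) (by decide) (by decide) (by omega) ?_ ?_ ?_
    · simpa using hZ
    · intro p hp τ hfr hrp hI
      rw [hn₁] at hp
      have hc := hc₁.frame hfr (by decide)
      have hTt := hT₁.frame hfr (by decide)
      have h7t : τ.reg 7 = j := by rw [hfr.reg 7 (by decide), h7₁]
      have h11t : τ.mem 11 = σ.mem 11 := by rw [hfr.mem 11 (by decide), h11₁]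
      have h15t : τ.mem 15 = σ.mem 15 := by rw [hfr.mem 15 (by decide), h15₁]
      have hjp : j * n + p < (l + 2) * n := cell_lt (by omega) hp
      have hrow : σ.mem 15 j * n + p < (k + 1) * n := cell_lt (by omega) hp
      have hnt := hc.hn
      refine WP.branch ?_ (fun h => WP.seq (WP.assign ?_ ?_)) (fun h => WP.skip ⟨?_, ?_⟩)
      · simp [h7t, hrp, hnt]; omega
      · simp [h7t, hrp, hnt, h15t]; omega
      · simp [h7t, hrp, hnt, h11t] at h
        simp only [Expr.val, cell_val, State.tick_reg, State.tick_mem, h7t, hrp, hnt, h15t]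
        refine WP.upTo_const (K := 60) (Inv := fun i τ' => ∀ q < n, τ'.mem 13 q ≠ 0 ↔
            (∃ p' < p, σ.mem 11 (j * n + p') ≠ 0 ∧ Ed j p' q ∧ Al (j + 1) q) ∨
              (q < i ∧ Ed j p q ∧ Al (j + 1) q))
          (by decide) (by decide) (by decide) (by simp [hnt]; omega) ?_ ?_ ?_
        · simpa using hI
        · intro q hq τ₁ hfr' hrq hI'
          simp [hnt] at hq
          have hc' := ((hc.tick _).setReg (by decide) _ _).frame hfr' (by decide)
          have hT' : Tables k n l Ed Al key st τ₁ := Tables.frame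
            (hTt.of_mem (by intros; rfl)) hfr' (by decide)
          have h7' : τ₁.reg 7 = j := by rw [hfr'.reg 7 (by decide)]; simpa using h7t
          have h9' : τ₁.reg 9 = σ.mem 15 j * n + p := by rw [hfr'.reg 9 (by decide)]; simp
          have h15' : τ₁.mem 15 = σ.mem 15 := by rw [hfr'.mem 15 (by decide)]; simpa using h15t
          have hcell := cell_lt hrow hq
          have hcell' : (j + 1) * n + q < (l + 2) * n := cell_lt (by omega) hq
          have hE := hT'.edges j hj p hp q hq
          rw [h15'] at hE
          have hA := hT'.alive (j + 1) (by omega) q hq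
          have hno : ¬ (Ed j p q ∧ Al (j + 1) q) → (∀ q' < n, τ₁.mem 13 q' ≠ 0 ↔
              (∃ p' < p, σ.mem 11 (j * n + p') ≠ 0 ∧ Ed j p' q' ∧ Al (j + 1) q') ∨
                (q' < q + 1 ∧ Ed j p q' ∧ Al (j + 1) q')) := by
            intro hno q' hq'
            refine (hI' q' hq').trans (or_congr_right ?_)
            constructor
            · exact fun h => ⟨by omega, h.2⟩
            · rintro ⟨h1, h2⟩
              rcases Nat.lt_succ_iff_lt_or_eq.1 h1 with h1 | rfl
              · exact ⟨h1, h2⟩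
              · exact absurd h2 hno
          refine WP.branch ?_ (fun h1 => WP.branch ?_ (fun h2 => WP.store trivial ?_ ⟨?_, ?_⟩)
            (fun h2 => WP.skip ⟨?_, ?_⟩)) (fun h1 => WP.skip ⟨?_, ?_⟩)
          · simp [h9', hrq, hc'.hn]; omega
          · simp [h7', hrq, hc'.hn]; omega
          · simp; omega
          · intro q' hq'
            simp [h9', hrq, hc'.hn] at h1
            simp [h7', hrq, hc'.hn] at h2
            by_cases hqq : q' = q
            · simp only [State.setReg_mem, State.setMem_mem, Expr.val, State.tick_reg, hrq, hqq,
                reduceIte, Function.update_self]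
              exact iff_of_true one_ne_zero (Or.inr ⟨by omega, hE.1 h1, hA.1 h2⟩)
            · simp only [State.setReg_mem, State.setMem_mem, Expr.val, State.tick_reg, hrq,
                reduceIte, Function.update_of_ne hqq, State.tick_mem]
              rw [hI' q' hq']
              refine or_congr_right (and_congr_left fun _ => ?_)
              omega
          · simp
          · simp [h7', hrq, hc'.hn] at h2
            exact hno fun h => hA.2 h.2 h2
          · simp
          · simp [h9', hrq, hc'.hn] at h1
            exact hno fun h => hE.2 h.1 h1
          · simp
        · intro τ₁ hfr' hI' hcl'
          simp [hnt] at hI' hcl'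
          refine ⟨fun q hq => (not_congr Iff.rfl).trans ((hI' q hq).trans ?_), by omega⟩
          constructor
          · rintro (⟨p', h1, h2⟩ | ⟨h1, h2⟩)
            · exact ⟨p', by omega, h2⟩
            · exact ⟨p, by omega, h, h2⟩
          · rintro ⟨p', h1, h2⟩
            rcases Nat.lt_succ_iff_lt_or_eq.1 h1 with h1 | rfl
            · exact Or.inl ⟨p', h1, h2⟩
            · exact Or.inr ⟨hq, h2.2⟩
      · simp [h7t, hrp, hnt, h11t] at h
        intro q hq
        refine (hI q hq).trans ?_
        constructor
        · rintro ⟨p', h1, h2⟩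
          exact ⟨p', by omega, h2⟩
        · rintro ⟨p', h1, h2⟩
          rcases Nat.lt_succ_iff_lt_or_eq.1 h1 with h1 | rfl
          · exact ⟨p', h1, h2⟩
          · exact absurd h h2.1
      · simp; omega
    · intro τ hfr hI hcl
      rw [hn₁] at hI hcl
      refine ⟨hI, ?_⟩
      simp only [mul_add] at hcl ⊢
      omega

/-- Find the least key above the bound of level `reg 7` among the candidates. -/
def findBest : Cmd :=
  .seq (.assign 12 (.const 0))
    (.upTo 10 0 (.branch (.load 13 (.reg 10))
      (.branch (.lt (.load 12 (.reg 7)) (.load 9 (.reg 10)))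
        (.branch (.add (.eq (.reg 12) (.const 0)) (.lt (.load 9 (.reg 10)) (.reg 12)))
          (.seq (.assign 12 (.load 9 (.reg 10))) (.assign 14 (.reg 10))) .skip) .skip) .skip))

/-- Zero in register 12 stands for "nothing found". This is unambiguous, because a key above the
bound is positive. -/
theorem findBest_spec {w n v m l q₀ qf : ℕ} {I : ℕ → ℕ} {σ : State} {key : ℕ → ℕ}
    (hσ : Ctx n v m l q₀ qf I σ) (hkey : σ.mem 9 = key) {lim : ℕ}
    (hlim : σ.mem 12 (σ.reg 7) = lim) (hB : n + 20 < modulus w) :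
    WP w findBest (fun τ =>
      (τ.reg 12 = 0 → ∀ q < n, σ.mem 13 q ≠ 0 → ¬ lim < key q) ∧
      (τ.reg 12 ≠ 0 → τ.reg 14 < n ∧ σ.mem 13 (τ.reg 14) ≠ 0 ∧ key (τ.reg 14) = τ.reg 12 ∧
        lim < τ.reg 12 ∧ ∀ q < n, σ.mem 13 q ≠ 0 → lim < key q → τ.reg 12 ≤ key q) ∧
      τ.clock ≤ σ.clock + n * 60 + 20) σ := by
  refine WP.seq (WP.assign (by simp; omega) ?_)
  simp only [Expr.val, Expr.cost]
  have hn := hσ.hn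
  refine WP.upTo_const (K := 60) (Inv := fun i τ =>
      (τ.reg 12 = 0 → ∀ q < i, σ.mem 13 q ≠ 0 → ¬ lim < key q) ∧
      (τ.reg 12 ≠ 0 → τ.reg 14 < n ∧ σ.mem 13 (τ.reg 14) ≠ 0 ∧ key (τ.reg 14) = τ.reg 12 ∧
        lim < τ.reg 12 ∧ ∀ q < i, σ.mem 13 q ≠ 0 → lim < key q → τ.reg 12 ≤ key q))
    (by decide) (by decide) (by decide) (by simp [hn]; omega) (by simp) ?_ ?_
  · rintro i hi τ hfr hri ⟨h1, h2⟩
    simp [hn] at hi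
    have h7 : τ.reg 7 = σ.reg 7 := by rw [hfr.reg 7 (by decide)]; simp
    have h9 : τ.mem 9 = key := by rw [hfr.mem 9 (by decide)]; simpa using hkey
    have h12 : τ.mem 12 = σ.mem 12 := by rw [hfr.mem 12 (by decide)]; simp
    have h13 : τ.mem 13 = σ.mem 13 := by rw [hfr.mem 13 (by decide)]; simp
    have hno : (σ.mem 13 i ≠ 0 → lim < key i → τ.reg 12 ≠ 0 ∧ τ.reg 12 ≤ key i) →
        (τ.reg 12 = 0 → ∀ q < i + 1, σ.mem 13 q ≠ 0 → ¬ lim < key q) ∧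
        (τ.reg 12 ≠ 0 → τ.reg 14 < n ∧ σ.mem 13 (τ.reg 14) ≠ 0 ∧ key (τ.reg 14) = τ.reg 12 ∧
          lim < τ.reg 12 ∧ ∀ q < i + 1, σ.mem 13 q ≠ 0 → lim < key q → τ.reg 12 ≤ key q) := by
      intro h
      refine ⟨fun h0 q hq hm hl => ?_, fun h0 => ?_⟩
      · rcases Nat.lt_succ_iff_lt_or_eq.1 hq with hq | rfl
        · exact h1 h0 q hq hm hl
        · exact (h hm hl).1 h0
      · obtain ⟨h3, h4, h5, h6, h7⟩ := h2 h0
        refine ⟨h3, h4, h5, h6, fun q hq hm hl => ?_⟩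
        rcases Nat.lt_succ_iff_lt_or_eq.1 hq with hq | rfl
        · exact h7 q hq hm hl
        · exact (h hm hl).2
    refine WP.branch trivial (fun h => WP.branch ⟨trivial, trivial⟩ (fun h' => WP.branch ?_
      (fun h'' => WP.seq (WP.assign trivial (WP.assign trivial ⟨⟨?_, ?_⟩, ?_⟩)))
      (fun h'' => WP.skip ⟨?_, ?_⟩)) (fun h' => WP.skip ⟨?_, ?_⟩)) (fun h => WP.skip ⟨?_, ?_⟩)
    · simp; split_ifs <;> omega
    · simp [hri, h9, h12, h13, h7, hlim] at h h' ⊢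
      intro h0
      omega
    · simp [hri, h9, h12, h13, h7, hlim] at h h' h'' ⊢
      refine fun h0 => ⟨hi, h, h', fun q hq hm hl => ?_⟩
      rcases Nat.eq_or_lt_of_le hq with rfl | hq
      · exact le_rfl
      · by_cases h3 : τ.reg 12 = 0
        · exact absurd hl (h1 h3 q hq hm)
        · have h4 := (h2 h3).2.2.2.2 q hq hm hl
          have h5 := h'' h3
          omega
    · simp
    · simp [hri, h9, h12, h13, h7, hlim] at h h' h''
      simpa using hno fun _ _ => h''
    · simp
    · simp [hri, h9, h12, h13, h7, hlim] at h h'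
      simpa using hno fun _ hl => absurd hl (by omega)
    · simp
    · simp [hri, h13] at h
      simpa using hno fun hm => absurd h hm
    · simp
  · rintro τ hfr ⟨h1, h2⟩ hcl
    simp [hn] at hcl
    simp only [State.setReg_reg, OfNat.zero_ne_ofNat, reduceIte, hn] at h1 h2
    exact ⟨h1, h2, by omega⟩

/-- Enter the candidates with key `reg 12` as the set of the next level. -/
def fillNext : Cmd :=
  .upTo 10 0 (.branch (.load 13 (.reg 10))
    (.store 11 (cell (.add (.reg 7) (.const 1)) (.reg 10)) (.eq (.load 9 (.reg 10)) (.reg 12)))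
    (.store 11 (cell (.add (.reg 7) (.const 1)) (.reg 10)) (.const 0)))

/-- The rows up to level `j` are the stack of the search and must survive; only row `j + 1` is
rewritten. At the last level this is row `l + 1`, whence the bound with `l + 2` rows. -/
theorem fillNext_spec {w n v m l q₀ qf : ℕ} {I : ℕ → ℕ} {σ : State} {key : ℕ → ℕ}
    (hσ : Ctx n v m l q₀ qf I σ) (hkey : σ.mem 9 = key) {j : ℕ} (h7 : σ.reg 7 = j) (hj : j ≤ l)
    (hB : (l + 2) * n + l + n + 20 < modulus w) :
    WP w fillNext (fun τ =>
      (∀ q < n, τ.mem 11 ((j + 1) * n + q) ≠ 0 ↔ σ.mem 13 q ≠ 0 ∧ key q = σ.reg 12) ∧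
      (∀ x < (j + 1) * n, τ.mem 11 x = σ.mem 11 x) ∧ τ.clock ≤ σ.clock + n * 60 + 20) σ := by
  have hn := hσ.hn
  refine WP.upTo_const (K := 60) (Inv := fun i τ =>
      (∀ q < i, τ.mem 11 ((j + 1) * n + q) ≠ 0 ↔ σ.mem 13 q ≠ 0 ∧ key q = σ.reg 12) ∧
      (∀ x < (j + 1) * n, τ.mem 11 x = σ.mem 11 x))
    (by decide) (by decide) (by decide) (by omega) (by simp) ?_ ?_
  · rintro i hi τ hfr hri ⟨h1, h2⟩
    rw [hn] at hi
    have hc := hσ.frame hfr (by decide)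
    have h7t : τ.reg 7 = j := by rw [hfr.reg 7 (by decide), h7]
    have h12 : τ.reg 12 = σ.reg 12 := hfr.reg 12 (by decide)
    have h9 : τ.mem 9 = key := by rw [hfr.mem 9 (by decide), hkey]
    have h13 : τ.mem 13 = σ.mem 13 := hfr.mem 13 (by decide)
    have hcell : (j + 1) * n + i < (l + 2) * n := cell_lt (by omega) hi
    refine WP.branch trivial (fun h => WP.store ?_ ⟨trivial, trivial⟩ ⟨⟨fun q hq => ?_, fun x hx => ?_⟩, ?_⟩)
      (fun h => WP.store ?_ ?_ ⟨⟨fun q hq => ?_, fun x hx => ?_⟩, ?_⟩)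
    · simp [h7t, hri, hc.hn]; omega
    · simp [hri, h13] at h
      simp only [State.setReg_mem, State.setMem_mem, reduceIte, Expr.val, cell_val, State.tick_reg,
        State.tick_mem, h7t, hri, hc.hn, h9, h12, Function.update_apply, add_right_inj]
      split
      · next h' => rw [h', eqVal_def]; simp [h]
      · exact h1 q (by omega)
    · simp only [State.setReg_mem, State.setMem_mem, reduceIte, Expr.val, cell_val, State.tick_reg,
        State.tick_mem, h7t, hri, hc.hn]
      rw [Function.update_of_ne (by omega)]
      exact h2 x hx
    · simp
    · simp [h7t, hri, hc.hn]; omega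
    · simp; omega
    · simp [hri, h13] at h
      simp only [State.setReg_mem, State.setMem_mem, reduceIte, Expr.val, cell_val, State.tick_reg,
        State.tick_mem, h7t, hri, hc.hn, Function.update_apply, add_right_inj]
      split
      · next h' => rw [h']; simp [h]
      · exact h1 q (by omega)
    · simp only [State.setReg_mem, State.setMem_mem, reduceIte, Expr.val, cell_val, State.tick_reg,
        State.tick_mem, h7t, hri, hc.hn]
      rw [Function.update_of_ne (by omega)]
      exact h2 x hx
    · simp
  · rintro τ hfr ⟨h1, h2⟩ hcl
    rw [hn] at h1 hcl
    exact ⟨h1, h2, by omega⟩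

/-! ### Printing an answer -/

/-- Print the endpoints of the span of the variable `reg 10`. -/
def printSpan : Cmd :=
  .seq (.assign 15 (.const 1))
  (.seq (.assign 16 (.const 1))
  (.seq (.upTo 11 6
      (.seq (.assign 9 (.load 7 (cell (.load 14 (.add (.reg 11) (.const 1))) (.reg 10))))
      (.seq (.assign 15 (.add (.reg 15) (.eq (.reg 9) (.const 0))))
        (.assign 16 (.add (.reg 16) (.lt (.reg 9) (.const 2)))))))
    (.seq (.write (.reg 15)) (.write (.reg 16)))))

/-- Print an answer. -/
def printAnswer : Cmd := .seq (.upTo 10 1 printSpan) .emit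

/-- The endpoints of the span of `x` if it has the status `s j` in the gap number `j`. -/
def spanEnds (l : ℕ) (s : ℕ → ℕ) : List ℕ :=
  [1 + ∑ j ∈ Finset.range (l + 1), eqVal (s j) 0, 1 + ∑ j ∈ Finset.range (l + 1), ltVal (s j) 2]

/-- The endpoints are found by counting gaps, those before the opening and those before the closing,
so one pass over the levels suffices per variable. -/
theorem printSpan_spec {w n v m l q₀ qf : ℕ} {I : ℕ → ℕ} {σ : State}
    (hσ : Ctx n v m l q₀ qf I σ) {x : ℕ} (hx : x < n) (h10 : σ.reg 10 = x)
    (hrep : ∀ j ≤ l, σ.mem 14 (j + 1) < n) (hB : n * n + l + 20 < modulus w) :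
    WP w printSpan (fun τ =>
      τ.buf = σ.buf ++ spanEnds l (fun j => σ.mem 7 (σ.mem 14 (j + 1) * n + x)) ∧
      τ.clock ≤ σ.clock + (l + 1) * 60 + 20) σ := by
  have hL := hσ.hL
  have hle : ∀ (f : ℕ → ℕ) i, (∀ j, f j ≤ 1) → ∑ j ∈ Finset.range i, f j ≤ i := fun f i hf =>
    (Finset.sum_le_card_nsmul _ _ 1 fun j _ => hf j).trans (by simp)
  have heq : ∀ a b, eqVal a b ≤ 1 := fun a b => by rw [eqVal_def]; split <;> omega
  have hlt : ∀ a b, ltVal a b ≤ 1 := fun a b => by rw [ltVal_def]; split <;> omega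
  set s : ℕ → ℕ := fun j => σ.mem 7 (σ.mem 14 (j + 1) * n + x) with hs
  refine WP.seq (WP.assign (by simp; omega) (WP.seq (WP.assign (by simp; omega) (WP.seq ?_))))
  simp only [Expr.val, Expr.cost]
  refine WP.upTo_const (K := 60) (Inv := fun i τ =>
      τ.reg 15 = 1 + ∑ j ∈ Finset.range i, eqVal (s j) 0 ∧
      τ.reg 16 = 1 + ∑ j ∈ Finset.range i, ltVal (s j) 2)
    (by decide) (by decide) (by decide) (by simp [hL]; nlinarith) (by simp) ?_ ?_
  · rintro i hi τ hfr hri ⟨h15, h16⟩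
    simp [hL] at hi
    have hc := ((hσ.setReg (by decide) _ _).setReg (by decide) _ _).frame hfr (by decide)
    have h10t : τ.reg 10 = x := by rw [hfr.reg 10 (by decide)]; simpa using h10
    have h7 : τ.mem 7 = σ.mem 7 := by rw [hfr.mem 7 (by decide)]; simp
    have h14 : τ.mem 14 = σ.mem 14 := by rw [hfr.mem 14 (by decide)]; simp
    have hcell := cell_lt (hrep i (by omega)) hx
    have h1 := hle (fun j => eqVal (s j) 0) i fun j => heq _ _
    have h2 := hle (fun j => ltVal (s j) 2) i fun j => hlt _ _
    have hval : Expr.val τ (.load 7 (cell (.load 14 (.add (.reg 11) (.const 1))) (.reg 10))) =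
        s i := by
      simp [h10t, h7, h14, hri, hc.hn, hs]
    have h3 := heq (s i) 0
    have h4 := hlt (s i) 2
    refine WP.seq (WP.assign ?_ ?_)
    · simp [h10t, hri, hc.hn, h14]; omega
    rw [hval]
    refine WP.seq (WP.assign ?_ (WP.assign ?_ ⟨⟨?_, ?_⟩, ?_⟩))
    · simp [-eqVal_def, h15]; omega
    · simp [-ltVal_def, h16]; omega
    · rw [Finset.sum_range_succ]
      simp [-eqVal_def, h15]; omega
    · rw [Finset.sum_range_succ]
      simp [-ltVal_def, h16]; omega
    · simp
  · rintro τ hfr ⟨h15, h16⟩ hcl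
    simp [-eqVal_def, -ltVal_def, hL] at h15 h16 hcl
    have hbuf : τ.buf = σ.buf := by rw [hfr.buf (by decide)]; simp
    refine WP.seq (WP.write trivial (WP.write trivial ⟨?_, ?_⟩))
    · simp [-eqVal_def, -ltVal_def, hbuf, h15, h16, spanEnds]
    · simp; omega

theorem printAnswer_spec {w n v m l q₀ qf : ℕ} {I : ℕ → ℕ} {σ : State}
    (hσ : Ctx n v m l q₀ qf I σ) (hvn : v ≤ n) (hbuf : σ.buf = [])
    (hrep : ∀ j ≤ l, σ.mem 14 (j + 1) < n) (hB : n * n + n + l + 20 < modulus w) :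
    WP w printAnswer (fun τ => τ.buf = [] ∧
      (∃ t ≤ σ.clock + v * ((l + 1) * 60 + 40) + 10, τ.clock = t ∧
        τ.log = σ.log ++ [(t, (List.range v).flatMap fun x =>
          spanEnds l fun j => σ.mem 7 (σ.mem 14 (j + 1) * n + x))])) σ := by
  have hv := hσ.hv
  refine WP.seq ?_
  refine WP.upTo_const (K := (l + 1) * 60 + 40) (Inv := fun i τ => τ.buf =
      (List.range i).flatMap fun x => spanEnds l fun j => σ.mem 7 (σ.mem 14 (j + 1) * n + x))
    (by decide) (by decide) (by decide) (by omega) (by simpa using hbuf) ?_ ?_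
  · intro i hi τ hfr hri hI
    rw [hv] at hi
    have hc := hσ.frame hfr (by decide)
    have h7 : τ.mem 7 = σ.mem 7 := hfr.mem 7 (by decide)
    have h14 : τ.mem 14 = σ.mem 14 := hfr.mem 14 (by decide)
    refine (printSpan_spec hc (show i < n by omega) hri (by rwa [h14]) (by omega)).mono ?_
    rintro τ' - ⟨h1, h2⟩
    refine ⟨?_, by omega⟩
    rw [State.setReg_buf, h1, hI, List.range_succ, List.flatMap_append, h7, h14]
    simp
  · intro τ hfr hI hcl
    rw [hv] at hI hcl
    have hlog : τ.log = σ.log := hfr.log (by decide)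
    refine ⟨_, .emit τ, rfl, τ.clock + 1, by omega, rfl, ?_⟩
    simp [hI, hlog]

end RAM

namespace RAM

/-! ### The enumeration loop -/

/-- The set of level `j` in the array `f`. -/
def setAt (n : ℕ) (f : ℕ → ℕ) (j : ℕ) : Finset ℕ :=
  (Finset.range n).filter fun q => f (j * n + q) ≠ 0

open Classical in
/-- The nodes of level `j + 1` that follow `S` and from which the end can be reached. -/
noncomputable def candSet (n : ℕ) (Ed : ℕ → ℕ → ℕ → Prop) (Al : ℕ → ℕ → Prop) (j : ℕ)
    (S : Finset ℕ) : Finset ℕ :=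
  (Finset.range n).filter fun q => ∃ p ∈ S, Ed j p q ∧ Al (j + 1) q

theorem mem_setAt {n : ℕ} {f : ℕ → ℕ} {j q : ℕ} :
    q ∈ setAt n f j ↔ q < n ∧ f (j * n + q) ≠ 0 := by
  simp [setAt]

theorem mem_candSet {n : ℕ} {Ed : ℕ → ℕ → ℕ → Prop} {Al : ℕ → ℕ → Prop} {j q : ℕ}
    {S : Finset ℕ} :
    q ∈ candSet n Ed Al j S ↔ ∃ p ∈ S, q < n ∧ Ed j p q ∧ Al (j + 1) q := by
  simp only [candSet, Finset.mem_filter, Finset.mem_range]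
  constructor
  · rintro ⟨h, p, hp, h'⟩; exact ⟨p, hp, h, h'⟩
  · rintro ⟨p, hp, h, h'⟩; exact ⟨h, p, hp, h'⟩

theorem setAt_congr {n : ℕ} {f g : ℕ → ℕ} {j : ℕ} (h : ∀ x < (j + 1) * n, f x = g x) :
    setAt n f j = setAt n g j := by
  ext q
  rw [mem_setAt, mem_setAt]
  refine and_congr_right fun hq => ?_
  rw [h _ (cell_lt (Nat.lt_succ_self j) hq)]

/-- Go back to the previous level, or stop. -/
def retreat : Cmd :=
  .branch (.reg 7) (.assign 7 (.sub (.reg 7) (.const 1))) (.assign 8 (.const 0))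

/-- Choose the key that has been found; then print an answer or go to the next level. -/
def advance : Cmd :=
  .seq (.store 12 (.reg 7) (.reg 12))
  (.seq (.store 14 (.add (.reg 7) (.const 1)) (.reg 14))
  (.seq fillNext
    (.branch (.eq (.add (.reg 7) (.const 1)) (.reg 6)) printAnswer
      (.seq (.assign 7 (.add (.reg 7) (.const 1))) (.store 12 (.reg 7) (.const 0))))))

/-- One step of the search for the next word. -/
def searchStep : Cmd :=
  .seq candidates (.seq findBest (.branch (.reg 12) advance retreat))

/-- Print the answers of all words. -/
def enumerate : Cmd :=
  .seq (.store 11 (.reg 4) (.const 1))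
  (.seq (.assign 7 (.const 0))
  (.seq (.assign 8 (.const 1)) (.loop (.reg 8) searchStep)))

/-- A time bound for one step of the search. -/
def stepTime (n : ℕ) : ℕ := n * (n * 60 + 120) + n * 120 + 200

/-- A time bound for printing an answer. -/
def printTime (v l : ℕ) : ℕ := v * ((l + 1) * 60 + 40) + 20

/-- The invariant of the enumeration. The words `rest` are still to be printed, `d` is the time by
which the next event has to happen. -/
structure EnumInv (k n v m l q₀ qf : ℕ) (I : ℕ → ℕ) (Ed : ℕ → ℕ → ℕ → Prop) (Al : ℕ → ℕ → Prop)
    (key st : ℕ → ℕ) (out : List ℕ → List ℕ) (all : List (List ℕ)) (pre delay D : ℕ)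
    (rest : List (List ℕ)) (d : ℕ) (τ : State) : Prop where
  ctx : Ctx n v m l q₀ qf I τ
  tables : Tables k n l Ed Al key st τ
  buf : τ.buf = []
  level : τ.reg 7 ≤ l
  rep : ∀ j < τ.reg 7, τ.mem 14 (j + 1) < n ∧ key (τ.mem 14 (j + 1)) = τ.mem 12 j
  log : τ.log.map Prod.snd ++ rest.map out = all
  onTime : OnTime pre delay (τ.log.map Prod.fst) d
  le : d + delay * rest.length ≤ D
  phase : (τ.reg 8 = 0 ∧ rest = [] ∧ τ.clock + 2 ≤ d) ∨
    (τ.reg 8 ≠ 0 ∧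
      rest = remaining (candSet n Ed Al) key (l + 1) (setAt n (τ.mem 11)) (τ.mem 12) (τ.reg 7) ∧
      (τ.clock + (stepTime n * (τ.reg 7 + l + 2) + printTime v l) ≤ d ∨
        (τ.mem 12 (τ.reg 7) = 0 ∧ ∃ p ∈ setAt n (τ.mem 11) (τ.reg 7), Al (τ.reg 7) p) ∧
          τ.clock + (stepTime n * (l + 1 - τ.reg 7) + printTime v l) ≤ d))

section

variable {w k n v m l q₀ qf : ℕ} {I : ℕ → ℕ} {Ed : ℕ → ℕ → ℕ → Prop} {Al : ℕ → ℕ → Prop}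
  {key st : ℕ → ℕ} {out : List ℕ → List ℕ} {all : List (List ℕ)} {pre delay D : ℕ}

theorem searchStep_spec (hvn : v ≤ n) (hkey : ∀ q < n, key q ≠ 0)
    (hAl : ∀ j ≤ l, ∀ p < n, Al j p → ∃ q < n, Ed j p q ∧ Al (j + 1) q)
    (hout : ∀ rep lim : ℕ → ℕ, (∀ j ≤ l, rep (j + 1) < n ∧ key (rep (j + 1)) = lim j) →
      ((List.range v).flatMap fun x => spanEnds l fun j => st (rep (j + 1) * n + x)) =
        out ((List.range (l + 1)).map lim))
    (hdelay : stepTime n * (2 * l + 2) + printTime v l ≤ delay)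
    (hB : (k + 1) * n * n + (k + 1) * n + (l + 2) * n + l + n + 20 < modulus w)
    {rest : List (List ℕ)} {d : ℕ} {σ : State} (h8 : σ.reg 8 ≠ 0)
    (hI : EnumInv k n v m l q₀ qf I Ed Al key st out all pre delay D rest d σ) :
    WP w searchStep (fun τ =>
      ∃ rest d, EnumInv k n v m l q₀ qf I Ed Al key st out all pre delay D rest d τ)
      (σ.tick 2) := by
  obtain ⟨hctx, hT, hbuf, hlev, hrep, hlog, hon, hle, hphase⟩ := hI
  obtain ⟨-, hrest, htime⟩ := hphase.resolve_left fun h => h8 h.1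
  have hnn : n * n ≤ (k + 1) * n * n := Nat.mul_le_mul_right _ (Nat.le_mul_of_pos_left _ (by omega))
  set j := σ.reg 7 with hj
  set S := setAt n (σ.mem 11) with hS
  set lim := σ.mem 12 with hlim
  have htime' : σ.clock + (stepTime n + printTime v l) ≤ d := by
    rcases htime with h | h
    · rw [show j + l + 2 = j + l + 1 + 1 by omega, Nat.mul_succ] at h
      omega
    · obtain ⟨e, he⟩ : ∃ e, l + 1 - j = e + 1 := ⟨l - j, by omega⟩
      rw [he, Nat.mul_succ] at h
      omega
  -- An exhausted level is met only in the first mode: on a fresh level the bound is `0`, and a live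
  -- node has a live successor, whose nonzero key makes it admissible.
  have hback : (τ : State) → τ.clock ≤ σ.clock + stepTime n →
      (∀ q ∈ candSet n Ed Al j (S j), ¬ lim j < key q) →
      τ.clock + (stepTime n * (j + l + 1) + printTime v l) ≤ d := by
    intro τ hτ hno
    rcases htime with h | ⟨⟨h1, p, hp, hal⟩, -⟩
    · rw [show j + l + 2 = j + l + 1 + 1 by omega, Nat.mul_succ] at h
      omega
    · obtain ⟨q, hq, he, ha⟩ := hAl j hlev p (mem_setAt.1 hp).1 hal
      have := hno q (mem_candSet.2 ⟨p, hp, hq, he, ha⟩)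
      rw [h1] at this
      exact absurd (Nat.pos_of_ne_zero (hkey q hq)) this
  have hstep : stepTime n = n * (n * 60 + 120) + n * 120 + 200 := rfl
  refine WP.seq ((candidates_spec (hctx.tick 2) (hT.of_mem (by intros; rfl)) (j := j) rfl hlev
    hB).mono fun σ₁ hfr₁ ⟨hcand, hcl₁⟩ => ?_)
  have hc₁ := (hctx.tick 2).frame hfr₁ (by decide)
  have hT₁ : Tables k n l Ed Al key st σ₁ := Tables.frame
    (hT.of_mem (by intros; rfl)) hfr₁ (by decide)
  have h7₁ : σ₁.reg 7 = j := hfr₁.reg 7 (by decide)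
  have h8₁ : σ₁.reg 8 ≠ 0 := by rwa [hfr₁.reg 8 (by decide)]
  have h11₁ : σ₁.mem 11 = σ.mem 11 := hfr₁.mem 11 (by decide)
  have h12₁ : σ₁.mem 12 = lim := hfr₁.mem 12 (by decide)
  have h14₁ : σ₁.mem 14 = σ.mem 14 := hfr₁.mem 14 (by decide)
  have hbuf₁ : σ₁.buf = [] := (hfr₁.buf (by decide)).trans hbuf
  have hlog₁ : σ₁.log = σ.log := hfr₁.log (by decide)
  have hcand' : ∀ q < n, σ₁.mem 13 q ≠ 0 ↔ q ∈ candSet n Ed Al j (S j) := by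
    intro q hq
    rw [hcand q hq, mem_candSet]
    constructor
    · rintro ⟨p, hp, h1, h2⟩
      exact ⟨p, mem_setAt.2 ⟨hp, h1⟩, hq, h2⟩
    · rintro ⟨p, hp, _, h2⟩
      exact ⟨p, (mem_setAt.1 hp).1, (mem_setAt.1 hp).2, h2⟩
  have hcandlt : ∀ q ∈ candSet n Ed Al j (S j), q < n := fun q hq => by
    obtain ⟨-, -, h, -⟩ := mem_candSet.1 hq
    exact h
  refine WP.seq ((findBest_spec hc₁ hT₁.keys (lim := lim j) (by rw [h7₁, h12₁])
    (by omega)).mono fun σ₂ hfr₂ ⟨hnone, hsome, hcl₂⟩ => ?_)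
  have hc₂ := hc₁.frame hfr₂ (by decide)
  have hT₂ := hT₁.frame hfr₂ (by decide)
  have h7₂ : σ₂.reg 7 = j := (hfr₂.reg 7 (by decide)).trans h7₁
  have h8₂ : σ₂.reg 8 ≠ 0 := by rwa [hfr₂.reg 8 (by decide)]
  have h11₂ : σ₂.mem 11 = σ.mem 11 := (hfr₂.mem 11 (by decide)).trans h11₁
  have h12₂ : σ₂.mem 12 = lim := (hfr₂.mem 12 (by decide)).trans h12₁
  have h13₂ : σ₂.mem 13 = σ₁.mem 13 := hfr₂.mem 13 (by decide)
  have h14₂ : σ₂.mem 14 = σ.mem 14 := (hfr₂.mem 14 (by decide)).trans h14₁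
  have hbuf₂ : σ₂.buf = [] := (hfr₂.buf (by decide)).trans hbuf₁
  have hlog₂ : σ₂.log = σ.log := (hfr₂.log (by decide)).trans hlog₁
  simp only [State.tick_clock] at hcl₁
  refine WP.branch trivial (fun h => ?_) (fun h => ?_)
  · simp only [Expr.val] at h
    obtain ⟨hrn, hrc, hrk, hrl, hrmin⟩ := hsome h
    set best := σ₂.reg 12 with hbest
    set rp := σ₂.reg 14 with hrp
    rw [hcand' rp hrn] at hrc
    have hmin : ∀ q ∈ candSet n Ed Al j (S j), lim j < key q → key rp ≤ key q := fun q hq hl => by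
      rw [hrk]
      exact hrmin q (hcandlt q hq) ((hcand' q (hcandlt q hq)).2 hq) hl
    refine WP.seq (WP.store trivial trivial (WP.seq (WP.store ?_ trivial (WP.seq ?_))))
    · simp [h7₂]; omega
    simp only [Expr.val, Expr.cost, State.tick_reg, State.setMem_reg, h7₂]
    rw [← hbest, ← hrp]
    set σ₃ := ((σ₂.tick (1 + 1)).setMem 12 j best (1 + 1 + 1)).setMem 14 (j + 1) rp
      (1 + 1 + 1 + 1 + 1) with hσ₃
    have hc₃ : Ctx n v m l q₀ qf I σ₃ :=
      ((hc₂.tick _).setMem (by decide) _ _ _).setMem (by decide) _ _ _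
    have hT₃ : Tables k n l Ed Al key st σ₃ := hT₂.of_mem (by simp [hσ₃])
    refine (fillNext_spec hc₃ hT₃.keys (j := j) (by simp [hσ₃, h7₂]) hlev (by omega)).mono
      fun σ₄ hfr₄ ⟨hnew, hold, hcl₄⟩ => ?_
    have hc₄ := hc₃.frame hfr₄ (by decide)
    have hT₄ := hT₃.frame hfr₄ (by decide)
    have h7₄ : σ₄.reg 7 = j := by rw [hfr₄.reg 7 (by decide)]; simp [hσ₃, h7₂]
    have h8₄ : σ₄.reg 8 ≠ 0 := by rw [hfr₄.reg 8 (by decide)]; simpa [hσ₃] using h8₂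
    have h12₄ : σ₄.mem 12 = Function.update lim j best := by
      rw [hfr₄.mem 12 (by decide)]; simp [hσ₃, h12₂]
    have h14₄ : σ₄.mem 14 = Function.update (σ.mem 14) (j + 1) rp := by
      rw [hfr₄.mem 14 (by decide)]; simp [hσ₃, h14₂]
    have hbuf₄ : σ₄.buf = [] := by rw [hfr₄.buf (by decide)]; simp [hσ₃, hbuf₂]
    have hlog₄ : σ₄.log = σ.log := by rw [hfr₄.log (by decide)]; simp [hσ₃, hlog₂]
    have hcl₃ : σ₃.clock = σ₂.clock + 10 := by simp [hσ₃]
    have h13₃ : σ₃.mem 13 = σ₁.mem 13 := by simp [hσ₃, h13₂]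
    have h12r : σ₃.reg 12 = best := by simp [hσ₃, hbest]
    rw [h13₃, h12r] at hnew
    -- The cells of the levels up to `j` lie below row `j + 1`, where `fillNext` writes.
    have hold' : ∀ i ≤ j, S i = setAt n (σ₄.mem 11) i := fun i hi => by
      refine setAt_congr fun x hx => ?_
      have : (i + 1) * n ≤ (j + 1) * n := Nat.mul_le_mul_right _ (by omega)
      rw [hold x (by omega)]
      simp [hσ₃, h11₂]
    have hnext : setAt n (σ₄.mem 11) (j + 1) = nextSet (candSet n Ed Al) key j (S j) (key rp) := by
      ext q
      rw [mem_setAt, nextSet, Finset.mem_filter, hrk]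
      constructor
      · rintro ⟨hq, h'⟩
        rw [hnew q hq, hcand' q hq] at h'
        exact h'
      · intro h'
        have hq := hcandlt q h'.1
        exact ⟨hq, (hnew q hq).2 ⟨(hcand' q hq).2 h'.1, h'.2⟩⟩
    have hrep₄ : ∀ i < j + 1, σ₄.mem 14 (i + 1) < n ∧
        key (σ₄.mem 14 (i + 1)) = σ₄.mem 12 i := by
      intro i hi
      rw [h14₄, h12₄]
      rcases Nat.lt_succ_iff_lt_or_eq.1 hi with hi | rfl
      · rw [Function.update_of_ne (by omega), Function.update_of_ne (by omega)]
        exact hrep i hi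
      · simp [hrn, hrk]
    have hlim₄ : ∀ i < j, lim i = σ₄.mem 12 i := fun i hi => by
      rw [h12₄, Function.update_of_ne (by omega)]
    have hlimj : σ₄.mem 12 j = key rp := by rw [h12₄, hrk, Function.update_self]
    rw [← hrk] at hrl
    refine WP.branch ?_ (fun h' => ?_) (fun h' => ?_)
    · simp [h7₄]; omega
    · simp [h7₄, hc₄.hL] at h'
      have hrep₅ : ∀ i ≤ l, σ₄.mem 14 (i + 1) < n ∧ key (σ₄.mem 14 (i + 1)) = σ₄.mem 12 i :=
        fun i hi => hrep₄ i (by omega)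
      have hrem := remaining_step_last (L := l + 1) (S := S) (S' := setAt n (σ₄.mem 11))
        (lim' := σ₄.mem 12) hrc hrl hmin hlim₄ hlimj hold' (by omega)
      refine (printAnswer_spec (hc₄.tick _) hvn (by simpa using hbuf₄)
        (fun i hi => (hrep₅ i hi).1) (by omega)).mono ?_
      rintro σ₅ hfr₅ ⟨hbuf₅, t, ht, hcl₅, hlog₅⟩
      simp only [State.tick_mem, State.tick_log, State.tick_clock, Expr.cost, hT₄.statuses,
        hout _ _ hrep₅] at hlog₅ ht
      have h7₅ : σ₅.reg 7 = j := (hfr₅.reg 7 (by decide)).trans h7₄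
      have h8₅ : σ₅.reg 8 ≠ 0 := by rw [hfr₅.reg 8 (by decide)]; exact h8₄
      have h11₅ : σ₅.mem 11 = σ₄.mem 11 := hfr₅.mem 11 (by decide)
      have h12₅ : σ₅.mem 12 = σ₄.mem 12 := hfr₅.mem 12 (by decide)
      have h14₅ : σ₅.mem 14 = σ₄.mem 14 := hfr₅.mem 14 (by decide)
      have htd : t ≤ d := by
        rw [hstep, printTime] at htime'
        omega
      rw [hrest, hrem] at hlog hle
      -- The search stays at the last level `l` and restarts the clock in the first mode, with `2 *
      -- l + 2` steps to the next event; this is where `hdelay` is used.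
      refine ⟨_, t + delay,
        { ctx := (hc₄.tick _).frame hfr₅ (by decide)
          tables := Tables.frame (hT₄.of_mem (by intros; rfl)) hfr₅ (by decide)
          buf := hbuf₅
          level := by omega
          rep := fun i hi => by
            rw [h14₅, h12₅]
            exact hrep₄ i (by omega)
          log := ?_
          onTime := ?_
          le := ?_
          phase := Or.inr ⟨h8₅, rfl, Or.inl ?_⟩ }⟩
      · rw [hlog₅, h11₅, h12₅, h7₅, ← hlog, hlog₄]
        simp
      · rw [hlog₅, hlog₄, List.map_append]
        exact hon.emit htd
      · rw [h11₅, h12₅, h7₅]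
        rw [List.length_cons, Nat.mul_succ] at hle
        omega
      · rw [h7₅, show j + l + 2 = 2 * l + 2 by omega]
        omega
    · simp [h7₄, hc₄.hL] at h'
      have hrem := remaining_step (L := l + 1) (S := S) (S' := setAt n (σ₄.mem 11))
        (lim' := Function.update (σ₄.mem 12) (j + 1) 0) hrc hrl hmin
        (fun i hi => by rw [Function.update_of_ne (by omega)]; exact hlim₄ i hi)
        (by rw [Function.update_of_ne (by omega), hlimj]) hold' (by omega) hnext (by simp)
      refine WP.seq (WP.assign ?_ (WP.store trivial ?_ ⟨rest, d,
        { ctx := (((hc₄.tick _).setReg (by decide) _ _).setMem (by decide) _ _ _)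
          tables := hT₄.of_mem (by simp)
          buf := by simpa using hbuf₄
          level := ?_
          rep := ?_
          log := by simpa [hlog₄] using hlog
          onTime := by simpa [hlog₄] using hon
          le := hle
          phase := Or.inr ⟨by simpa using h8₄, ?_, Or.inr ⟨⟨?_, rp, ?_, ?_⟩, ?_⟩⟩ }⟩))
      · simp [h7₄]; omega
      · simp; omega
      · simp [h7₄]; omega
      · intro i hi
        simp [h7₄] at hi
        have := hrep₄ i (by omega)
        simpa [h7₄, Function.update_of_ne (show i ≠ j + 1 by omega)] using this
      · rw [hrest, hrem]
        simp [h7₄]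
      · simp
      · have : rp ∈ setAt n (σ₄.mem 11) (j + 1) := by
          rw [hnext]
          exact Finset.mem_filter.2 ⟨hrc, rfl⟩
        simpa [h7₄] using this
      · obtain ⟨-, -, -, -, h2⟩ := mem_candSet.1 hrc
        simpa [h7₄] using h2
      · have h1 : stepTime n * (l + 1 - j) ≤ stepTime n * (j + l + 2) :=
          Nat.mul_le_mul_left _ (by omega)
        have h2 : σ.clock + (stepTime n * (l + 1 - j) + printTime v l) ≤ d := by
          rcases htime with h | h <;> omega
        rw [show l + 1 - j = l + 1 - (j + 1) + 1 by omega, Nat.mul_succ] at h2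
        simp only [State.setMem_clock, State.setMem_reg, State.setReg_reg, reduceIte, Expr.val,
          Expr.cost, State.setReg_clock, State.tick_clock, State.tick_reg, h7₄]
        omega
  · simp only [Expr.val] at h
    have hno : ∀ q ∈ candSet n Ed Al j (S j), ¬ lim j < key q := fun q hq =>
      hnone h q (hcandlt q hq) ((hcand' q (hcandlt q hq)).2 hq)
    have hnil := branchWords_eq_nil (L := l + 1) hno
    refine WP.branch trivial (fun h' => ?_) (fun h' => ?_)
    · simp only [Expr.val, State.tick_reg, h7₂] at h'
      obtain ⟨i, hi⟩ : ∃ i, j = i + 1 := ⟨j - 1, by omega⟩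
      refine WP.assign (by simp; omega) ⟨rest, d,
        { ctx := ((hc₂.tick _).tick _).setReg (by decide) _ _
          tables := hT₂.of_mem (by intros; rfl)
          buf := hbuf₂
          level := ?_
          rep := ?_
          log := by simpa [hlog₂] using hlog
          onTime := by simpa [hlog₂] using hon
          le := hle
          phase := Or.inr ⟨by simpa using h8₂, ?_, Or.inl ?_⟩ }⟩
      · simp [h7₂]; omega
      · intro i' hi'
        simp [h7₂] at hi'
        simpa [h14₂, h12₂] using hrep i' (by omega)
      · rw [hrest, hi, remaining]
        rw [hi] at hnil
        rw [hnil]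
        simp [h7₂, h11₂, h12₂, hi, hS]
      · have := hback (((σ₂.tick 2).tick 2).setReg 7 i 4) (by simp; omega) hno
        simp [h7₂, hi] at this ⊢
        rw [show i + l + 2 = i + 1 + l + 1 by omega]
        omega
    · simp only [Expr.val, State.tick_reg, h7₂] at h'
      -- With level `0` exhausted no words remain, and the next event is the halt.
      rw [h', remaining, ← h', hnil] at hrest
      refine WP.assign (by simp; omega) ⟨rest, d,
        { ctx := ((hc₂.tick _).tick _).setReg (by decide) _ _
          tables := hT₂.of_mem (by intros; rfl)
          buf := hbuf₂
          level := ?_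
          rep := ?_
          log := by simpa [hlog₂] using hlog
          onTime := by simpa [hlog₂] using hon
          le := hle
          phase := Or.inl ⟨by simp, hrest, ?_⟩ }⟩
      · simp [h7₂]; omega
      · intro i' hi'
        simp [h7₂, h'] at hi'
      · simp; omega

theorem enumerate_spec {σ : State} (hσ : Ctx n v m l q₀ qf I σ)
    (hT : Tables k n l Ed Al key st σ) (hvn : v ≤ n) (hq₀ : q₀ < n) (hkey : ∀ q < n, key q ≠ 0)
    (hAl : ∀ j ≤ l, ∀ p < n, Al j p → ∃ q < n, Ed j p q ∧ Al (j + 1) q)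
    (hout : ∀ rep lim : ℕ → ℕ, (∀ j ≤ l, rep (j + 1) < n ∧ key (rep (j + 1)) = lim j) →
      ((List.range v).flatMap fun x => spanEnds l fun j => st (rep (j + 1) * n + x)) =
        out ((List.range (l + 1)).map lim))
    (h11 : ∀ x, σ.mem 11 x = 0) (h12 : ∀ x, σ.mem 12 x = 0) (hbuf : σ.buf = [])
    (hlog : σ.log = [])
    (hpre : σ.clock + stepTime n * (l + 2) + printTime v l + 20 ≤ pre)
    (hdelay : stepTime n * (2 * l + 2) + printTime v l ≤ delay)
    (hB : (k + 1) * n * n + (k + 1) * n + (l + 2) * n + l + n + 20 < modulus w) :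
    WP w enumerate (fun τ => τ.buf = [] ∧
      τ.log.map Prod.snd = (wordsFrom (candSet n Ed Al) key (l + 1) 0 {q₀}).map out ∧
      OnTime pre delay (τ.log.map Prod.fst) τ.clock) σ := by
  set words := wordsFrom (candSet n Ed Al) key (l + 1) 0 {q₀} with hwords
  refine WP.seq (WP.store trivial (by simp; omega) (WP.seq (WP.assign (by simp; omega)
    (WP.seq (WP.assign (by simp; omega) ?_)))))
  simp only [Expr.val, Expr.cost, hσ.hq₀]
  set σ₁ := ((σ.setMem 11 q₀ 1 (1 + 1 + 1)).setReg 7 0 (1 + 1)).setReg 8 1 (1 + 1) with hσ₁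
  -- Since each printed answer moves the deadline by at most `delay` and shortens `rest`, this total
  -- bounds the clock throughout, which yields termination.
  refine WP.loop (D := pre + delay * words.length) (Inv := fun τ => ∃ rest d,
    EnumInv k n v m l q₀ qf I Ed Al key st out (words.map out) pre delay
      (pre + delay * words.length) rest d τ) ?_ ?_ ?_ ?_ ?_
  · have h0 : setAt n (σ₁.mem 11) 0 = {q₀} := by
      ext q
      simp [mem_setAt, hσ₁, Function.update_apply, h11]
      rintro rfl
      exact hq₀
    have hw : words = remaining (candSet n Ed Al) key (l + 1) (setAt n (σ₁.mem 11)) (σ₁.mem 12)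
        (σ₁.reg 7) := by
      rw [show σ₁.reg 7 = 0 by simp [hσ₁], remaining_start (by simp [hσ₁, h12]) (by omega), h0]
    -- The search starts in the first mode, as the initial state need not be live: there may be no
    -- answer at all.
    refine ⟨words, pre,
      { ctx := ((hσ.setMem (by decide) _ _ _).setReg (by decide) _ _).setReg (by decide) _ _
        tables := hT.of_mem (by simp [hσ₁])
        buf := hbuf
        level := by simp [hσ₁]
        rep := by simp [hσ₁]
        log := by simp [hσ₁, hlog]
        onTime := by
          rw [show σ₁.log = [] from hlog]
          exact ⟨by simp, by simp⟩
        le := le_rfl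
        phase := Or.inr ⟨by simp [hσ₁], hw, Or.inl ?_⟩ }⟩
    simp only [hσ₁, State.setReg_clock, State.setMem_clock, State.setReg_reg, Nat.reduceEqDiff,
      reduceIte, Nat.zero_add]
    omega
  · rintro τ ⟨rest, d, hI⟩
    have h1 := hI.le
    have : τ.clock ≤ d := by
      rcases hI.phase with h | ⟨-, -, h | h⟩ <;> omega
    omega
  · intros
    exact trivial
  · rintro τ - ⟨rest, d, hI⟩ h
    exact searchStep_spec hvn hkey hAl hout hdelay hB h hI
  · rintro τ - ⟨rest, d, hI⟩ h
    obtain ⟨-, hnil, hcl⟩ := hI.phase.resolve_right fun h' => h'.1 h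
    have h1 := hI.log
    rw [hnil, List.map_nil, List.append_nil] at h1
    exact ⟨hI.buf, h1, hI.onTime.mono (by simpa using hcl)⟩

end

end RAM

/-! ### Paths of functional automata -/

section functional

variable {S V Q : Type*} {step : Q → Option (RefSymbol S V) → Q → Prop} {a f : Q}

/-- The numbers of operations along the run `run` are as the tuple `μ` requires. -/
def StatusesOf {s : List S} (st : Q → V → ℕ) (run : ℕ → Q) (μ : SpanTuple V s) : Prop :=
  ∀ i ≤ s.length, ∀ x, st (run i) x =
    (if (μ x).left ≤ i + 1 then 1 else 0) + if (μ x).right ≤ i + 1 then 1 else 0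

theorem LabelPath.split {p : Q} {r r₁ r₂ : List (RefSymbol S V)} (h : LabelPath step p r f)
    (hr : r = r₁ ++ r₂) : ∃ q, LabelPath step p r₁ q ∧ LabelPath step q r₂ f := by
  induction h generalizing r₁ with
  | nil p =>
    obtain ⟨rfl, rfl⟩ := List.append_eq_nil_iff.1 hr.symm
    exact ⟨p, .nil p, .nil p⟩
  | eps hs _ ih =>
    obtain ⟨q, h1, h2⟩ := ih hr
    exact ⟨q, .eps hs h1, h2⟩
  | cons hs hp ih =>
    cases r₁ with
    | nil =>
      subst hr
      exact ⟨_, .nil _, .cons hs hp⟩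
    | cons c r₁ =>
      rw [List.cons_append, List.cons.injEq] at hr
      obtain ⟨rfl, hr⟩ := hr
      obtain ⟨q, h1, h2⟩ := ih hr
      exact ⟨q, .cons hs h1, h2⟩

theorem GapRun.exists_path_to_last {s : List S} {run : ℕ → Q} (h : GapRun step a f s run) {i : ℕ}
    (hi : i ≤ s.length) : ∃ r, LabelPath step (run i) r f := by
  induction hi using Nat.decreasingInduction with
  | self => exact ⟨[], by rw [h.last]; exact .nil f⟩
  | of_succ i hi ih =>
    obtain ⟨r, hr⟩ := ih
    obtain ⟨p, hs, hp⟩ := h.next i hi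
    obtain ⟨r', hr', -⟩ := silent_iff.1 hp
    exact ⟨_, .cons hs (hr'.append hr)⟩

/-- As `left ≤ right`, the status is nonzero from gap `left - 1` on and equals `2` from gap `right -
1` on, so the spans can be read off the statuses. Comparing at these gaps of both tuples suffices.
-/
theorem StatusesOf.unique {s : List S} {st : Q → V → ℕ} {run : ℕ → Q} {μ μ' : SpanTuple V s}
    (h : StatusesOf st run μ) (h' : StatusesOf st run μ') : μ = μ' := by
  funext x
  have h1 := (μ x).one_le_left
  have h2 := (μ x).left_le_right
  have h3 := (μ x).right_le
  have h1' := (μ' x).one_le_left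
  have h2' := (μ' x).left_le_right
  have h3' := (μ' x).right_le
  have key : ∀ i ≤ s.length, ((if (μ x).left ≤ i + 1 then 1 else 0) +
      if (μ x).right ≤ i + 1 then 1 else 0) = (if (μ' x).left ≤ i + 1 then 1 else 0) +
      if (μ' x).right ≤ i + 1 then 1 else 0 := fun i hi => (h i hi x).symm.trans (h' i hi x)
  have kl := key ((μ x).left - 1) (by omega)
  have kl' := key ((μ' x).left - 1) (by omega)
  have kr := key ((μ x).right - 1) (by omega)
  have kr' := key ((μ' x).right - 1) (by omega)
  ext
  · split_ifs at kl kl' <;> omega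
  · split_ifs at kr kr' <;> omega

/-- The gaps of status `0` are `0, …, left - 2` and those of status below `2` are `0, …, right - 2`;
counting them gives the endpoints minus one. -/
theorem StatusesOf.spanEnds {s : List S} {st : Q → V → ℕ} {run : ℕ → Q} {μ : SpanTuple V s}
    (h : StatusesOf st run μ) (x : V) :
    RAM.spanEnds s.length (fun j => st (run j) x) = [(μ x).left, (μ x).right] := by
  have h1 := (μ x).one_le_left
  have h2 := (μ x).left_le_right
  have h3 := (μ x).right_le
  have hcard : ∀ b, b ≤ s.length →
      ((Finset.range (s.length + 1)).filter fun j => j < b).card = b := fun b hb => by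
    have : ((Finset.range (s.length + 1)).filter fun j => j < b) = Finset.range b := by
      ext j; simp; omega
    rw [this, Finset.card_range]
  have hl : ∑ j ∈ Finset.range (s.length + 1), RAM.eqVal (st (run j) x) 0 = (μ x).left - 1 := by
    rw [← hcard ((μ x).left - 1) (by omega), Finset.card_filter]
    refine Finset.sum_congr rfl fun j hj => ?_
    rw [Finset.mem_range] at hj
    rw [RAM.eqVal_def, h j (by omega) x]
    split_ifs <;> omega
  have hr : ∑ j ∈ Finset.range (s.length + 1), RAM.ltVal (st (run j) x) 2 = (μ x).right - 1 := by
    rw [← hcard ((μ x).right - 1) (by omega), Finset.card_filter]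
    refine Finset.sum_congr rfl fun j hj => ?_
    rw [Finset.mem_range] at hj
    rw [RAM.ltVal_def, h j (by omega) x]
    split_ifs <;> omega
  rw [RAM.spanEnds, hl, hr]
  congr 1
  · omega
  · congr 1; omega

variable [DecidableEq S] [DecidableEq V]

/-- This is where functionality enters: a common suffix completes both prefixes to valid words,
which contain exactly two operations on `x`. -/
theorem opCount_eq_of_valid (hval : ∀ r, LabelPath step a r f → ValidRefWord r) {q : Q}
    {r₁ r₂ r : List (RefSymbol S V)} (h₁ : LabelPath step a r₁ q) (h₂ : LabelPath step a r₂ q)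
    (h : LabelPath step q r f) (x : V) : opCount x r₁ = opCount x r₂ := by
  have e₁ := (hval _ (h₁.append h)).opCount_eq x
  have e₂ := (hval _ (h₂.append h)).opCount_eq x
  rw [opCount_append] at e₁ e₂
  omega

theorem opCount_le_of_valid (hval : ∀ r, LabelPath step a r f → ValidRefWord r) {q : Q}
    {r₁ r : List (RefSymbol S V)} (h₁ : LabelPath step a r₁ q) (h : LabelPath step q r f) (x : V) :
    opCount x r₁ ≤ 2 := by
  have e₁ := (hval _ (h₁.append h)).opCount_eq x
  rw [opCount_append] at e₁
  omega

/-- `st` gives, at all states on paths from `a` to `f`, the numbers of operations on the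
variables. -/
def IsStatus (step : Q → Option (RefSymbol S V) → Q → Prop) (a f : Q) (st : Q → V → ℕ) : Prop :=
  ∀ q r r', LabelPath step a r q → LabelPath step q r' f → ∀ x, st q x = opCount x r

/-- One arbitrary path to each reachable state is enough, since on accepting paths the counts depend
only on the state; there they are at most `2`, so the cap has no effect. -/
theorem isStatus_of_exists (hval : ∀ r, LabelPath step a r f → ValidRefWord r) {st : Q → V → ℕ}
    (h : ∀ q r, LabelPath step a r q →
      ∃ r', LabelPath step a r' q ∧ ∀ x, st q x = min 2 (opCount x r')) :
    IsStatus step a f st := by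
  intro q r r' hr hr' x
  obtain ⟨r₀, h₀, hst⟩ := h q r hr
  rw [hst, opCount_eq_of_valid hval hr h₀ hr', min_eq_right (opCount_le_of_valid hval h₀ hr' x)]

theorem statusesOf_of_paths {st : Q → V → ℕ} (hst : IsStatus step a f st) {s : List S}
    {run : ℕ → Q} (hrun : GapRun step a f s run) {r : List (RefSymbol S V)} (hr : ValidRefWord r)
    (hp : ∀ i ≤ s.length, LabelPath step a (gapPrefix i r) (run i)) {μ : SpanTuple V s}
    (hμ : IsTupleOf r μ) : StatusesOf st run μ := by
  intro i hi x
  obtain ⟨r', hr'⟩ := hrun.exists_path_to_last hi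
  rw [hst _ _ _ (hp i hi) hr' x, hr.opCount_gapPrefix hμ]

theorem exists_tuple_of_gapRun (hval : ∀ r, LabelPath step a r f → ValidRefWord r)
    {st : Q → V → ℕ} (hst : IsStatus step a f st) {s : List S} {run : ℕ → Q}
    (hrun : GapRun step a f s run) : ∃ μ : SpanTuple V s,
      (∃ r, LabelPath step a r f ∧ ValidRefWord r ∧ clean r = s ∧ IsTupleOf r μ) ∧
      StatusesOf st run μ := by
  obtain ⟨r, hr, hc, hp⟩ := hrun.exists_path
  have hv := hval r hr
  obtain ⟨μ, hμ⟩ := hv.exists_tuple hc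
  exact ⟨μ, ⟨r, hr, hv, hc, hμ⟩, statusesOf_of_paths hst hrun hv hp hμ⟩

theorem exists_gapRun_of_tuple {st : Q → V → ℕ} (hst : IsStatus step a f st) {s : List S}
    {μ : SpanTuple V s} {r : List (RefSymbol S V)} (hr : LabelPath step a r f)
    (hv : ValidRefWord r) (hc : clean r = s) (hμ : IsTupleOf r μ) :
    ∃ run, GapRun step a f s run ∧ StatusesOf st run μ := by
  obtain ⟨run, hrun, hp⟩ := hr.exists_gapRun
  rw [hc] at hrun hp
  exact ⟨run, hrun, statusesOf_of_paths hst hrun hv hp hμ⟩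

/-- Between the words of keys along the runs and the tuples there is a bijection, if keys stand for
statuses. -/
theorem exists_tuples_of_words (hval : ∀ r, LabelPath step a r f → ValidRefWord r)
    {st : Q → V → ℕ} (hst : IsStatus step a f st) {s : List S} {key : Q → ℕ} {X : Set Q}
    (hX : ∀ run, GapRun step a f s run → ∀ i ≤ s.length, run i ∈ X)
    (hkey : ∀ q ∈ X, ∀ q' ∈ X, key q = key q' ↔ ∀ x, st q x = st q' x)
    {words : List (List ℕ)} (hnd : words.Nodup)
    (hwords : ∀ u, u ∈ words ↔ ∃ run, GapRun step a f s run ∧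
      u = (List.range (s.length + 1)).map fun i => key (run i))
    {β : Type*} {out : List ℕ → β} {enc : SpanTuple V s → β}
    (hout : ∀ run μ, GapRun step a f s run → StatusesOf st run μ →
      out ((List.range (s.length + 1)).map fun i => key (run i)) = enc μ) :
    ∃ answers : List (SpanTuple V s), answers.Nodup ∧
      (∀ μ, μ ∈ answers ↔
        ∃ r, LabelPath step a r f ∧ ValidRefWord r ∧ clean r = s ∧ IsTupleOf r μ) ∧
      answers.map enc = words.map out := by
  have hex : ∀ u, ∃ μ : SpanTuple V s, u ∈ words → ∃ run, GapRun step a f s run ∧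
      (u = (List.range (s.length + 1)).map fun i => key (run i)) ∧
      (∃ r, LabelPath step a r f ∧ ValidRefWord r ∧ clean r = s ∧ IsTupleOf r μ) ∧
      StatusesOf st run μ := fun u => by
    by_cases hu : u ∈ words
    · obtain ⟨run, hrun, rfl⟩ := (hwords u).1 hu
      obtain ⟨μ, h1, h2⟩ := exists_tuple_of_gapRun hval hst hrun
      exact ⟨μ, fun _ => ⟨run, hrun, rfl, h1, h2⟩⟩
    · exact ⟨fun _ => ⟨1, 1, le_rfl, le_rfl, by omega⟩, fun h => absurd h hu⟩
  choose tup htup using hex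
  refine ⟨words.map tup, ?_, fun μ => ?_, ?_⟩
  · rw [List.nodup_map_iff_inj_on hnd]
    intro u hu u' hu' he
    obtain ⟨run, hrun, hu₁, -, hs⟩ := htup u hu
    obtain ⟨run', hrun', hu₁', -, hs'⟩ := htup u' hu'
    rw [hu₁, hu₁']
    refine List.map_congr_left fun i hi => ?_
    have hi := List.mem_range.1 hi
    refine (hkey _ (hX _ hrun i (by omega)) _ (hX _ hrun' i (by omega))).2 fun x => ?_
    rw [hs i (by omega) x, hs' i (by omega) x, he]
  · rw [List.mem_map]
    constructor
    · rintro ⟨u, hu, rfl⟩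
      obtain ⟨-, -, -, h, -⟩ := htup u hu
      exact h
    · rintro ⟨r, hr, hv, hc, hμ⟩
      obtain ⟨run, hrun, hs⟩ := exists_gapRun_of_tuple hst hr hv hc hμ
      have hu := (hwords _).2 ⟨run, hrun, rfl⟩
      refine ⟨_, hu, ?_⟩
      obtain ⟨run', hrun', he, -, hs'⟩ := htup _ hu
      refine StatusesOf.unique hs' fun i hi x => ?_
      rw [← hs i hi x]
      refine (hkey _ (hX _ hrun' i hi) _ (hX _ hrun i hi)).1 ?_ x
      exact (List.map_inj_left.1 he i (List.mem_range.2 (by omega))).symm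
  · rw [List.map_map]
    refine List.map_congr_left fun u hu => ?_
    obtain ⟨run, hrun, he, -, hs⟩ := htup u hu
    rw [Function.comp_apply, ← hout run _ hrun hs, ← he]

/-- The number of all variable operations. -/
def opTotal [Fintype V] (r : List (RefSymbol S V)) : ℕ := ∑ x, opCount x r

/-- A discrete intermediate value argument: each symbol raises the total by at most one. -/
theorem exists_prefix_opTotal_eq [Fintype V] (r : List (RefSymbol S V)) {j : ℕ}
    (hj : j ≤ opTotal r) : ∃ r₁ r₂, r = r₁ ++ r₂ ∧ opTotal r₁ = j := by
  induction r using List.reverseRecOn with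
  | nil => exact ⟨[], [], rfl, by simp [opTotal, opCount] at hj ⊢; omega⟩
  | append_singleton r c ih =>
    by_cases h : j ≤ opTotal r
    · obtain ⟨r₁, r₂, rfl, h'⟩ := ih h
      exact ⟨r₁, r₂ ++ [c], by simp, h'⟩
    · refine ⟨r ++ [c], [], by simp, ?_⟩
      have h1 : opTotal (r ++ [c]) = opTotal r + opTotal [c] := by
        simp [opTotal, Finset.sum_add_distrib]
      have h2 : opTotal [c] ≤ 1 := by
        cases c <;> simp [opTotal, opCount, List.count_singleton]
      omega

/-- A functional automaton that accepts a word has at least as many states as variables. -/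
theorem card_le_of_valid [Fintype V] [Fintype Q]
    (hval : ∀ r, LabelPath step a r f → ValidRefWord r) {r : List (RefSymbol S V)}
    (hr : LabelPath step a r f) : Fintype.card V ≤ Fintype.card Q := by
  have htot : opTotal r = Fintype.card V * 2 := by
    simp [opTotal, (hval r hr).opCount_eq]
  have hex : ∀ j : Fin (Fintype.card V), ∃ q r₁ r₂, LabelPath step a r₁ q ∧
      LabelPath step q r₂ f ∧ opTotal r₁ = j := fun j => by
    obtain ⟨r₁, r₂, he, hj⟩ := exists_prefix_opTotal_eq r (j := j) (by omega)
    obtain ⟨q, h1, h2⟩ := hr.split he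
    exact ⟨q, r₁, r₂, h1, h2, hj⟩
  choose q r₁ r₂ h1 h2 hj using hex
  -- Operation counts are a function of the state, so cuts of an accepting path with different
  -- totals fall on different states.
  have : Function.Injective q := fun j j' he => by
    have h3 := h1 j'
    rw [← he] at h3
    have : opTotal (r₁ j) = opTotal (r₁ j') :=
      Finset.sum_congr rfl fun x _ => opCount_eq_of_valid hval (h1 j) h3 (h2 j) x
    rw [hj, hj] at this
    exact Fin.ext this
  simpa using Fintype.card_le_of_injective _ this

end functional

/-! ### Automata on natural numbers -/

namespace VSetAutomaton

theorem mem_refLanguage_iff {S V Q : Type*} {A : VSetAutomaton S V Q}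
    {r : List (RefSymbol S V)} :
    r ∈ A.refLanguage ↔ LabelPath (fun p o q => q ∈ A.δ p o) A.start r A.final := by
  have hpath : ∀ p x q, A.toEpsNFA.IsPath p q x →
      LabelPath (fun p o q => q ∈ A.δ p o) p x.reduceOption q := by
    intro p x q h
    induction h with
    | nil s => exact .nil s
    | cons t s u o x hs _ ih =>
      cases o with
      | none => exact .eps hs ih
      | some c => exact .cons hs ih
  rw [refLanguage, εNFA.mem_accepts_iff_exists_path]
  constructor
  · rintro ⟨p, q, x, hp, hq, rfl, h⟩
    obtain rfl : p = A.start := hp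
    obtain rfl : q = A.final := hq
    exact hpath _ _ _ h
  · intro h
    suffices ∀ p q, LabelPath (fun p o q => q ∈ A.δ p o) p r q →
        ∃ x : List (Option (RefSymbol S V)), x.reduceOption = r ∧ A.toEpsNFA.IsPath p q x by
      obtain ⟨x, hx, hp⟩ := this _ _ h
      exact ⟨_, _, x, rfl, rfl, hx, hp⟩
    intro p q hp
    clear h
    induction hp with
    | nil p => exact ⟨[], rfl, .nil p⟩
    | eps hs _ ih =>
      obtain ⟨x, rfl, hx⟩ := ih
      exact ⟨none :: x, rfl, .cons _ _ _ _ _ hs hx⟩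
    | @cons _ _ _ c _ hs _ ih =>
      obtain ⟨x, rfl, hx⟩ := ih
      exact ⟨some c :: x, rfl, .cons _ _ _ _ _ hs hx⟩

variable {k v n : ℕ}

/-- The transitions as triples whose states are natural numbers. -/
def natStep (A : VSetAutomaton (Fin k) (Fin v) (Fin n)) (p : ℕ)
    (o : Option (RefSymbol (Fin k) (Fin v))) (q : ℕ) : Prop :=
  ∃ p' q' : Fin n, q' ∈ A.δ p' o ∧ (p' : ℕ) = p ∧ (q' : ℕ) = q

theorem natPath_iff {A : VSetAutomaton (Fin k) (Fin v) (Fin n)} {p q : Fin n}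
    {r : List (RefSymbol (Fin k) (Fin v))} :
    LabelPath A.natStep p r q ↔ LabelPath (fun p o q => q ∈ A.δ p o) p r q := by
  constructor
  · suffices ∀ a b : ℕ, LabelPath A.natStep a r b → ∀ p q : Fin n, (p : ℕ) = a → (q : ℕ) = b →
        LabelPath (fun p o q => q ∈ A.δ p o) p r q from fun h => this _ _ h _ _ rfl rfl
    intro a b h
    induction h with
    | nil a =>
      rintro p q rfl h
      obtain rfl := Fin.ext h
      exact .nil _
    | eps hs _ ih =>
      rintro p q rfl rfl
      obtain ⟨p', q', hs, h, rfl⟩ := hs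
      obtain rfl := Fin.ext h
      exact .eps hs (ih _ _ rfl rfl)
    | cons hs _ ih =>
      rintro p q rfl rfl
      obtain ⟨p', q', hs, h, rfl⟩ := hs
      obtain rfl := Fin.ext h
      exact .cons hs (ih _ _ rfl rfl)
  · intro h
    induction h with
    | nil p => exact .nil _
    | eps hs _ ih => exact .eps ⟨_, _, hs, rfl, rfl⟩ ih
    | cons hs _ ih => exact .cons ⟨_, _, hs, rfl, rfl⟩ ih

theorem mem_refLanguage_iff_natPath {A : VSetAutomaton (Fin k) (Fin v) (Fin n)}
    {r : List (RefSymbol (Fin k) (Fin v))} :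
    r ∈ A.refLanguage ↔ LabelPath A.natStep A.start r A.final := by
  rw [mem_refLanguage_iff, natPath_iff]

theorem mem_spanRelation_iff {A : VSetAutomaton (Fin k) (Fin v) (Fin n)} {s : List (Fin k)}
    {μ : SpanTuple (Fin v) s} : μ ∈ A.spanRelation s ↔
      ∃ r, LabelPath A.natStep A.start r A.final ∧ ValidRefWord r ∧ clean r = s ∧
        IsTupleOf r μ := by
  simp only [spanRelation, Set.mem_ofPred_eq, mem_refLanguage_iff_natPath]

/-- Justifies the immediate halt of `solve`; in all other cases `v ≤ n` is available for address and
time bounds. -/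
theorem spanRelation_eq_empty_of_lt {A : VSetAutomaton (Fin k) (Fin v) (Fin n)}
    (hA : A.Functional) (h : n < v) (s : List (Fin k)) : A.spanRelation s = ∅ := by
  rw [Set.eq_empty_iff_forall_notMem]
  rintro μ ⟨r, hr, -⟩
  have := card_le_of_valid (fun r hr => hA r (mem_refLanguage_iff.2 hr))
    (mem_refLanguage_iff.1 hr)
  simp only [Fintype.card_fin] at this
  omega

end VSetAutomaton

/-! ### The input array -/

theorem length_encodeLabel {k v : ℕ} (o : Option (RefSymbol (Fin k) (Fin v))) :
    (encodeLabel o).length = 2 := by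
  rcases o with _ | ⟨_ | _ | _⟩ <;> rfl

theorem encodeLabel_injective {k v : ℕ} :
    Function.Injective (encodeLabel : Option (RefSymbol (Fin k) (Fin v)) → List ℕ) := by
  rintro (_ | ⟨_ | _ | _⟩) (_ | ⟨_ | _ | _⟩) h <;> simp_all [encodeLabel, Fin.ext_iff]

theorem getD_flatMap {α : Type*} {g : α → List ℕ} {b : ℕ} (hg : ∀ t, (g t).length = b)
    (ts : List α) (ys : List ℕ) {j c : ℕ} (hj : j < ts.length) (hc : c < b) :
    (ts.flatMap g ++ ys).getD (c + b * j) 0 = (g ts[j]).getD c 0 := by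
  induction ts generalizing j with
  | nil => simp at hj
  | cons t ts ih =>
    rw [List.flatMap_cons, List.append_assoc]
    cases j with
    | zero => rw [Nat.mul_zero, add_zero, List.getD_append _ _ _ _ (by rw [hg]; exact hc)]; rfl
    | succ j =>
      rw [List.getD_append_right _ _ _ _ (by rw [hg, Nat.mul_succ]; omega), hg,
        show c + b * (j + 1) - b = c + b * j by rw [Nat.mul_succ]; omega,
        ih (by simpa using hj)]
      rfl

theorem encodeInput_eq {k v n : ℕ} (A : VSetAutomaton (Fin k) (Fin v) (Fin n))
    (ts : List (Fin n × Option (RefSymbol (Fin k) (Fin v)) × Fin n)) (s : List (Fin k)) :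
    encodeInput A ts s = [n, v, ts.length, s.length, (A.start : ℕ), (A.final : ℕ)] ++
      (ts.flatMap (fun t => [(t.1 : ℕ)] ++ encodeLabel t.2.1 ++ [(t.2.2 : ℕ)]) ++
        List.map (fun a : Fin k => (a : ℕ)) s) := by
  rw [encodeInput, List.append_assoc]
  congr 2
  induction s with
  | nil => rfl
  | cons a s ih => simpa using ih

/-- The array `I` holds the transitions `ts` and the string `s` in the input format. -/
structure HoldsInput {k v n : ℕ} (A : VSetAutomaton (Fin k) (Fin v) (Fin n)) (s : List (Fin k))
    (I : ℕ → ℕ) (m : ℕ) : Prop where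
  step_iff : ∀ p o q, A.natStep p o q ↔ ∃ j < m, I (6 + 4 * j) = p ∧
    encodeLabel o = [I (7 + 4 * j), I (8 + 4 * j)] ∧ I (9 + 4 * j) = q
  sound : ∀ j < m, ∃ p o q, A.natStep p o q ∧ I (6 + 4 * j) = p ∧
    encodeLabel o = [I (7 + 4 * j), I (8 + 4 * j)] ∧ I (9 + 4 * j) = q
  letters : ∀ i (h : i < s.length), I (i + (6 + 4 * m)) = (s[i] : ℕ)

/-- Six header words are followed by records of four words (source, kind, argument, target), then by
the string. This is the origin of the addresses `6 + 4 * j, …, 9 + 4 * j` and `6 + 4 * m + i`. -/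
theorem holdsInput_encodeInput {k v n : ℕ} {A : VSetAutomaton (Fin k) (Fin v) (Fin n)}
    {ts : List (Fin n × Option (RefSymbol (Fin k) (Fin v)) × Fin n)} (s : List (Fin k))
    (hts : ∀ t, t ∈ ts ↔ t ∈ A.transitions) :
    HoldsInput A s (fun i => (encodeInput A ts s).getD i 0) ts.length := by
  set g : Fin n × Option (RefSymbol (Fin k) (Fin v)) × Fin n → List ℕ :=
    fun t => [(t.1 : ℕ)] ++ encodeLabel t.2.1 ++ [(t.2.2 : ℕ)] with hgdef
  have hg : ∀ t, (g t).length = 4 := fun t => by simp [hgdef, length_encodeLabel]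
  have hget : ∀ j (hj : j < ts.length) c, c < 4 →
      (encodeInput A ts s).getD (6 + c + 4 * j) 0 = (g ts[j]).getD c 0 := by
    intro j hj c hc
    rw [encodeInput_eq, List.getD_append_right _ _ _ _ (by simp; omega),
      ← getD_flatMap hg ts (List.map (fun a : Fin k => (a : ℕ)) s) hj hc]
    congr 1
    simp; omega
  have hrec : ∀ j (hj : j < ts.length),
      (encodeInput A ts s).getD (6 + 4 * j) 0 = ts[j].1 ∧
      encodeLabel ts[j].2.1 = [(encodeInput A ts s).getD (7 + 4 * j) 0,
        (encodeInput A ts s).getD (8 + 4 * j) 0] ∧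
      (encodeInput A ts s).getD (9 + 4 * j) 0 = ts[j].2.2 := by
    intro j hj
    obtain ⟨x, y, hxy⟩ := List.length_eq_two.1 (length_encodeLabel ts[j].2.1)
    have h0 := hget j hj 0 (by omega)
    have h1 := hget j hj 1 (by omega)
    have h2 := hget j hj 2 (by omega)
    have h3 := hget j hj 3 (by omega)
    rw [hgdef] at h0 h1 h2 h3
    simp only [hxy] at h0 h1 h2 h3
    refine ⟨h0, ?_, h3⟩
    rw [hxy]
    congr 1
    · exact h1.symm
    · congr 1
      exact h2.symm
  refine ⟨fun p o q => ⟨?_, ?_⟩, fun j hj => ?_, fun i hi => ?_⟩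
  · rintro ⟨p', q', h, rfl, rfl⟩
    obtain ⟨j, hj, he⟩ := List.getElem_of_mem ((hts (p', o, q')).2 h)
    obtain ⟨h1, h2, h3⟩ := hrec j hj
    rw [he] at h1 h2 h3
    exact ⟨j, hj, h1, h2, h3⟩
  · rintro ⟨j, hj, rfl, ho, rfl⟩
    obtain ⟨h1, h2, h3⟩ := hrec j hj
    refine ⟨ts[j].1, ts[j].2.2, ?_, h1.symm, h3.symm⟩
    rw [encodeLabel_injective (ho.trans h2.symm)]
    exact (hts _).1 (List.getElem_mem hj)
  · obtain ⟨h1, h2, h3⟩ := hrec j hj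
    exact ⟨_, _, _, ⟨_, _, (hts _).1 (List.getElem_mem hj), rfl, rfl⟩, h1, h2, h3⟩
  · have hlen : ([n, v, ts.length, s.length, (A.start : ℕ), (A.final : ℕ)] ++
        ts.flatMap g).length = 6 + 4 * ts.length := by
      simp [List.length_flatMap, hg, mul_comm]
      omega
    rw [encodeInput_eq, ← List.append_assoc, List.getD_append_right _ _ _ _ (by rw [hlen]; omega), hlen,
      Nat.add_sub_cancel,
      List.getD_eq_getElem _ _ (by simpa using hi), List.getElem_map]

namespace HoldsInput

variable {k v n m : ℕ} {A : VSetAutomaton (Fin k) (Fin v) (Fin n)} {s : List (Fin k)} {I : ℕ → ℕ}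

theorem bounds (h : HoldsInput A s I m) {j : ℕ} (hj : j < m) :
    I (6 + 4 * j) < n ∧ I (9 + 4 * j) < n ∧ (I (7 + 4 * j) = 1 → I (8 + 4 * j) < k) ∧
      (1 < I (7 + 4 * j) → I (8 + 4 * j) < v) := by
  obtain ⟨p, o, q, ⟨p', q', -, rfl, rfl⟩, hp, ho, hq⟩ := h.sound j hj
  refine ⟨by omega, by omega, ?_⟩
  rcases o with _ | ⟨a | x | x⟩ <;> simp only [encodeLabel, List.cons.injEq, and_true] at ho <;>
    omega

theorem silent_step_iff (h : HoldsInput A s I m) {p q : ℕ} : SilentStep A.natStep p q ↔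
    RAM.AdjStep (fun q => RAM.silentFrom I q m) (fun e => I (9 + 4 * e)) p q := by
  simp only [SilentStep, RAM.AdjStep, RAM.mem_silentFrom]
  constructor
  · rintro ⟨o, ho, hl⟩
    obtain ⟨j, hj, h1, h2, h3⟩ := (h.step_iff _ _ _).1 ho
    refine ⟨j, ⟨hj, h1, fun h' => ?_⟩, h3⟩
    rcases o with _ | ⟨a | x | x⟩
    · simp [encodeLabel] at h2; omega
    · exact hl a rfl
    · simp [encodeLabel] at h2; omega
    · simp [encodeLabel] at h2; omega
  · rintro ⟨j, ⟨hj, h1, h2⟩, h3⟩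
    obtain ⟨p', o, q', hs, hp, ho, hq⟩ := h.sound j hj
    obtain rfl : p' = p := hp.symm.trans h1
    obtain rfl : q' = q := hq.symm.trans h3
    refine ⟨o, hs, ?_⟩
    rintro a rfl
    simp [encodeLabel] at ho
    omega

theorem letter_step_iff (h : HoldsInput A s I m) {p q : ℕ} {a : Fin k} :
    A.natStep p (some (.letter a)) q ↔ ∃ j < m, I (7 + 4 * j) = 1 ∧ I (8 + 4 * j) = a ∧
      I (6 + 4 * j) = p ∧ I (9 + 4 * j) = q := by
  rw [h.step_iff]
  simp only [encodeLabel, List.cons.injEq, and_true]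
  constructor
  · rintro ⟨j, hj, h1, h2, h3⟩
    exact ⟨j, hj, by omega, by omega, h1, h3⟩
  · rintro ⟨j, hj, h1, h2, h3, h4⟩
    exact ⟨j, hj, h3, ⟨h1.symm, h2.symm⟩, h4⟩

theorem path_of_walk (h : HoldsInput A s I m) {q₀ q : ℕ} {f : ℕ → ℕ} (hw : RAM.Walk I m q₀ q f) :
    ∃ r, LabelPath A.natStep q₀ r q ∧ ∀ x : Fin v, f x = opCount x r := by
  induction hw with
  | nil => exact ⟨[], .nil _, fun x => rfl⟩
  | @snoc j p q f _ hj hp hq ih =>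
    obtain ⟨r, hr, hf⟩ := ih
    obtain ⟨p', o, q', hs, hp', ho, hq'⟩ := h.sound j hj
    obtain rfl : p' = p := hp'.symm.trans hp
    obtain rfl : q' = q := hq'.symm.trans hq
    rcases o with _ | c
    · simp only [encodeLabel, List.cons.injEq, and_true] at ho
      refine ⟨r ++ [], hr.append (.eps hs (.nil _)), fun x => ?_⟩
      beta_reduce
      rw [if_neg (by omega), List.append_nil, hf, add_zero]
    · refine ⟨r ++ [c], hr.append (.cons hs (.nil _)), fun x => ?_⟩
      beta_reduce
      rw [opCount_append, hf]
      congr 1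
      rcases c with a | y | y <;>
        simp only [encodeLabel, List.cons.injEq, and_true] at ho <;>
        simp only [← ho.1, ← ho.2, opCount, List.count_singleton, Fin.ext_iff, beq_iff_eq,
          RefSymbol.opens.injEq, RefSymbol.closes.injEq, reduceCtorEq, if_false]
      · simp
      · simp [eq_comm]
      · simp [eq_comm]

/-- Once propagation has stabilised, every state reachable from a marked one is marked, so each
reachable state has a recorded status row. -/
theorem mark_of_path (h : HoldsInput A s I m) {mark : ℕ → ℕ}
    (hc : ∀ j < m, mark (I (6 + 4 * j)) ≠ 0 → mark (I (9 + 4 * j)) ≠ 0) {p q : ℕ}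
    {r : List (RefSymbol (Fin k) (Fin v))} (hr : LabelPath A.natStep p r q) (hp : mark p ≠ 0) :
    mark q ≠ 0 := by
  have hs : ∀ p o q, A.natStep p o q → mark p ≠ 0 → mark q ≠ 0 := fun p o q hs hp => by
    obtain ⟨j, hj, rfl, -, rfl⟩ := (h.step_iff _ _ _).1 hs
    exact hc j hj hp
  induction hr with
  | nil p => exact hp
  | eps h' _ ih => exact ih (hs _ _ _ h' hp)
  | cons h' _ ih => exact ih (hs _ _ _ h' hp)

end HoldsInput

namespace RAM

/-! ### The whole program -/

/-- Compute the tables of the layered graph. -/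
def prepare : Cmd :=
  .seq buildLists (.seq initClosure
  (.seq (.assign 8 (.reg 0)) (.seq (.assign 9 (.const 0)) (.seq (.assign 10 (.const 0))
  (.seq (.assign 11 (.const 0)) (.seq expandPairs (.seq letterBlocks (.seq levelBlocks
  (.seq statuses (.seq keys aliveNodes))))))))))

/-- Read the size parameters. -/
def readHeader : Cmd :=
  .seq (.assign 0 (.load 0 (.const 0))) (.seq (.assign 1 (.load 0 (.const 1)))
  (.seq (.assign 2 (.load 0 (.const 2))) (.seq (.assign 3 (.load 0 (.const 3)))
  (.seq (.assign 4 (.load 0 (.const 4))) (.seq (.assign 5 (.load 0 (.const 5)))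
  (.assign 6 (.add (.reg 3) (.const 1))))))))

/-- List the answers, unless there are more variables than states. -/
def solve : Cmd :=
  .seq readHeader (.branch (.lt (.reg 0) (.reg 1)) .skip (.seq prepare enumerate))

/-- Silent reachability in the transition table `I`. -/
def SilentReach (I : ℕ → ℕ) (m : ℕ) : ℕ → ℕ → Prop :=
  Relation.ReflTransGen (AdjStep (fun q => silentFrom I q m) fun e => I (9 + 4 * e))

/-- The edges of level `j` of the layered graph. -/
def LevelEdge (I : ℕ → ℕ) (m : ℕ) : ℕ → ℕ → ℕ → Prop
  | 0, p, q => SilentReach I m p q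
  | i + 1, p, q => ∃ j < m, I (7 + 4 * j) = 1 ∧ I (8 + 4 * j) = I (i + (6 + 4 * m)) ∧
      I (6 + 4 * j) = p ∧ SilentReach I m (I (9 + 4 * j)) q

/-- A time bound for the computation of the tables. -/
def prepareTime (n m l v : ℕ) : ℕ :=
  m * 60 + 6 + (n * 30 + 6) + 20 + (100 * (n * m + n * n) + 10) + (m * (n * 60 + 100) + 6) +
    (l * 40 + 6) + ((n + 1) * (m * 60 + 50) + n * (v * 40 + 200) + 20) + (n * (v * 60 + 40) + 20) +
    ((l + 1) * (n * (n * 60 + 60) + 60) + 20)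

/-- A bound for all numbers that occur in a computation. -/
def sizeBound (k n m l : ℕ) : ℕ :=
  (k + 1) * n * n + (k + 1) * n + (l + 2) * n + 3 * (n * n) + k + l + n + 4 * m + 20

theorem prepare_spec {w k n v m l q₀ qf : ℕ} {I : ℕ → ℕ} {σ : State}
    (hσ : Ctx n v m l q₀ qf I σ) (hvn : v ≤ n) (hq₀ : q₀ < n) (hqf : qf < n)
    (hI : ∀ j < m, I (6 + 4 * j) < n ∧ I (9 + 4 * j) < n ∧ (I (7 + 4 * j) = 1 → I (8 + 4 * j) < k) ∧
      (1 < I (7 + 4 * j) → I (8 + 4 * j) < v))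
    (hs : ∀ i < l, I (i + (6 + 4 * m)) < k) (hz : ∀ a, a ≠ 0 → ∀ x, σ.mem a x = 0)
    (hB : sizeBound k n m l < modulus w) :
    WP w prepare (fun τ => ∃ mark st key, StatusInv n v m q₀ I mark st ∧
      (∀ j < m, mark (I (6 + 4 * j)) ≠ 0 → mark (I (9 + 4 * j)) ≠ 0) ∧
      (∀ q < n, key q ≠ 0) ∧
      (∀ q < n, ∀ q' < n, key q = key q' ↔ ∀ x < v, st (q * n + x) = st (q' * n + x)) ∧
      Tables k n l (LevelEdge I m) (AliveAt n (l + 1) qf (LevelEdge I m)) key st τ ∧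
      τ.clock ≤ σ.clock + prepareTime n m l v) σ := by
  rw [sizeBound] at hB
  have hnn : n ≤ n * n := Nat.le_mul_self n
  refine WP.seq ((buildLists_spec hσ (hz 1 (by decide)) (by omega)).mono ?_)
  rintro σ₁ hf₁ ⟨hlink, ht₁⟩
  have hc₁ := hσ.frame hf₁ (by decide)
  -- The arrays that later phases expect to be zero are carried along; each phase preserves those it
  -- does not write.
  have hz₁ : ∀ a ∈ [3, 6, 7, 8, 10, 15], ∀ x, σ₁.mem a x = 0 := fun a ha x => by
    rw [hf₁.mem a ((by decide : ∀ a ∈ [3, 6, 7, 8, 10, 15], a ∉ buildLists.arrs) a ha)]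
    exact hz a ((by decide : ∀ a ∈ [3, 6, 7, 8, 10, 15], a ≠ 0) a ha) x
  refine WP.seq ((initClosure_spec hc₁ (hz₁ 3 (by decide)) (by omega)).mono ?_)
  rintro σ₂ hf₂ ⟨h3, h45, ht₂⟩
  have hc₂ := hc₁.frame hf₂ (by decide)
  have hz₂ : ∀ a ∈ [6, 7, 8, 10, 15], ∀ x, σ₂.mem a x = 0 := fun a ha x => by
    rw [hf₂.mem a ((by decide : ∀ a ∈ [6, 7, 8, 10, 15], a ∉ initClosure.arrs) a ha)]
    exact hz₁ a ((by decide : ∀ a ∈ [6, 7, 8, 10, 15], a ∈ [3, 6, 7, 8, 10, 15]) a ha) x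
  have hlink₂ : ∀ q, Linked (σ₂.mem 2) (σ₂.mem 1 q) (silentFrom I q m) := by
    rw [hf₂.mem 1 (by decide), hf₂.mem 2 (by decide)]
    exact hlink
  refine WP.seq (WP.assign trivial (WP.seq (WP.assign (by simp; omega) (WP.seq
    (WP.assign (by simp; omega) (WP.seq (WP.assign (by simp; omega) (WP.seq ?_))))))))
  have hc₃ := ((((hc₂.setReg (show 6 < 8 by decide) ((Expr.reg 0).val σ₂) ((Expr.reg 0).cost + 1)).setReg
    (show 6 < 9 by decide) 0 2).setReg (show 6 < 10 by decide) 0 2).setReg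
    (show 6 < 11 by decide) 0 2)
  refine (expandPairs_spec hc₃ (by omega) (by simp [hc₂.hn]) (by simp) (by simp) (by simp)
    (by simpa using h3) (by simpa using h45) (by simpa using hlink₂) (fun q e he => ?_)
    (sum_length_silentFrom_le I n m) (by omega)).mono ?_
  · have := (mem_silentFrom.1 he).1
    exact ⟨this, (hI e this).2.1⟩
  rintro σ₃ hf₃ ⟨hcl, hout, ht₃⟩
  have hc₄ := hc₃.frame hf₃ (by decide)
  have hz₃ : ∀ a ∈ [6, 7, 8, 10, 15], ∀ x, σ₃.mem a x = 0 := fun a ha x => by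
    rw [hf₃.mem a ((by decide : ∀ a ∈ [6, 7, 8, 10, 15], a ∉ expandPairs.arrs) a ha)]
    simpa using hz₂ a ha x
  refine WP.seq ((letterBlocks_spec (k := k) hc₄ hout
    (fun j hj => ⟨(hI j hj).1, (hI j hj).2.1, (hI j hj).2.2.1⟩) (by omega)).mono ?_)
  rintro σ₄ hf₄ ⟨hlow, hblk, ht₄⟩
  have hc₅ := hc₄.frame hf₄ (by decide)
  have hz₄ : ∀ a ∈ [6, 7, 8, 10, 15], ∀ x, σ₄.mem a x = 0 := fun a ha x => by
    rw [hf₄.mem a ((by decide : ∀ a ∈ [6, 7, 8, 10, 15], a ∉ letterBlocks.arrs) a ha)]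
    exact hz₃ a ha x
  refine WP.seq ((levelBlocks_spec (k := k) hc₅ hs (hz₄ 15 (by decide) 0) (by omega)).mono ?_)
  rintro σ₅ hf₅ ⟨h150, h15, ht₅⟩
  have hc₆ := hc₅.frame hf₅ (by decide)
  have hz₅ : ∀ a ∈ [6, 7, 8, 10], ∀ x, σ₅.mem a x = 0 := fun a ha x => by
    rw [hf₅.mem a ((by decide : ∀ a ∈ [6, 7, 8, 10], a ∉ levelBlocks.arrs) a ha)]
    exact hz₄ a ((by decide : ∀ a ∈ [6, 7, 8, 10], a ∈ [6, 7, 8, 10, 15]) a ha) x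
  refine WP.seq ((statuses_spec hc₆ hvn hq₀ (hz₅ 6 (by decide)) (hz₅ 7 (by decide))
    (fun j hj => ⟨(hI j hj).1, (hI j hj).2.1, (hI j hj).2.2.2⟩) (by omega)).mono ?_)
  rintro σ₆ hf₆ ⟨hst, hcm, ht₆⟩
  have hc₇ := hc₆.frame hf₆ (by decide)
  refine WP.seq ((keys_spec hc₇ hvn hst.le_two (fun x => by
    rw [hf₆.mem 8 (by decide)]; exact hz₅ 8 (by decide) x) (by omega)).mono ?_)
  rintro σ₇ hf₇ ⟨hk0, hkey, ht₇⟩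
  have hc₈ := hc₇.frame hf₇ (by decide)
  have e15 : σ₇.mem 15 = σ₅.mem 15 := by rw [hf₇.mem 15 (by decide), hf₆.mem 15 (by decide)]
  have e3 : σ₇.mem 3 = σ₄.mem 3 := by
    rw [hf₇.mem 3 (by decide), hf₆.mem 3 (by decide), hf₅.mem 3 (by decide)]
  have hcl' : ∀ a < n, ∀ b < n, σ₃.mem 3 (a * n + b) ≠ 0 ↔ SilentReach I m a b := fun a ha b hb => by
    rw [SilentReach, hcl a ha b]
    exact ⟨fun h => ⟨hb, h⟩, fun h => h.2⟩
  have hEd : ∀ j ≤ l, ∀ p < n, ∀ q < n,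
      σ₇.mem 3 ((σ₇.mem 15 j * n + p) * n + q) ≠ 0 ↔ LevelEdge I m j p q := by
    intro j hj p hp q hq
    rw [e15, e3]
    cases j with
    | zero =>
      rw [h150, zero_mul, zero_add, hlow _ (cell_lt hp hq), hcl' p hp q hq, LevelEdge]
    | succ i =>
      rw [h15 i (by omega), hblk _ p hp q hq, LevelEdge]
      refine exists_congr fun e => and_congr_right fun he => ?_
      rw [hcl' _ (hI e he).2.1 q hq]
  have hk : ∀ j ≤ l, σ₇.mem 15 j ≤ k := by
    intro j hj
    rw [e15]
    cases j with
    | zero => omega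
    | succ i => rw [h15 i (by omega)]; exact hs i (by omega)
  refine (aliveNodes_spec (k := k) hc₈ hqf (fun x => by
    rw [hf₇.mem 10 (by decide), hf₆.mem 10 (by decide)]; exact hz₅ 10 (by decide) x) hk hEd
    (by omega)).mono ?_
  rintro τ hf ⟨hal, ht⟩
  refine ⟨σ₆.mem 6, σ₆.mem 7, σ₇.mem 9, hst, hcm, hk0, hkey, ⟨?_, ?_, hal, ?_, ?_⟩, ?_⟩
  · rw [hf.mem 3 (by decide), hf.mem 15 (by decide)]
    exact hEd
  · rw [hf.mem 15 (by decide)]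
    exact hk
  · rw [hf.mem 9 (by decide)]
  · rw [hf.mem 7 (by decide), hf₇.mem 7 (by decide)]
  · simp only [State.setReg_clock, Expr.cost] at ht₃
    rw [prepareTime]
    omega

theorem readHeader_spec {w n v m l q₀ qf : ℕ} {xs : List ℕ} (hB : l + 20 < modulus w) :
    WP w readHeader (fun τ =>
      Ctx n v m l q₀ qf (fun i => ([n, v, m, l, q₀, qf] ++ xs).getD i 0) τ ∧
      (∀ a, a ≠ 0 → ∀ x, τ.mem a x = 0) ∧ τ.buf = [] ∧ τ.log = [] ∧ τ.clock ≤ 40)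
      (State.init ([n, v, m, l, q₀, qf] ++ xs)) := by
  have h : ∀ i < 7, i < modulus w := fun i hi => by omega
  refine WP.seq (WP.assign (h 0 (by omega)) (WP.seq (WP.assign (h 1 (by omega)) (WP.seq (WP.assign
    (h 2 (by omega)) (WP.seq (WP.assign (h 3 (by omega)) (WP.seq (WP.assign (h 4 (by omega)) (WP.seq
    (WP.assign (h 5 (by omega)) (WP.assign ?_ ?_))))))))))))
  · simp [State.init]
    omega
  · refine ⟨⟨?_, ?_, ?_, ?_, ?_, ?_, ?_, ?_⟩, fun a ha x => ?_, rfl, rfl, ?_⟩ <;>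
      simp [State.init]
    exact fun h => absurd h ha

/-! ### Ranges of states, word size and running time. -/

theorem SilentReach.lt {I : ℕ → ℕ} {m n a b : ℕ} (h : SilentReach I m a b)
    (hI : ∀ j < m, I (9 + 4 * j) < n) (ha : a < n) : b < n := by
  induction h with
  | refl => exact ha
  | tail _ hs _ =>
    obtain ⟨e, he, rfl⟩ := hs
    exact hI e (mem_silentFrom.1 he).1

theorem LevelEdge.lt {I : ℕ → ℕ} {m n j a b : ℕ} (h : LevelEdge I m j a b)
    (hI : ∀ j < m, I (9 + 4 * j) < n) (ha : a < n) : b < n := by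
  cases j with
  | zero => exact SilentReach.lt h hI ha
  | succ i =>
    obtain ⟨e, he, -, -, -, h⟩ := h
    exact h.lt hI (hI e he)

/-- With `w` this large, `2 ^ w ≥ (N + 1) ^ (k + 10)`. Two of the factors supply `(N + 1) ^ 2`; as
`N + 1 ≥ 2`, eight supply `256 = 2 ^ 8`, and `k` supply `2 ^ k ≥ k + 1`. -/
theorem le_modulus_wordSize (k : ℕ) {N : ℕ} (hN : 0 < N) :
    (N + 1) * (N + 1) * (256 * (k + 1)) ≤ modulus (wordSize (k + 10) N) := by
  have h1 : N + 1 ≤ 2 ^ (Nat.log 2 N + 1) := Nat.lt_pow_succ_log_self (by decide) N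
  have h2 : modulus (wordSize (k + 10) N) = (2 ^ (Nat.log 2 N + 1)) ^ (k + 10) := by
    rw [modulus, wordSize, mul_comm, pow_mul]
  have h3 : k + 1 ≤ 2 ^ k := Nat.lt_two_pow_self
  calc (N + 1) * (N + 1) * (256 * (k + 1)) ≤ (N + 1) * (N + 1) * (256 * 2 ^ k) := by gcongr
    _ = (N + 1) ^ 2 * 2 ^ (k + 8) := by ring
    _ ≤ (N + 1) ^ 2 * (N + 1) ^ (k + 8) := by gcongr; omega
    _ = (N + 1) ^ (k + 10) := by ring
    _ ≤ (2 ^ (Nat.log 2 N + 1)) ^ (k + 10) := by gcongr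
    _ = _ := h2.symm

theorem sizeBound_lt {k n m l N : ℕ} (hn : 0 < n) (hN : n + m + l ≤ N) :
    sizeBound k n m l < modulus (wordSize (k + 10) N) := by
  refine lt_of_lt_of_le ?_ (le_modulus_wordSize k (by omega))
  set M := N + 1 with hM
  have hMM : M ≤ M * M := Nat.le_mul_self M
  have h1 : 1 ≤ M * M := Nat.mul_pos (by omega) (by omega)
  have e1 : (k + 1) * n * n ≤ (k + 1) * (M * M) := by
    rw [mul_assoc]; gcongr <;> omega
  have e2 : (k + 1) * n ≤ (k + 1) * (M * M) := by gcongr; omega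
  have e3 : (l + 2) * n ≤ 2 * (M * M) := by
    calc (l + 2) * n ≤ (2 * M) * M := by gcongr <;> omega
      _ = 2 * (M * M) := by ring
  have e4 : n * n ≤ M * M := by gcongr <;> omega
  have e5 : k + 1 ≤ (k + 1) * (M * M) := Nat.le_mul_of_pos_right _ h1
  have e6 : M * M ≤ (k + 1) * (M * M) := Nat.le_mul_of_pos_left _ (by omega)
  have e7 : M * M * (256 * (k + 1)) = 256 * ((k + 1) * (M * M)) := by ring
  rw [sizeBound, e7]
  omega

/-- Everything reduces to the monomials `n * n * (l + 1)` and `m * n`. The terms with `v`, such as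
`v * (l + 1)` for printing, are absorbed by `v ≤ n`. -/
theorem time_le {n m l v : ℕ} (hn : 0 < n) (hvn : v ≤ n) :
    stepTime n * (2 * l + 2) + printTime v l ≤ 2000 * (n ^ 2 * (l + 1)) ∧
    41 + 4 + prepareTime n m l v + stepTime n * (l + 2) + printTime v l + 20 ≤
      4000 * (n ^ 2 * (l + 1) + m * n) := by
  have h1 : n ≤ n * n := Nat.le_mul_self n
  have h2 : n * n ≤ n * n * (l + 1) := Nat.le_mul_of_pos_right _ (by omega)
  have h3 : n * (l + 1) ≤ n * n * (l + 1) := by gcongr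
  have h4 : l + 1 ≤ n * (l + 1) := Nat.le_mul_of_pos_left _ hn
  have h5 : m ≤ m * n := Nat.le_mul_of_pos_right _ hn
  have h6 : n * v ≤ n * n := by gcongr
  have h7 : v * (l + 1) ≤ n * (l + 1) := by gcongr
  have h8 : n * m = m * n := mul_comm _ _
  have e1 : stepTime n * (2 * l + 2) =
      120 * (n * n * (l + 1)) + 480 * (n * (l + 1)) + 400 * (l + 1) := by
    rw [stepTime]; ring
  have e2 : stepTime n * (l + 2) ≤ stepTime n * (2 * l + 2) := by gcongr; omega
  have e3 : printTime v l = 60 * (v * (l + 1)) + 40 * v + 20 := by rw [printTime]; ring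
  have e4 : prepareTime n m l v = 160 * m + 220 * (m * n) + 320 * n + 100 * (n * n) +
      40 * l + 100 * (n * v) + 60 * (n * n * (l + 1)) + 60 * (n * (l + 1)) + 60 * (l + 1) +
      60 * m + 164 := by
    rw [prepareTime]; ring
  have e5 : n ^ 2 * (l + 1) = n * n * (l + 1) := by ring
  omega

end RAM

/-! ### Runs of the automaton as paths of the layered graph. -/

namespace HoldsInput

variable {k v n m : ℕ} {A : VSetAutomaton (Fin k) (Fin v) (Fin n)} {s : List (Fin k)} {I : ℕ → ℕ}

theorem silentReach_iff (h : HoldsInput A s I m) {p q : ℕ} :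
    Relation.ReflTransGen (SilentStep A.natStep) p q ↔ RAM.SilentReach I m p q := by
  have : SilentStep A.natStep =
      RAM.AdjStep (fun q => RAM.silentFrom I q m) (fun e => I (9 + 4 * e)) := by
    funext p q
    exact propext h.silent_step_iff
  rw [this, RAM.SilentReach]

/-- Level `i + 1` of the graph carries the state of gap `i`: the edge at level `0` is a silent path,
and the one at level `i + 1` reads letter `i` and then moves silently. -/
theorem gapRun_iff (h : HoldsInput A s I m) {p f : ℕ} {run : ℕ → ℕ} :
    GapRun A.natStep p f s run ↔ RAM.LevelEdge I m 0 p (run 0) ∧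
      (∀ i < s.length, RAM.LevelEdge I m (i + 1) (run i) (run (i + 1))) ∧ run s.length = f := by
  have hnext : ∀ i (hi : i < s.length), (∃ p', A.natStep (run i) (some (.letter s[i])) p' ∧
      Relation.ReflTransGen (SilentStep A.natStep) p' (run (i + 1))) ↔
      RAM.LevelEdge I m (i + 1) (run i) (run (i + 1)) := by
    intro i hi
    simp only [h.letter_step_iff, h.silentReach_iff, RAM.LevelEdge, h.letters i hi]
    constructor
    · rintro ⟨p', ⟨j, hj, h1, h2, h3, rfl⟩, h4⟩
      exact ⟨j, hj, h1, h2, h3, h4⟩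
    · rintro ⟨j, hj, h1, h2, h3, h4⟩
      exact ⟨_, ⟨j, hj, h1, h2, h3, rfl⟩, h4⟩
  constructor
  · rintro ⟨h1, h2, h3⟩
    exact ⟨h.silentReach_iff.1 h1, fun i hi => (hnext i hi).1 (h2 i hi), h3⟩
  · rintro ⟨h1, h2, h3⟩
    exact ⟨h.silentReach_iff.2 h1, fun i hi => (hnext i hi).2 (h2 i hi), h3⟩

theorem run_lt (h : HoldsInput A s I m) {p f : ℕ} (hp : p < n) {run : ℕ → ℕ}
    (hrun : GapRun A.natStep p f s run) {i : ℕ} (hi : i ≤ s.length) : run i < n := by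
  obtain ⟨h1, h2, -⟩ := h.gapRun_iff.1 hrun
  have hI : ∀ j < m, I (9 + 4 * j) < n := fun j hj => (h.bounds hj).2.1
  induction i with
  | zero => exact h1.lt hI hp
  | succ i ih => exact (h2 i (by omega)).lt hI (ih (by omega))

theorem mem_wordsFrom_iff (h : HoldsInput A s I m) {p f : ℕ} (hp : p < n) {key : ℕ → ℕ}
    (hkey : ∀ q < n, key q ≠ 0) {u : List ℕ} :
    u ∈ wordsFrom (RAM.candSet n (RAM.LevelEdge I m)
      (RAM.AliveAt n (s.length + 1) f (RAM.LevelEdge I m))) key (s.length + 1) 0 {p} ↔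
    ∃ run, GapRun A.natStep p f s run ∧
      u = (List.range (s.length + 1)).map fun i => key (run i) := by
  rw [mem_wordsFrom (fun j S q => RAM.mem_candSet) (fun j S q hq => by
    obtain ⟨-, -, h, -⟩ := RAM.mem_candSet.1 hq
    exact hkey q h) (Finset.singleton_nonempty p)]
  simp only [Finset.mem_singleton, zero_add]
  constructor
  · rintro ⟨run, hr0, hrun, rfl⟩
    refine ⟨fun i => run (i + 1), h.gapRun_iff.2 ⟨?_, fun i hi => (hrun (i + 1) (by omega)).2.1, ?_⟩,
      rfl⟩
    · rw [← hr0]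
      exact (hrun 0 (by omega)).2.1
    · exact RAM.aliveAt_last.1 (hrun s.length (by omega)).2.2
  · rintro ⟨run, hrun, rfl⟩
    obtain ⟨h1, h2, h3⟩ := h.gapRun_iff.1 hrun
    -- The run is extended by `p` at level `0`. It is also its own witness that all its nodes are
    -- live, so discarding the other nodes loses no word.
    have hedge : ∀ i < s.length + 1, (fun i => Nat.casesOn i p run : ℕ → ℕ) (i + 1) < n ∧
        RAM.LevelEdge I m i ((fun i => Nat.casesOn i p run : ℕ → ℕ) i)
          ((fun i => Nat.casesOn i p run : ℕ → ℕ) (i + 1)) := by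
      intro i hi
      refine ⟨h.run_lt hp hrun (by omega), ?_⟩
      cases i with
      | zero => exact h1
      | succ i => exact h2 i (by omega)
    refine ⟨fun i => Nat.casesOn i p run, rfl, fun i hi => ⟨(hedge i hi).1, (hedge i hi).2,
      _, rfl, h3, fun j _ hj => hedge j hj⟩, rfl⟩

end HoldsInput

/-! ### Assembly: the program lists the tuples. -/

theorem VSetAutomaton.natPath_lt {k v n : ℕ} {A : VSetAutomaton (Fin k) (Fin v) (Fin n)} {p q : ℕ}
    {r : List (RefSymbol (Fin k) (Fin v))} (h : LabelPath A.natStep p r q) (hp : p < n) :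
    q < n := by
  have hs : ∀ p o q, A.natStep p o q → q < n := by
    rintro p o q ⟨_, q', -, -, rfl⟩
    exact q'.isLt
  induction h with
  | nil p => exact hp
  | eps h' _ ih => exact ih (hs _ _ _ h')
  | cons h' _ ih => exact ih (hs _ _ _ h')

theorem RAM.spanEnds_congr {l : ℕ} {f g : ℕ → ℕ} (h : ∀ j ≤ l, f j = g j) :
    RAM.spanEnds l f = RAM.spanEnds l g := by
  have h' : ∀ j ∈ Finset.range (l + 1), f j = g j := fun j hj =>
    h j (by rw [Finset.mem_range] at hj; omega)
  have e1 : ∑ j ∈ Finset.range (l + 1), eqVal (f j) 0 = ∑ j ∈ Finset.range (l + 1), eqVal (g j) 0 :=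
    Finset.sum_congr rfl fun j hj => by rw [h' j hj]
  have e2 : ∑ j ∈ Finset.range (l + 1), ltVal (f j) 2 = ∑ j ∈ Finset.range (l + 1), ltVal (g j) 2 :=
    Finset.sum_congr rfl fun j hj => by rw [h' j hj]
  rw [spanEnds, spanEnds, e1, e2]

theorem flatMap_range_eq_encodeTuple {S : Type*} {v : ℕ} {s : List S} {μ : SpanTuple (Fin v) s}
    {g : ℕ → List ℕ} (hg : ∀ x : Fin v, g x = [(μ x).left, (μ x).right]) :
    (List.range v).flatMap g = encodeTuple μ := by
  rw [encodeTuple, ← List.map_coe_finRange_eq_range, List.flatMap_map]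
  exact List.flatMap_congr fun x _ => hg x

theorem numTransitions_eq_length {S V Q : Type*} {A : VSetAutomaton S V Q}
    {ts : List (Q × Option (RefSymbol S V) × Q)} (hnd : ts.Nodup)
    (hts : ∀ t, t ∈ ts ↔ t ∈ A.transitions) : A.numTransitions = ts.length := by
  classical
  have : A.transitions = (ts.toFinset : Set _) := by
    ext t
    simp [hts]
  rw [VSetAutomaton.numTransitions, this, Set.ncard_coe_finset, List.toFinset_card_of_nodup hnd]

theorem solve_enumerates {k v n : ℕ} (A : VSetAutomaton (Fin k) (Fin v) (Fin n))
    (ts : List (Fin n × Option (RefSymbol (Fin k) (Fin v)) × Fin n)) (s : List (Fin k))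
    (hA : A.Functional) (hts : ∀ t, t ∈ ts ↔ t ∈ A.transitions) {w : ℕ}
    (hB : RAM.sizeBound k n ts.length s.length < RAM.modulus w) :
    ∃ answers : List (SpanTuple (Fin v) s),
      answers.Nodup ∧ (∀ μ, μ ∈ answers ↔ μ ∈ A.spanRelation s) ∧
      RAM.Enumerates w RAM.solve (encodeInput A ts s) (answers.map encodeTuple)
        (4000 * (n ^ 2 * (s.length + 1) + ts.length * n)) (2000 * (n ^ 2 * (s.length + 1))) := by
  have hn : 0 < n := A.start.pos
  have hB' := hB
  rw [RAM.sizeBound] at hB'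
  have hin := holdsInput_encodeInput (A := A) s hts
  set I := fun i => (encodeInput A ts s).getD i 0 with hI
  have hheader : RAM.WP w RAM.readHeader (fun τ =>
      RAM.Ctx n v ts.length s.length A.start A.final I τ ∧ (∀ a, a ≠ 0 → ∀ x, τ.mem a x = 0) ∧
      τ.buf = [] ∧ τ.log = [] ∧ τ.clock ≤ 40) (RAM.State.init (encodeInput A ts s)) := by
    rw [hI, encodeInput_eq]
    exact RAM.readHeader_spec (by omega)
  by_cases hv : n < v
  · refine ⟨[], List.nodup_nil, fun μ => ?_, ?_⟩
    · rw [A.spanRelation_eq_empty_of_lt hA hv]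
      simp
    -- The time bound is at least `4000`, more than reading the header and one test cost.
    · have hX : 1 ≤ n ^ 2 * (s.length + 1) := Nat.mul_pos (by positivity) (by omega)
      refine RAM.WP.seq (hheader.mono ?_)
      rintro σ - ⟨hc, -, hbuf, hlog, ht⟩
      refine RAM.WP.branch ⟨trivial, trivial⟩ (fun _ => RAM.WP.skip ⟨?_, ?_, ?_, ?_⟩) (fun h => ?_)
      · simpa using hbuf
      · simp [hlog]
      · simp [hlog]
        omega
      · simp [hlog]
      · simp [hc.hn, hc.hv, hv] at h
  rw [not_lt] at hv
  obtain ⟨hdelay, hpre⟩ := RAM.time_le (m := ts.length) (l := s.length) hn hv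
  have hval : ∀ r, LabelPath A.natStep A.start r A.final → ValidRefWord r := fun r hr =>
    hA r (VSetAutomaton.mem_refLanguage_iff_natPath.2 hr)
  have hrun : RAM.WP w RAM.solve (fun τ => ∃ answers : List (SpanTuple (Fin v) s),
      answers.Nodup ∧ (∀ μ, μ ∈ answers ↔ μ ∈ A.spanRelation s) ∧ τ.buf = [] ∧
      τ.log.map Prod.snd = answers.map encodeTuple ∧
      OnTime (4000 * (n ^ 2 * (s.length + 1) + ts.length * n)) (2000 * (n ^ 2 * (s.length + 1)))
        (τ.log.map Prod.fst) τ.clock) (RAM.State.init (encodeInput A ts s)) := by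
    refine RAM.WP.seq (hheader.mono ?_)
    rintro σ - ⟨hc, hz, hbuf, hlog, ht⟩
    refine RAM.WP.branch ⟨trivial, trivial⟩ (fun h => ?_) (fun _ => RAM.WP.seq ?_)
    · simp [hc.hn, hc.hv] at h
      omega
    refine (RAM.prepare_spec (k := k) (hc.tick _) hv A.start.isLt A.final.isLt
      (fun j hj => hin.bounds hj) (fun i hi => by rw [hin.letters i hi]; exact Fin.isLt _)
      (by simpa using hz) hB).mono ?_
    rintro σ' hf ⟨mark, st, key, hst, hmark, hk0, hkey, htab, ht'⟩
    have hc' := (hc.tick _).frame hf (by decide)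
    -- Every reachable state is marked, and its row holds the capped counts of some path, which is
    -- all that `isStatus_of_exists` asks for.
    have hstatus : IsStatus A.natStep (A.start : ℕ) A.final
        fun q (x : Fin v) => st (q * n + x) := by
      refine isStatus_of_exists hval fun q r hr => ?_
      have hq : q < n := VSetAutomaton.natPath_lt hr A.start.isLt
      obtain ⟨f, hw, hf⟩ := hst.walk q hq (hin.mark_of_path hmark hr hst.start)
      obtain ⟨r', hr', hop⟩ := hin.path_of_walk hw
      exact ⟨r', hr', fun x => by rw [hf x x.isLt, hop]⟩
    -- A word of keys is turned into output through any states with these keys; the choice is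
    -- immaterial, as equal keys mean equal status rows.
    set out : List ℕ → List ℕ := fun u => (List.range v).flatMap fun x =>
      RAM.spanEnds s.length fun j =>
        st ((Classical.epsilon fun q => q < n ∧ key q = u.getD j 0) * n + x) with hout
    have hout' : ∀ rep lim : ℕ → ℕ, (∀ j ≤ s.length, rep j < n ∧ key (rep j) = lim j) →
        ((List.range v).flatMap fun x => RAM.spanEnds s.length fun j => st (rep j * n + x)) =
          out ((List.range (s.length + 1)).map lim) := by
      intro rep lim h
      refine List.flatMap_congr fun x hx => RAM.spanEnds_congr fun j hj => ?_
      have hlim : ((List.range (s.length + 1)).map lim).getD j 0 = lim j := by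
        simp [List.getD_eq_getElem?_getD, show j < s.length + 1 by omega]
      rw [hlim]
      obtain ⟨h1, h2⟩ := Classical.epsilon_spec (p := fun q => q < n ∧ key q = lim j) ⟨_, h j hj⟩
      exact (hkey _ (h j hj).1 _ h1).1 ((h j hj).2.trans h2.symm) x (List.mem_range.1 hx)
    obtain ⟨answers, hnd, hmem, hans⟩ := exists_tuples_of_words hval hstatus (s := s) (key := key)
      (X := {q | q < n}) (fun run hrun i hi => hin.run_lt A.start.isLt hrun hi)
      (fun q hq q' hq' => (hkey q hq q' hq').trans
        ⟨fun h x => h x x.isLt, fun h x hx => h ⟨x, hx⟩⟩)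
      (nodup_wordsFrom _ _ _) (fun u => hin.mem_wordsFrom_iff A.start.isLt hk0) (out := out)
      (enc := encodeTuple) (fun run μ hrun hs => by
        rw [← hout' run _ fun j hj => ⟨hin.run_lt A.start.isLt hrun hj, rfl⟩]
        exact flatMap_range_eq_encodeTuple fun x => hs.spanEnds x)
    refine (RAM.enumerate_spec (out := out)
      (pre := 4000 * (n ^ 2 * (s.length + 1) + ts.length * n)) hc' htab hv A.start.isLt hk0
      (fun j hj p _ h => (RAM.aliveAt_step (by omega)).1 h)
      (fun rep lim h => hout' (fun j => rep (j + 1)) lim h)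
      (fun x => by rw [hf.mem 11 (by decide)]; exact hz 11 (by decide) x)
      (fun x => by rw [hf.mem 12 (by decide)]; exact hz 12 (by decide) x)
      (by rw [hf.buf (by decide)]; exact hbuf) (by rw [hf.log (by decide)]; exact hlog)
      ?_ hdelay (by omega)).mono ?_
    · refine le_trans ?_ hpre
      simp at ht'
      omega
    · rintro τ - ⟨h1, h2, h3⟩
      refine ⟨answers, hnd, fun μ => ?_, h1, h2.trans hans.symm, h3⟩
      rw [hmem, VSetAutomaton.mem_spanRelation_iff]
  obtain ⟨τ, he, answers, hnd, hmem, hbuf, hlog, hon⟩ := hrun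
  exact ⟨answers, hnd, hmem, τ, he, hbuf, hlog, hon⟩

theorem mainTheorem1 (k : ℕ) :
    ∃ (p : RAM.Cmd) (c C : ℕ),
      ∀ (n v : ℕ) (A : VSetAutomaton (Fin k) (Fin v) (Fin n))
        (ts : List (Fin n × Option (RefSymbol (Fin k) (Fin v)) × Fin n)) (s : List (Fin k)),
        A.Functional → ts.Nodup → (∀ t, t ∈ ts ↔ t ∈ A.transitions) →
        ∃ answers : List (SpanTuple (Fin v) s),
          answers.Nodup ∧ (∀ μ, μ ∈ answers ↔ μ ∈ A.spanRelation s) ∧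
          RAM.Enumerates (wordSize c (n + v + A.numTransitions + s.length)) p
            (encodeInput A ts s) (answers.map encodeTuple)
            (C * (n ^ 2 * (s.length + 1) + A.numTransitions * n))
            (C * (n ^ 2 * (s.length + 1))) := by
  -- The factor `k + 10` comes from `le_modulus_wordSize`; `4000` is the larger of the two constants
  -- in `time_le`.
  refine ⟨RAM.solve, k + 10, 4000, fun n v A ts s hA hnd hts => ?_⟩
  rw [numTransitions_eq_length hnd hts]
  obtain ⟨answers, h1, h2, τ, he, hbuf, hlog, hon, hch⟩ := solve_enumerates A ts s hA hts
    (RAM.sizeBound_lt (k := k) A.start.pos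
      (show n + ts.length + s.length ≤ n + v + ts.length + s.length by omega))
  exact ⟨answers, h1, h2, τ, he, hbuf, hlog, hon, hch.imp fun t t' h => h.trans (by omega)⟩
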